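/- **Theorem.** Consider a word RAM with word length $w=\Theta(\log n)$: one step performs one addition, subtraction, multiplication (modulo $2^w$), division with remainder, bitwise operation, shift or comparison of $w$-bit words, one access to the working memory, one control operation, one query to the read-only input, or the output of one symbol to a write-only output. The working memory consists of all words that the program can write and read (its variables, temporaries and random-access memory), each counted as $w$ bits; its initial contents are arbitrary. The input is a directed graph $G=(V,E)$ with $V=\{0,\dots,n-1\}$ for a known integer $n\ge 1$, with $E\subseteq V\times V$, and with $m=|E|$; it is given by in/out adjacency arrays in arbitrary order with cross links, i.e. constant-time functions return the indegree and the outdegree of a vertex, its $i$th in- or outneighbor, and, for each edge $(u,v)$, the position of $u$ in the in-array of $v$ from that of $v$ in the out-array of $u$, and vice versa. Write $u\equiv v$ if $G$ contains a (possibly empty) path from $u$ to $v$ and one from $v$ to $u$. The strongly connected components of $G$ are the subgraphs induced by the equivalence classes of $\equiv$. To compute them with their vertices (with their edges, with their vertices and edges, respectively) means to output one block for each strongly connected component, with a separator symbol between consecutive blocks, such that the block of a component lists exactly its vertices (its edges, its vertices and its edges, respectively), each exactly once. Blocks, and the items within a block, may come in any order. Then for each of the three choices (vertices, edges, or both) there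 is a program that, for every such input, computes the strongly connected components of $G$ in $O(n+m)$ time with at most $$n\log_2 3+\tfrac{14}{5}m+O\bigl((\log_2 (n+1))^2\bigr)$$ bits of working memory. More precisely, there are a program and a constant $c$ such that for every constant $K$ there is a constant $C$ such that, for all $n\ge1$, all inputs with $n$ vertices, and all word lengths $w$ with $c(\lfloor\log_2 n\rfloor+1)\le w\le K(\lfloor\log_2 n\rfloor+1)$, the program runs in at most $C(n+m)$ steps and with at most $n\log_2 3+\frac{14}{5}m+C(\log_2(n+1))^2$ bits of working memory. -/

import Mathlib

/-! ### Directed graphs: size, strongly connected components, adjacency arrays -/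

/-- The number of edges of a digraph on `n` vertices. -/
noncomputable def edgeCount {n : ℕ} (G : Digraph (Fin n)) : ℕ :=
  {e : Fin n × Fin n | G.Adj e.1 e.2}.ncard

/-- `u` and `v` are equivalent if there is a (possibly empty) path from `u` to `v`
and one from `v` to `u`. -/
def StronglyEquiv {n : ℕ} (G : Digraph (Fin n)) (u v : Fin n) : Prop :=
  Relation.ReflTransGen G.Adj u v ∧ Relation.ReflTransGen G.Adj v u

/-- `A` is the vertex set of a strongly connected component of `G`,
i.e. an equivalence class of `StronglyEquiv G`. -/
def IsSCC {n : ℕ} (G : Digraph (Fin n)) (A : Set (Fin n)) : Prop :=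
  ∃ u : Fin n, A = {v | StronglyEquiv G u v}

/-- A representation of `G` by in/out adjacency arrays with cross links.  The out-array of `u`
lists the outneighbors of `u`, and the in-array of `v` lists the inneighbors of `v`, each once and
in an arbitrary order.  The cross links (`outMate`, `inMate`) of an edge `(u, v)` lead from the
position of `v` in the out-array of `u` to that of `u` in the in-array of `v`, and back. -/
structure AdjArrays {n : ℕ} (G : Digraph (Fin n)) where
  outDeg : Fin n → ℕ
  inDeg : Fin n → ℕ
  outHead : (u : Fin n) → Fin (outDeg u) → Fin n
  inHead : (v : Fin n) → Fin (inDeg v) → Fin n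
  outMate : (u : Fin n) → (i : Fin (outDeg u)) → Fin (inDeg (outHead u i))
  inMate : (v : Fin n) → (j : Fin (inDeg v)) → Fin (outDeg (inHead v j))
  outHead_injective : ∀ u, Function.Injective (outHead u)
  inHead_injective : ∀ v, Function.Injective (inHead v)
  exists_outHead_iff : ∀ u v, (∃ i, outHead u i = v) ↔ G.Adj u v
  exists_inHead_iff : ∀ v u, (∃ j, inHead v j = u) ↔ G.Adj u v
  inHead_outMate : ∀ u i, inHead (outHead u i) (outMate u i) = u
  outHead_inMate : ∀ v j, outHead (inHead v j) (inMate v j) = v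

/-- The access functions of the input. -/
inductive Query where
  | outDeg | inDeg | outHead | inHead | outMate | inMate

/-- The answer to a query with arguments `u`, `i` (the degree queries ignore `i`);
`none` if the arguments do not denote a vertex and a position in its array. -/
def AdjArrays.answer {n : ℕ} {G : Digraph (Fin n)} (R : AdjArrays G) :
    Query → ℕ → ℕ → Option ℕ
  | .outDeg, u, _ => if hu : u < n then some (R.outDeg ⟨u, hu⟩) else none
  | .inDeg, u, _ => if hu : u < n then some (R.inDeg ⟨u, hu⟩) else none
  | .outHead, u, i =>
      if hu : u < n then
        if hi : i < R.outDeg ⟨u, hu⟩ then some (R.outHead ⟨u, hu⟩ ⟨i, hi⟩ : ℕ) else none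
      else none
  | .inHead, u, i =>
      if hu : u < n then
        if hi : i < R.inDeg ⟨u, hu⟩ then some (R.inHead ⟨u, hu⟩ ⟨i, hi⟩ : ℕ) else none
      else none
  | .outMate, u, i =>
      if hu : u < n then
        if hi : i < R.outDeg ⟨u, hu⟩ then some (R.outMate ⟨u, hu⟩ ⟨i, hi⟩ : ℕ) else none
      else none
  | .inMate, u, i =>
      if hu : u < n then
        if hi : i < R.inDeg ⟨u, hu⟩ then some (R.inMate ⟨u, hu⟩ ⟨i, hi⟩ : ℕ) else none
      else none

/-! ### The word RAM

Words are `w`-bit strings.  A program has `k` word variables and a random-access working memory of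
`S` words.  The input is read-only and accessible only through `Query`; the output is a write-only
sequence of symbols. -/

/-- Unit-cost operations on words. -/
inductive WordOp where
  | add | sub | mul | div | mod | and | or | xor | shl | shr | eq | lt

/-- Arithmetic is unsigned and modulo `2 ^ w`; `x / 0 = 0` and `x % 0 = x`. -/
def WordOp.eval {w : ℕ} : WordOp → BitVec w → BitVec w → BitVec w
  | .add, a, b => a + b
  | .sub, a, b => a - b
  | .mul, a, b => a * b
  | .div, a, b => a / b
  | .mod, a, b => a % b
  | .and, a, b => a &&& b
  | .or, a, b => a ||| b
  | .xor, a, b => a ^^^ b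
  | .shl, a, b => a <<< b
  | .shr, a, b => a >>> b
  | .eq, a, b => if a = b then BitVec.ofNat w 1 else BitVec.ofNat w 0
  | .lt, a, b => if a.toNat < b.toNat then BitVec.ofNat w 1 else BitVec.ofNat w 0

/-- Expressions over the variables, natural-number constants, the number of vertices and
the word length. -/
inductive Expr (k : ℕ) where
  | const (c : ℕ)
  | numVertices
  | wordLength
  | var (x : Fin k)
  | op (o : WordOp) (e f : Expr k)

/-- The contents of the variables and of the working memory. -/
@[ext] structure State (w k : ℕ) where
  vars : Fin k → BitVec w
  mem : ℕ → BitVec w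

def State.setVar {w k : ℕ} (σ : State w k) (x : Fin k) (a : BitVec w) : State w k :=
  { σ with vars := Function.update σ.vars x a }

def State.setMem {w k : ℕ} (σ : State w k) (i : ℕ) (a : BitVec w) : State w k :=
  { σ with mem := Function.update σ.mem i a }

/-- The value of an expression, for an input graph with `n` vertices. -/
def Expr.eval {w k : ℕ} (n : ℕ) (σ : State w k) : Expr k → BitVec w
  | .const c => BitVec.ofNat w c
  | .numVertices => BitVec.ofNat w n
  | .wordLength => BitVec.ofNat w w
  | .var x => σ.vars x
  | .op o e f => o.eval (e.eval n σ) (f.eval n σ)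

/-- The number of nodes of an expression: the time needed to evaluate it, and a bound on the
number of temporary words that its evaluation occupies. -/
def Expr.size {k : ℕ} : Expr k → ℕ
  | .op _ e f => 1 + e.size + f.size
  | _ => 1

/-- Programs with `k` word variables. -/
inductive Cmd (k : ℕ) where
  | skip
  | assign (x : Fin k) (e : Expr k)
  | load (x : Fin k) (addr : Expr k)
  | store (addr e : Expr k)
  | query (x : Fin k) (q : Query) (u i : Expr k)
  | emitVertex (e : Expr k)
  | emitEdge (e f : Expr k)
  | emitSep
  | seq (c d : Cmd k)
  | ite (b : Expr k) (c d : Cmd k)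
  | loop (b : Expr k) (c : Cmd k)

/-- Symbols on the output: a vertex, an edge given by its tail and its head, or a separator. -/
inductive OutSymbol where
  | vertex (v : ℕ)
  | edge (u v : ℕ)
  | sep

/-- `Exec R S P σ t out σ'`: on the input graph represented by `R` and with `S` words of working
memory, the program `P`, started in `σ`, halts after exactly `t` steps in `σ'`, having written
`out`.  There is no execution if an address `≥ S` is accessed or a query has invalid arguments.
`ite b c d` and `loop b c` test whether `b` is nonzero. -/
inductive Exec {n : ℕ} {G : Digraph (Fin n)} (R : AdjArrays G) {w k : ℕ} (S : ℕ) :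
    Cmd k → State w k → ℕ → List OutSymbol → State w k → Prop where
  | skip (σ : State w k) : Exec R S .skip σ 1 [] σ
  | assign (σ : State w k) (x : Fin k) (e : Expr k) :
      Exec R S (.assign x e) σ (1 + e.size) [] (σ.setVar x (e.eval n σ))
  | load (σ : State w k) (x : Fin k) (addr : Expr k) (h : (addr.eval n σ).toNat < S) :
      Exec R S (.load x addr) σ (1 + addr.size) []
        (σ.setVar x (σ.mem (addr.eval n σ).toNat))
  | store (σ : State w k) (addr e : Expr k) (h : (addr.eval n σ).toNat < S) :
      Exec R S (.store addr e) σ (1 + addr.size + e.size) []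
        (σ.setMem (addr.eval n σ).toNat (e.eval n σ))
  | query (σ : State w k) (x : Fin k) (q : Query) (u i : Expr k) (r : ℕ)
      (h : R.answer q (u.eval n σ).toNat (i.eval n σ).toNat = some r) :
      Exec R S (.query x q u i) σ (1 + u.size + i.size) [] (σ.setVar x (BitVec.ofNat w r))
  | emitVertex (σ : State w k) (e : Expr k) :
      Exec R S (.emitVertex e) σ (1 + e.size) [.vertex (e.eval n σ).toNat] σ
  | emitEdge (σ : State w k) (e f : Expr k) :
      Exec R S (.emitEdge e f) σ (1 + e.size + f.size)
        [.edge (e.eval n σ).toNat (f.eval n σ).toNat] σ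
  | emitSep (σ : State w k) : Exec R S .emitSep σ 1 [.sep] σ
  | seq {σ₁ σ₂ σ₃ : State w k} {c d : Cmd k} {t₁ t₂ : ℕ} {out₁ out₂ : List OutSymbol}
      (hc : Exec R S c σ₁ t₁ out₁ σ₂) (hd : Exec R S d σ₂ t₂ out₂ σ₃) :
      Exec R S (.seq c d) σ₁ (t₁ + t₂) (out₁ ++ out₂) σ₃
  | iteTrue {σ σ' : State w k} {b : Expr k} {c d : Cmd k} {t : ℕ} {out : List OutSymbol}
      (hb : (b.eval n σ).toNat ≠ 0) (hc : Exec R S c σ t out σ') :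
      Exec R S (.ite b c d) σ (1 + b.size + t) out σ'
  | iteFalse {σ σ' : State w k} {b : Expr k} {c d : Cmd k} {t : ℕ} {out : List OutSymbol}
      (hb : (b.eval n σ).toNat = 0) (hd : Exec R S d σ t out σ') :
      Exec R S (.ite b c d) σ (1 + b.size + t) out σ'
  | loopTrue {σ₁ σ₂ σ₃ : State w k} {b : Expr k} {c : Cmd k} {t₁ t₂ : ℕ}
      {out₁ out₂ : List OutSymbol} (hb : (b.eval n σ₁).toNat ≠ 0)
      (hc : Exec R S c σ₁ t₁ out₁ σ₂) (hl : Exec R S (.loop b c) σ₂ t₂ out₂ σ₃) :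
      Exec R S (.loop b c) σ₁ (1 + b.size + t₁ + t₂) (out₁ ++ out₂) σ₃
  | loopFalse {σ : State w k} {b : Expr k} {c : Cmd k} (hb : (b.eval n σ).toNat = 0) :
      Exec R S (.loop b c) σ (1 + b.size) [] σ

/-- A bound on the number of temporary words needed at any one time to evaluate the expressions
of a program. -/
def Cmd.temps {k : ℕ} : Cmd k → ℕ
  | .skip => 0
  | .assign _ e => e.size
  | .load _ addr => addr.size
  | .store addr e => addr.size + e.size
  | .query _ _ u i => u.size + i.size
  | .emitVertex e => e.size
  | .emitEdge e f => e.size + f.size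
  | .emitSep => 0
  | .seq c d => max c.temps d.temps
  | .ite b c d => max b.size (max c.temps d.temps)
  | .loop b c => max b.size c.temps

/-- The number of bits of working memory of `P` when run with word length `w` and `S` memory
words: all variables, temporaries and memory words are counted in full. -/
def workBits {k : ℕ} (P : Cmd k) (w S : ℕ) : ℕ :=
  w * (k + P.temps + S)

/-! ### Correct output -/

/-- The symbols to be output for the component with vertex set `A`: its vertices (if `vs`) and the
edges of the subgraph induced by `A` (if `es`). -/
def componentSymbols {n : ℕ} (G : Digraph (Fin n)) (vs es : Bool) (A : Set (Fin n)) :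
    Set OutSymbol :=
  {s | vs = true ∧ ∃ v ∈ A, s = .vertex v} ∪
    {s | es = true ∧ ∃ u ∈ A, ∃ v ∈ A, G.Adj u v ∧ s = .edge u v}

/-- `out` consists of one block for each strongly connected component, with separators between
consecutive blocks, and each block lists the symbols of its component, each exactly once. -/
def IsSCCOutput {n : ℕ} (G : Digraph (Fin n)) (vs es : Bool) (out : List OutSymbol) : Prop :=
  ∃ (comps : List (Set (Fin n))) (blocks : List (List OutSymbol)),
    comps.Nodup ∧ (∀ A, A ∈ comps ↔ IsSCC G A) ∧
    List.Forall₂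
      (fun A block => block.Nodup ∧ ∀ s, s ∈ block ↔ s ∈ componentSymbols G vs es A)
      comps blocks ∧
    out = List.intercalate [OutSymbol.sep] blocks

/-!
The program is a space-efficient version of Kosaraju's algorithm. A first depth-first search along the
outgoing edges finishes the vertices in some order. Then the vertices are considered in the reverse of
this order, and each of them that has not been output yet is output together with the vertices that
reach it and have not been output either: `KInv.mem_iff` shows that these form its component. The fact
about depth-first search behind this is `Hist.finProp`: a vertex reaches every vertex from which it can
be reached through vertices finished before it.

Neither the finishing order nor the stack of a search fits into the space available, which is why
* a search keeps, for every vertex on the current path, only the position of the parent in the array of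
  the vertex for the opposite direction; the cross links lead back from there;
* the first search writes one bit per edge to a log, namely whether it followed the edge to a new
  vertex, in the order in which it leaves the edges, and one bit per possible root, namely whether a
  search started there. From the log, the search can be undone step by step (`WP.undoLoop`), and this
  meets the vertices in the reverse of the finishing order;
* a vertex without incoming or without outgoing edges is a component of its own and is output at once.
  Only the `c` other vertices, called core vertices, take part in the searches.

For each component, a first backward search colors its vertices, and a second one outputs them and those
of their outgoing edges that lead to colored vertices (`WP.visit`); an edge from a vertex not yet output
never leads to a vertex output before unless the latter has no outgoing edges (`KInv.pred`), and such
vertices stay uncolored.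

*Space.* The log has at most `m + c` bits. A stack entry for a vertex with `d` edges in the array used has
`⌈log₂ d⌉` bits. While the first search is being undone, its stack and that of a backward search exist
together, and `1 + ⌈log₂ a⌉ + ⌈log₂ b⌉ ≤ 5 * (a + b) / 6` for `a, b ≥ 1`, so that the stacks take at most
`5 * m / 3 - c` bits (`coreCount_add_stTot_le`). Three colors suffice, and they are stored as digits to
base `3`, with as many digits in a word as fit, which makes about `n * log₂ 3` bits. The waste is below
`3 * n / w` bits. This is a small fraction of `m` unless the graph is so sparse that few blocks of `w / 400`
consecutive vertices contain a vertex with an edge; in that case, only such blocks get space for colors,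
and an array of pointers locates them. In total there are at most `n * log₂ 3 + 8 * m / 3` bits, a small
multiple of `m` for rounding, and a constant number of words and tables of powers
(`Sizes.mul_size_le`).

*Time.* Programs are verified by means of `WP`, which counts the executions of loop bodies; the
number of steps is at most a constant times one plus this count. Every core vertex takes part in the
first search, in undoing it, and in two backward searches, in each of which it accounts for
`AdjArrays.cost`, which is linear in its degrees.
-/

/-! ### Reasoning about programs over the natural numbers -/

/-- The contents of the variables and of the memory, read as natural numbers. -/
@[ext] structure NState (k : ℕ) where
  v : Fin k → ℕ
  m : ℕ → ℕ

/-- The natural-number view of a machine state. -/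
def State.nat {w k : ℕ} (σ : State w k) : NState k :=
  ⟨fun x => (σ.vars x).toNat, fun a => (σ.mem a).toNat⟩

/-- Update of a variable. -/
def NState.set {k : ℕ} (s : NState k) (x : Fin k) (a : ℕ) : NState k :=
  { s with v := Function.update s.v x a }

/-- Update of a memory word. -/
def NState.put {k : ℕ} (s : NState k) (i a : ℕ) : NState k :=
  { s with m := Function.update s.m i a }

@[simp] theorem NState.set_m {k : ℕ} (s : NState k) (x : Fin k) (a : ℕ) :
    (s.set x a).m = s.m := rfl

@[simp] theorem NState.put_v {k : ℕ} (s : NState k) (i a : ℕ) : (s.put i a).v = s.v := rfl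

@[simp] theorem NState.put_m {k : ℕ} (s : NState k) (i a : ℕ) :
    (s.put i a).m = Function.update s.m i a := rfl

theorem NState.set_v {k : ℕ} (s : NState k) (x y : Fin k) (a : ℕ) :
    (s.set x a).v y = if y = x then a else s.v y := by
  simp [NState.set, Function.update_apply]

/-- The value of an expression in exact arithmetic on natural numbers; meaningful only under
`Expr.ok`. -/
def Expr.val {k : ℕ} (n w : ℕ) (s : NState k) : Expr k → ℕ
  | .const c => c
  | .numVertices => n
  | .wordLength => w
  | .var x => s.v x
  | .op o e f =>
    let a := e.val n w s
    let b := f.val n w s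
    match o with
    | .add => a + b
    | .sub => a - b
    | .mul => a * b
    | .div => a / b
    | .mod => a % b
    | .eq => if a = b then 1 else 0
    | .lt => if a < b then 1 else 0
    | .shl => a * 2 ^ b
    | _ => 0

/-- The evaluation of the expression involves neither an overflow nor a negative number.
The bitwise operations other than the left shift are not used. -/
def Expr.ok {k : ℕ} (n w : ℕ) (s : NState k) : Expr k → Prop
  | .const c => c < 2 ^ w
  | .numVertices => n < 2 ^ w
  | .wordLength => True
  | .var _ => True
  | .op o e f =>
    e.ok n w s ∧ f.ok n w s ∧
    match o with
    | .add => e.val n w s + f.val n w s < 2 ^ w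
    | .sub => f.val n w s ≤ e.val n w s
    | .mul => e.val n w s * f.val n w s < 2 ^ w
    | .div | .mod | .eq | .lt => True
    | .shl => e.val n w s * 2 ^ f.val n w s < 2 ^ w
    | _ => False

theorem Expr.eval_toNat {n w k : ℕ} (hw : 0 < w) (σ : State w k) (e : Expr k)
    (h : e.ok n w σ.nat) : (e.eval n σ).toNat = e.val n w σ.nat := by
  have h1 : 1 < 2 ^ w := Nat.one_lt_two_pow hw.ne'
  induction e with
  | const c => simpa [Expr.eval, Expr.val] using Nat.mod_eq_of_lt h
  | numVertices => simpa [Expr.eval, Expr.val] using Nat.mod_eq_of_lt h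
  | wordLength => simpa [Expr.eval, Expr.val] using Nat.mod_eq_of_lt Nat.lt_two_pow_self
  | var x => rfl
  | op o e f ihe ihf =>
    obtain ⟨he, hf, ho⟩ := h
    have ihe := ihe he
    have ihf := ihf hf
    cases o with
    | add =>
      simp only [Expr.eval, WordOp.eval, Expr.val, BitVec.toNat_add, ihe, ihf]
      exact Nat.mod_eq_of_lt ho
    | sub =>
      simp only [Expr.eval, WordOp.eval, Expr.val]
      rw [BitVec.toNat_sub_of_le, ihe, ihf]
      rw [BitVec.le_def, ihe, ihf]; exact ho
    | mul =>
      simp only [Expr.eval, WordOp.eval, Expr.val, BitVec.toNat_mul, ihe, ihf]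
      exact Nat.mod_eq_of_lt ho
    | div => simp only [Expr.eval, WordOp.eval, Expr.val, BitVec.toNat_udiv, ihe, ihf]
    | mod => simp only [Expr.eval, WordOp.eval, Expr.val, BitVec.toNat_umod, ihe, ihf]
    | eq =>
      simp only [Expr.eval, WordOp.eval, Expr.val, ← ihe, ← ihf, BitVec.toNat_inj]
      split_ifs <;> simp [Nat.mod_eq_of_lt h1]
    | lt =>
      simp only [Expr.eval, WordOp.eval, Expr.val, ← ihe, ← ihf]
      split_ifs <;> simp [Nat.mod_eq_of_lt h1]
    | shl =>
      simp only [Expr.eval, WordOp.eval, Expr.val, BitVec.shiftLeft_eq', BitVec.toNat_shiftLeft,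
        ihe, ihf, Nat.shiftLeft_eq]
      exact Nat.mod_eq_of_lt ho
    | and => exact ho.elim
    | or => exact ho.elim
    | xor => exact ho.elim
    | shr => exact ho.elim

theorem State.nat_setVar {w k : ℕ} (σ : State w k) (x : Fin k) (a : BitVec w) :
    (σ.setVar x a).nat = σ.nat.set x a.toNat := by
  ext y
  · by_cases h : y = x
    · subst h; simp [State.nat, State.setVar, NState.set]
    · simp [State.nat, State.setVar, NState.set, Function.update_of_ne h]
  · rfl

theorem State.nat_setMem {w k : ℕ} (σ : State w k) (i : ℕ) (a : BitVec w) :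
    (σ.setMem i a).nat = σ.nat.put i a.toNat := by
  ext y
  · rfl
  · by_cases h : y = i
    · subst h; simp [State.nat, State.setMem, NState.put]
    · simp [State.nat, State.setMem, NState.put, Function.update_of_ne h]

/-- A constant such that an execution of the program in the course of which loop bodies are
executed `q` times in total takes at most `weight * (q + 1)` steps. -/
def Cmd.weight {k : ℕ} : Cmd k → ℕ
  | .skip => 1
  | .assign _ e => 1 + e.size
  | .load _ a => 1 + a.size
  | .store a e => 1 + a.size + e.size
  | .query _ _ u i => 1 + u.size + i.size
  | .emitVertex e => 1 + e.size
  | .emitEdge e f => 1 + e.size + f.size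
  | .emitSep => 1
  | .seq c d => c.weight + d.weight
  | .ite b c d => 1 + b.size + c.weight + d.weight
  | .loop b c => 1 + b.size + c.weight

/-- Total correctness: started in a state with natural-number view `s`, the program `P` halts, and
`Q q out s'` holds for the number `q` of executions of loop bodies (which determines the running
time up to a constant factor), the output `out` and the final state `s'`. -/
def WP {n : ℕ} {G : Digraph (Fin n)} (R : AdjArrays G) (S w : ℕ) {k : ℕ} (P : Cmd k)
    (s : NState k) (Q : ℕ → List OutSymbol → NState k → Prop) : Prop :=
  0 < w → ∀ σ : State w k, σ.nat = s → ∃ t q out σ', Exec R S P σ t out σ' ∧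
    t ≤ P.weight * (q + 1) ∧ Q q out σ'.nat

namespace WP

variable {n : ℕ} {G : Digraph (Fin n)} {R : AdjArrays G} {S w k : ℕ} {s : NState k}
  {Q : ℕ → List OutSymbol → NState k → Prop}

theorem conseq {P : Cmd k} {Q' : ℕ → List OutSymbol → NState k → Prop} (h : WP R S w P s Q')
    (hQ : ∀ q out s', Q' q out s' → Q q out s') : WP R S w P s Q := by
  intro hw σ hσ
  obtain ⟨t, q, out, σ', he, ht, hq⟩ := h hw σ hσ
  exact ⟨t, q, out, σ', he, ht, hQ _ _ _ hq⟩

theorem skip (h : Q 0 [] s) : WP R S w .skip s Q := by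
  intro hw σ hσ; subst hσ
  exact ⟨_, 0, _, _, .skip σ, by simp [Cmd.weight], h⟩

theorem assign {x : Fin k} {e : Expr k} (he : e.ok n w s) (h : Q 0 [] (s.set x (e.val n w s))) :
    WP R S w (.assign x e) s Q := by
  intro hw σ hσ; subst hσ
  refine ⟨_, 0, _, _, .assign σ x e, by simp [Cmd.weight], ?_⟩
  rw [State.nat_setVar, Expr.eval_toNat hw _ _ he]; exact h

theorem load {x : Fin k} {a : Expr k} (he : a.ok n w s) (ha : a.val n w s < S)
    (h : Q 0 [] (s.set x (s.m (a.val n w s)))) : WP R S w (.load x a) s Q := by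
  intro hw σ hσ; subst hσ
  have h1 := Expr.eval_toNat hw _ _ he
  refine ⟨_, 0, _, _, .load σ x a (by rw [h1]; exact ha), by simp [Cmd.weight], ?_⟩
  rw [State.nat_setVar, h1]; exact h

theorem store {a e : Expr k} (hok : a.ok n w s) (he : e.ok n w s) (ha : a.val n w s < S)
    (h : Q 0 [] (s.put (a.val n w s) (e.val n w s))) : WP R S w (.store a e) s Q := by
  intro hw σ hσ; subst hσ
  have h1 := Expr.eval_toNat hw _ _ hok
  refine ⟨_, 0, _, _, .store σ a e (by rw [h1]; exact ha), by simp [Cmd.weight], ?_⟩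
  rw [State.nat_setMem, h1, Expr.eval_toNat hw _ _ he]; exact h

theorem query {x : Fin k} {qu : Query} {u i : Expr k} (r : ℕ) (hu : u.ok n w s) (hi : i.ok n w s)
    (hr : R.answer qu (u.val n w s) (i.val n w s) = some r) (hrw : r < 2 ^ w)
    (h : Q 0 [] (s.set x r)) : WP R S w (.query x qu u i) s Q := by
  intro hw σ hσ; subst hσ
  refine ⟨_, 0, _, _, .query σ x qu u i r
    (by rw [Expr.eval_toNat hw _ _ hu, Expr.eval_toNat hw _ _ hi]; exact hr),
    by simp [Cmd.weight], ?_⟩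
  rw [State.nat_setVar, BitVec.toNat_ofNat, Nat.mod_eq_of_lt hrw]; exact h

theorem emitVertex {e : Expr k} (he : e.ok n w s) (h : Q 0 [.vertex (e.val n w s)] s) :
    WP R S w (.emitVertex e) s Q := by
  intro hw σ hσ; subst hσ
  refine ⟨_, 0, _, _, .emitVertex σ e, by simp [Cmd.weight], ?_⟩
  rw [Expr.eval_toNat hw _ _ he]; exact h

theorem emitEdge {e f : Expr k} (he : e.ok n w s) (hf : f.ok n w s)
    (h : Q 0 [.edge (e.val n w s) (f.val n w s)] s) :
    WP R S w (.emitEdge e f) s Q := by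
  intro hw σ hσ; subst hσ
  refine ⟨_, 0, _, _, .emitEdge σ e f, by simp [Cmd.weight], ?_⟩
  rw [Expr.eval_toNat hw _ _ he, Expr.eval_toNat hw _ _ hf]; exact h

theorem emitSep (h : Q 0 [.sep] s) : WP R S w .emitSep s Q := by
  intro hw σ hσ; subst hσ
  exact ⟨_, 0, _, _, .emitSep σ, by simp [Cmd.weight], h⟩

theorem seq {c d : Cmd k}
    (h : WP R S w c s fun q₁ o₁ s₁ => WP R S w d s₁ fun q₂ o₂ s₂ => Q (q₁ + q₂) (o₁ ++ o₂) s₂) :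
    WP R S w (.seq c d) s Q := by
  intro hw σ hσ
  obtain ⟨t₁, q₁, o₁, σ₁, e₁, l₁, h₁⟩ := h hw σ hσ
  obtain ⟨t₂, q₂, o₂, σ₂, e₂, l₂, h₂⟩ := h₁ hw σ₁ rfl
  refine ⟨_, q₁ + q₂, _, _, .seq e₁ e₂, ?_, h₂⟩
  simp only [Cmd.weight]
  nlinarith [Nat.zero_le (c.weight * q₂), Nat.zero_le (d.weight * q₁)]

/-- Sequential composition with a first part that executes no loop body and writes nothing. -/
theorem seq0 {c d : Cmd k}
    (h : WP R S w c s fun q₁ o₁ s₁ => q₁ = 0 ∧ o₁ = [] ∧ WP R S w d s₁ Q) :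
    WP R S w (.seq c d) s Q := by
  refine seq (h.conseq ?_)
  rintro q out s' ⟨rfl, rfl, h⟩
  simpa using h

theorem ite {b : Expr k} {c d : Cmd k} (hb : b.ok n w s) (hc : b.val n w s ≠ 0 → WP R S w c s Q)
    (hd : b.val n w s = 0 → WP R S w d s Q) : WP R S w (.ite b c d) s Q := by
  intro hw σ hσ
  subst hσ
  have h1 := Expr.eval_toNat hw _ _ hb
  by_cases h : b.val n w σ.nat = 0
  · obtain ⟨t, q, o, σ', e, l, h2⟩ := hd h hw σ rfl
    refine ⟨_, q, _, _, .iteFalse (by rw [h1]; exact h) e, ?_, h2⟩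
    simp only [Cmd.weight]
    nlinarith [Nat.zero_le (c.weight * (q + 1)), Nat.zero_le (b.size * q)]
  · obtain ⟨t, q, o, σ', e, l, h2⟩ := hc h hw σ rfl
    refine ⟨_, q, _, _, .iteTrue (by rw [h1]; exact h) e, ?_, h2⟩
    simp only [Cmd.weight]
    nlinarith [Nat.zero_le (d.weight * (q + 1)), Nat.zero_le (b.size * q)]

theorem loop_true {b : Expr k} {c : Cmd k} (hb : b.ok n w s) (hb0 : b.val n w s ≠ 0)
    (h : WP R S w c s fun q₁ o₁ s₁ => WP R S w (.loop b c) s₁ fun q₂ o₂ s₂ =>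
      Q (1 + q₁ + q₂) (o₁ ++ o₂) s₂) : WP R S w (.loop b c) s Q := by
  intro hw σ hσ
  subst hσ
  obtain ⟨t₁, q₁, o₁, σ₁, e₁, l₁, h₁⟩ := h hw σ rfl
  obtain ⟨t₂, q₂, o₂, σ₂, e₂, l₂, h₂⟩ := h₁ hw σ₁ rfl
  refine ⟨_, 1 + q₁ + q₂, _, _,
    .loopTrue (by rw [Expr.eval_toNat hw _ _ hb]; exact hb0) e₁ e₂, ?_, h₂⟩
  simp only [Cmd.weight] at l₂ ⊢
  nlinarith [Nat.zero_le (b.size * q₁)]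

theorem loop_false {b : Expr k} {c : Cmd k} (hb : b.ok n w s) (hb0 : b.val n w s = 0)
    (h : Q 0 [] s) : WP R S w (.loop b c) s Q := by
  intro hw σ hσ
  subst hσ
  refine ⟨_, 0, _, _, .loopFalse (by rw [Expr.eval_toNat hw _ _ hb]; exact hb0), ?_, h⟩
  simp only [Cmd.weight]; omega

/-- Loop rule: `I` relates the number of executions of loop bodies, the output and the state
at the beginning of an iteration, and the measure `μ` decreases. -/
theorem loop_inv {b : Expr k} {c : Cmd k} (I : ℕ → List OutSymbol → NState k → Prop)
    (μ : NState k → ℕ) (hI : I 0 [] s)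
    (hok : ∀ q o s', I q o s' → b.ok n w s')
    (hbody : ∀ q o s', I q o s' → b.val n w s' ≠ 0 → WP R S w c s' fun q' o' s'' =>
      I (q + 1 + q') (o ++ o') s'' ∧ μ s'' < μ s')
    (hend : ∀ q o s', I q o s' → b.val n w s' = 0 → Q q o s') :
    WP R S w (.loop b c) s Q := by
  suffices H : ∀ N s' q o, μ s' < N → I q o s' → WP R S w (.loop b c) s' fun q' o' s'' =>
      Q (q + q') (o ++ o') s'' by
    simpa using H (μ s + 1) s 0 [] (Nat.lt_succ_self _) hI
  intro N
  induction N with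
  | zero => intro s' q o h; omega
  | succ N ih =>
    intro s' q o hN hIs
    by_cases hb : b.val n w s' = 0
    · exact loop_false (hok _ _ _ hIs) hb (by simpa using hend _ _ _ hIs hb)
    · refine loop_true (hok _ _ _ hIs) hb ((hbody _ _ _ hIs hb).conseq ?_)
      rintro q' o' s'' ⟨h1, h2⟩
      refine (ih s'' _ _ (by omega) h1).conseq ?_
      intro q2 o2 s2 h
      simpa [add_assoc, List.append_assoc] using h

end WP

theorem WP.exec {n : ℕ} {G : Digraph (Fin n)} {R : AdjArrays G} {S w k : ℕ} {P : Cmd k}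
    {Q : ℕ → List OutSymbol → NState k → Prop} (hw : 0 < w) (σ : State w k)
    (h : WP R S w P σ.nat Q) : ∃ t q out σ', Exec R S P σ t out σ' ∧
      t ≤ P.weight * (q + 1) ∧ Q q out σ'.nat := h hw σ rfl

/-! ### Notation for programs -/

namespace Expr

variable {k : ℕ}

instance : Add (Expr k) := ⟨.op .add⟩
instance : Sub (Expr k) := ⟨.op .sub⟩
instance : Mul (Expr k) := ⟨.op .mul⟩
instance : Div (Expr k) := ⟨.op .div⟩
instance : Mod (Expr k) := ⟨.op .mod⟩
instance (c : ℕ) : OfNat (Expr k) c := ⟨.const c⟩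
instance : Coe (Fin k) (Expr k) := ⟨.var⟩

variable {n w : ℕ} {s : NState k} (e f : Expr k)

@[simp] theorem val_add : (e + f).val n w s = e.val n w s + f.val n w s := rfl
@[simp] theorem val_sub : (e - f).val n w s = e.val n w s - f.val n w s := rfl
@[simp] theorem val_mul : (e * f).val n w s = e.val n w s * f.val n w s := rfl
@[simp] theorem val_div : (e / f).val n w s = e.val n w s / f.val n w s := rfl
@[simp] theorem val_mod : (e % f).val n w s = e.val n w s % f.val n w s := rfl
@[simp] theorem val_ofNat (c : ℕ) [c.AtLeastTwo] :
    (no_index (OfNat.ofNat c) : Expr k).val n w s = OfNat.ofNat c := rfl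
@[simp] theorem val_zero : (0 : Expr k).val n w s = 0 := rfl
@[simp] theorem val_one : (1 : Expr k).val n w s = 1 := rfl
@[simp] theorem val_const (c : ℕ) : (Expr.const c : Expr k).val n w s = c := rfl
@[simp] theorem val_var (x : Fin k) : (Expr.var x).val n w s = s.v x := rfl
@[simp] theorem val_numVertices : (Expr.numVertices : Expr k).val n w s = n := rfl
@[simp] theorem val_wordLength : (Expr.wordLength : Expr k).val n w s = w := rfl
@[simp] theorem val_eq :
    (Expr.op .eq e f).val n w s = if e.val n w s = f.val n w s then 1 else 0 := rfl
@[simp] theorem val_lt :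
    (Expr.op .lt e f).val n w s = if e.val n w s < f.val n w s then 1 else 0 := rfl
@[simp] theorem val_shl :
    (Expr.op .shl e f).val n w s = e.val n w s * 2 ^ f.val n w s := rfl

@[simp] theorem ok_add : (e + f).ok n w s ↔
    e.ok n w s ∧ f.ok n w s ∧ e.val n w s + f.val n w s < 2 ^ w := Iff.rfl
@[simp] theorem ok_sub : (e - f).ok n w s ↔
    e.ok n w s ∧ f.ok n w s ∧ f.val n w s ≤ e.val n w s := Iff.rfl
@[simp] theorem ok_mul : (e * f).ok n w s ↔
    e.ok n w s ∧ f.ok n w s ∧ e.val n w s * f.val n w s < 2 ^ w := Iff.rfl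
@[simp] theorem ok_div : (e / f).ok n w s ↔ e.ok n w s ∧ f.ok n w s :=
  ⟨fun h => ⟨h.1, h.2.1⟩, fun h => ⟨h.1, h.2, trivial⟩⟩
@[simp] theorem ok_mod : (e % f).ok n w s ↔ e.ok n w s ∧ f.ok n w s :=
  ⟨fun h => ⟨h.1, h.2.1⟩, fun h => ⟨h.1, h.2, trivial⟩⟩
@[simp] theorem ok_eq : (Expr.op .eq e f).ok n w s ↔ e.ok n w s ∧ f.ok n w s :=
  ⟨fun h => ⟨h.1, h.2.1⟩, fun h => ⟨h.1, h.2, trivial⟩⟩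
@[simp] theorem ok_lt : (Expr.op .lt e f).ok n w s ↔ e.ok n w s ∧ f.ok n w s :=
  ⟨fun h => ⟨h.1, h.2.1⟩, fun h => ⟨h.1, h.2, trivial⟩⟩
@[simp] theorem ok_shl : (Expr.op .shl e f).ok n w s ↔
    e.ok n w s ∧ f.ok n w s ∧ e.val n w s * 2 ^ f.val n w s < 2 ^ w := Iff.rfl
@[simp] theorem ok_ofNat (c : ℕ) [c.AtLeastTwo] :
    (no_index (OfNat.ofNat c) : Expr k).ok n w s ↔ (OfNat.ofNat c : ℕ) < 2 ^ w := Iff.rfl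
@[simp] theorem ok_zero : (0 : Expr k).ok n w s := (Nat.two_pow_pos w : 0 < 2 ^ w)
@[simp] theorem ok_one : (1 : Expr k).ok n w s ↔ 1 < 2 ^ w := Iff.rfl
@[simp] theorem ok_const (c : ℕ) : (Expr.const c : Expr k).ok n w s ↔ c < 2 ^ w := Iff.rfl
@[simp] theorem ok_var (x : Fin k) : (Expr.var x).ok n w s := trivial
@[simp] theorem ok_numVertices : (Expr.numVertices : Expr k).ok n w s ↔ n < 2 ^ w := Iff.rfl
@[simp] theorem ok_wordLength : (Expr.wordLength : Expr k).ok n w s := trivial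

end Expr

infixr:60 " ;; " => Cmd.seq

namespace NState

variable {k : ℕ}

@[simp] theorem set_v_self (s : NState k) (x : Fin k) (a : ℕ) : (s.set x a).v x = a := by
  simp [set_v]

theorem set_v_ne (s : NState k) {x y : Fin k} (a : ℕ) (h : y ≠ x) : (s.set x a).v y = s.v y := by
  simp [set_v, h]

@[simp] theorem set_set (s : NState k) (x : Fin k) (a b : ℕ) : (s.set x a).set x b = s.set x b := by
  simp [set]

end NState

namespace WP

variable {n : ℕ} {G : Digraph (Fin n)} {R : AdjArrays G} {S w k : ℕ} {s : NState k}
  {Q : ℕ → List OutSymbol → NState k → Prop} {d : Cmd k}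

theorem seq_assign {x : Fin k} {e : Expr k} (he : e.ok n w s)
    (h : WP R S w d (s.set x (e.val n w s)) Q) : WP R S w (.assign x e ;; d) s Q :=
  seq0 (assign he ⟨rfl, rfl, h⟩)

theorem seq_load {x : Fin k} {a : Expr k} (he : a.ok n w s) (ha : a.val n w s < S)
    (h : WP R S w d (s.set x (s.m (a.val n w s))) Q) : WP R S w (.load x a ;; d) s Q :=
  seq0 (load he ha ⟨rfl, rfl, h⟩)

theorem seq_query {x : Fin k} {qu : Query} {u i : Expr k} (r : ℕ) (hu : u.ok n w s)
    (hi : i.ok n w s) (hr : R.answer qu (u.val n w s) (i.val n w s) = some r) (hrw : r < 2 ^ w)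
    (h : WP R S w d (s.set x r) Q) : WP R S w (.query x qu u i ;; d) s Q :=
  seq0 (query r hu hi hr hrw ⟨rfl, rfl, h⟩)

end WP

/-! ### Digits of numbers -/

/-- The arithmetic by which digit number `j` of a number `W` with `K` digits is set to `e`: there is no
overflow, and the other digits stay the same. -/
theorem digit_set {β K W j e : ℕ} (hW : W < β ^ K) (hj : j < K) (he : e < β) :
    W / β ^ j % β * β ^ j ≤ W ∧
    W - W / β ^ j % β * β ^ j + e * β ^ j < β ^ K ∧
    ∀ i, (W - W / β ^ j % β * β ^ j + e * β ^ j) / β ^ i % β =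
      if i = j then e else W / β ^ i % β := by
  have hβ : 0 < β := by omega
  have hp : 0 < β ^ j := Nat.pow_pos hβ
  obtain ⟨q, t, r, ht, hr, rfl⟩ : ∃ q t r, t < β ∧ r < β ^ j ∧ W = β ^ j * (β * q + t) + r :=
    ⟨W / β ^ j / β, W / β ^ j % β, W % β ^ j, Nat.mod_lt _ hβ, Nat.mod_lt _ hp, by
      rw [Nat.div_add_mod, Nat.div_add_mod]⟩
  have h1 : (β ^ j * (β * q + t) + r) / β ^ j = β * q + t := by
    rw [Nat.mul_add_div hp, Nat.div_eq_of_lt hr, add_zero]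
  have h2 : (β * q + t) % β = t := by
    rw [Nat.mul_add_mod, Nat.mod_eq_of_lt ht]
  have h3 : β ^ j * (β * q + t) + r - t * β ^ j + e * β ^ j = β ^ j * (β * q + e) + r := by
    have : β ^ j * (β * q + t) + r = β ^ j * (β * q) + r + t * β ^ j := by ring
    rw [this, Nat.add_sub_cancel]; ring
  rw [h1, h2, h3]
  have hlow : ∀ c < β, β ^ j * (β * q + c) + r < β ^ (j + 1) * (q + 1) := by
    intro c hc
    have : β ^ j * (c + 1) ≤ β ^ j * β := Nat.mul_le_mul_left _ hc
    rw [pow_succ]; nlinarith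
  have hhigh : ∀ c < β, (β ^ j * (β * q + c) + r) / β ^ (j + 1) = q := by
    intro c hc
    rw [Nat.div_eq_iff (Nat.pow_pos hβ)]
    have := hlow c hc
    constructor
    · rw [pow_succ]; nlinarith [Nat.zero_le (β ^ j * c)]
    · have : q * β ^ (j + 1) + β ^ (j + 1) = β ^ (j + 1) * (q + 1) := by ring
      omega
  refine ⟨by nlinarith, ?_, fun i => ?_⟩
  · have hq : q < β ^ (K - (j + 1)) := by
      rw [← hhigh t ht]
      apply Nat.div_lt_of_lt_mul
      rwa [← pow_add, Nat.add_sub_of_le hj]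
    calc _ < β ^ (j + 1) * (q + 1) := hlow e he
      _ ≤ β ^ (j + 1) * β ^ (K - (j + 1)) := Nat.mul_le_mul_left _ hq
      _ = β ^ K := by rw [← pow_add, Nat.add_sub_of_le hj]
  · rcases lt_trichotomy i j with h | rfl | h
    · rw [if_neg h.ne]
      have key : ∀ c, (β ^ j * c + r) / β ^ i % β = r / β ^ i % β := by
        intro c
        obtain ⟨d, rfl⟩ := Nat.exists_eq_add_of_lt h
        have : β ^ (i + d + 1) * c + r = β ^ i * (β * (β ^ d * c)) + r := by ring
        rw [this, Nat.mul_add_div (Nat.pow_pos hβ), Nat.mul_add_mod]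
      rw [key, key]
    · rw [if_pos rfl, Nat.mul_add_div hp, Nat.div_eq_of_lt hr, add_zero, Nat.mul_add_mod,
        Nat.mod_eq_of_lt he]
    · rw [if_neg h.ne']
      obtain ⟨d, rfl⟩ := Nat.exists_eq_add_of_lt h
      have : β ^ (j + d + 1) = β ^ (j + 1) * β ^ d := by ring
      rw [this, ← Nat.div_div_eq_div_mul, ← Nat.div_div_eq_div_mul, hhigh e he, hhigh t ht]

/-! ### Arrays of digits in words -/

/-- The words of `m` from address `A` on hold an array of `cap` digits to base `β`, with `K` digits
per word and the `i`th digit equal to `f i`.  The words from address `T` on hold a table of the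
powers `β ^ j` for `j < K`. -/
structure DRep (S w : ℕ) (m : ℕ → ℕ) (A T K β cap : ℕ) (f : ℕ → ℕ) : Prop where
  posK : 0 < K
  two_le : 2 ≤ β
  pow_lt : β ^ K < 2 ^ w
  tab : ∀ j < K, m (T + j) = β ^ j
  tabA : T + K ≤ A
  A_le : A + cap / K + 1 ≤ S
  dig : ∀ i < cap, m (A + i / K) / β ^ (i % K) % β = f i
  word : ∀ i < cap, m (A + i / K) < β ^ K

namespace DRep

variable {S w : ℕ} {m m' : ℕ → ℕ} {A T K β cap : ℕ} {f : ℕ → ℕ}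

theorem div_le (h : i < cap) : i / K ≤ cap / K := Nat.div_le_div_right h.le

theorem digit_lt (h : DRep S w m A T K β cap f) {i : ℕ} (hi : i < cap) : f i < β := by
  rw [← h.dig i hi]; exact Nat.mod_lt _ (by linarith [h.two_le])

theorem frame (h : DRep S w m A T K β cap f) (h1 : ∀ a, T ≤ a → a < T + K → m' a = m a)
    (h2 : ∀ a, A ≤ a → a ≤ A + cap / K → m' a = m a) : DRep S w m' A T K β cap f where
  posK := h.posK
  two_le := h.two_le
  pow_lt := h.pow_lt
  tab j hj := by rw [h1 _ (by omega) (by omega)]; exact h.tab j hj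
  tabA := h.tabA
  A_le := h.A_le
  dig i hi := by
    have := div_le (K := K) hi
    have := Nat.zero_le (i / K)
    rw [h2 _ (by omega) (by omega)]; exact h.dig i hi
  word i hi := by
    have := div_le (K := K) hi
    have := Nat.zero_le (i / K)
    rw [h2 _ (by omega) (by omega)]; exact h.word i hi

theorem set (h : DRep S w m A T K β cap f) {i e : ℕ} (hi : i < cap) (he : e < β) :
    DRep S w (Function.update m (A + i / K)
      (m (A + i / K) - m (A + i / K) / β ^ (i % K) % β * β ^ (i % K) + e * β ^ (i % K)))
      A T K β cap (Function.update f i e) := by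
  have hd := digit_set (h.word i hi) (Nat.mod_lt i h.posK) he
  have hA := h.tabA
  refine ⟨h.posK, h.two_le, h.pow_lt, fun j hj => ?_, hA, h.A_le, fun x hx => ?_, fun x hx => ?_⟩
  · have h0 := Nat.zero_le (i / K)
    rw [Function.update_of_ne (by omega)]; exact h.tab j hj
  · by_cases hxi : x / K = i / K
    · rw [hxi, Function.update_self, hd.2.2]
      by_cases hm : x % K = i % K
      · have : x = i := by rw [← Nat.div_add_mod x K, ← Nat.div_add_mod i K, hxi, hm]
        subst this; simp
      · rw [if_neg hm, Function.update_of_ne (by rintro rfl; exact hm rfl), ← hxi]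
        exact h.dig x hx
    · rw [Function.update_of_ne (by omega), Function.update_of_ne (by rintro rfl; exact hxi rfl)]
      exact h.dig x hx
  · by_cases hxi : x / K = i / K
    · rw [hxi, Function.update_self]; exact hd.2.1
    · rw [Function.update_of_ne (by omega)]; exact h.word x hx

end DRep

/-- The expressions for the parameters of an array of digits: the address `A` of the array, the
number `K` of digits per word, the address `T` of the table of powers, and the base `β`. -/
structure DArr where
  A : Fin 32
  K : Fin 32
  T : Expr 32
  β : Expr 32

/-- Reads digit number `i` of an array into the variable `x`. -/
def DArr.get (d : DArr) (x i : Fin 32) : Cmd 32 :=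
  .load 0 (d.T + (i : Expr 32) % d.K) ;;
  .load x (d.A + (i : Expr 32) / d.K) ;;
  .assign x ((x : Expr 32) / (0 : Fin 32) % d.β)

/-- Writes the value of `e` to digit number `i` of an array. -/
def DArr.put (d : DArr) (i : Fin 32) (e : Expr 32) : Cmd 32 :=
  .load 0 (d.T + (i : Expr 32) % d.K) ;;
  .load 1 (d.A + (i : Expr 32) / d.K) ;;
  .store (d.A + (i : Expr 32) / d.K)
    ((1 : Fin 32) - (1 : Fin 32) / (0 : Fin 32) % d.β * (0 : Fin 32) + e * (0 : Fin 32))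

namespace WP

variable {n : ℕ} {G : Digraph (Fin n)} {R : AdjArrays G} {S w : ℕ} {s : NState 32}
  {Q : ℕ → List OutSymbol → NState 32 → Prop} {A T K β cap : ℕ} {f : ℕ → ℕ}

theorem dget {d : DArr} {x i : Fin 32} (h : DRep S w s.m A T K β cap f) (hS : S < 2 ^ w)
    (hA : s.v d.A = A) (hK : s.v d.K = K) (hA0 : d.A ≠ 0) (hK0 : d.K ≠ 0) (hi0 : i ≠ 0)
    (hx0 : x ≠ 0)
    (hT : ∀ s', d.T.ok n w s' ∧ d.T.val n w s' = T) (hβ : ∀ s', d.β.ok n w s' ∧ d.β.val n w s' = β)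
    (hi : s.v i < cap)
    (hQ : ∀ t, Q 0 [] ((s.set 0 t).set x (f (s.v i)))) : WP R S w (d.get x i) s Q := by
  have hm := Nat.mod_lt (s.v i) h.posK
  have hd := DRep.div_le (K := K) hi
  have hz := Nat.zero_le (s.v i / K)
  have h1 := h.tabA
  have h2 := h.A_le
  refine seq_load ?_ ?_ (seq_load ?_ ?_ (assign ?_ ?_))
  · simp [hT, hK]; omega
  · simp [hT, hK]; omega
  · simp [NState.set_v, hA0, hK0, hi0, hA, hK]; omega
  · simp [NState.set_v, hA0, hK0, hi0, hA, hK]; omega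
  · simp [hβ]
  · simp [NState.set_v, hT, hβ, hA0, hK0, hi0, hA, hK, hx0.symm, h.tab _ hm, h.dig _ hi]
    exact hQ _

theorem dput {d : DArr} {i : Fin 32} {e : Expr 32} {ev : ℕ} (h : DRep S w s.m A T K β cap f)
    (hS : S < 2 ^ w)
    (hA : s.v d.A = A) (hK : s.v d.K = K) (hA0 : d.A ≠ 0) (hK0 : d.K ≠ 0) (hi0 : i ≠ 0)
    (hA1 : d.A ≠ 1) (hK1 : d.K ≠ 1) (hi1 : i ≠ 1)
    (hT : ∀ s', d.T.ok n w s' ∧ d.T.val n w s' = T) (hβ : ∀ s', d.β.ok n w s' ∧ d.β.val n w s' = β)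
    (hi : s.v i < cap)
    (he : ∀ t z, e.ok n w ((s.set 0 t).set 1 z) ∧ e.val n w ((s.set 0 t).set 1 z) = ev)
    (heβ : ev < β)
    (hQ : ∀ t z m', DRep S w m' A T K β cap (Function.update f (s.v i) ev) →
      (∀ a, a < A ∨ A + cap / K < a → m' a = s.m a) → Q 0 [] ⟨((s.set 0 t).set 1 z).v, m'⟩) :
    WP R S w (d.put i e) s Q := by
  have hm := Nat.mod_lt (s.v i) h.posK
  have hd := DRep.div_le (K := K) hi
  have hz := Nat.zero_le (s.v i / K)
  have h1 := h.tabA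
  have h2 := h.A_le
  have h3 := digit_set (h.word _ hi) hm heβ
  have h4 := h.pow_lt
  have h5 := h.word _ hi
  have h6 : ev * β ^ (s.v i % K) < 2 ^ w := lt_of_le_of_lt (Nat.le_add_left _ _) (h3.2.1.trans h4)
  refine seq_load ?_ ?_ (seq_load ?_ ?_ (store ?_ ?_ ?_ ?_))
  · simp [hT, hK]; omega
  · simp [hT, hK]; omega
  · simp [NState.set_v, hA0, hK0, hi0, hA, hK]; omega
  · simp [NState.set_v, hA0, hK0, hi0, hA, hK]; omega
  · simp [NState.set_v, hA0, hK0, hi0, hA, hK, hA1, hK1, hi1]; omega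
  · simp only [Expr.ok_add, Expr.ok_sub, Expr.ok_mul, Expr.ok_div, Expr.ok_mod, Expr.val_sub,
      Expr.val_mul, Expr.val_div, Expr.val_mod, he, hβ, Expr.ok_var, Expr.val_var, true_and]
    simp [NState.set_v, hA0, hK0, hi0, hA, hK, hA1, hK1, hi1, hT, h.tab _ hm]
    exact ⟨⟨by omega, h3.1⟩, h6, h3.2.1.trans h4⟩
  · simp [NState.set_v, hA0, hK0, hi0, hA, hK, hA1, hK1, hi1]; omega
  · refine hQ _ _ _ ?_ ?_
    · have := h.set hi heβ
      have e1 : ∀ t z, (d.A + (i : Expr 32) / d.K : Expr 32).val n w ((s.set 0 t).set 1 z) =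
          A + s.v i / K := fun t z => by
        simp [NState.set_v, hA0, hK0, hi0, hA, hK, hA1, hK1, hi1]
      have e2 : ∀ t z, ((1 : Fin 32) - (1 : Fin 32) / (0 : Fin 32) % d.β * (0 : Fin 32) +
          e * (0 : Fin 32) : Expr 32).val n w ((s.set 0 t).set 1 z) =
          z - z / t % β * t + ev * t := fun t z => by
        simp only [Expr.val_add, Expr.val_sub, Expr.val_mul, Expr.val_div, Expr.val_mod, he, hβ,
          Expr.val_var]
        simp [NState.set_v]
      rw [e1, e2]
      simpa [NState.set_v, hT, hA0, hK0, hi0, hA, hK, h.tab _ hm] using this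
    · intro a ha
      simp only [NState.put_m, NState.set_m]
      rw [Function.update_of_ne]
      simp [NState.set_v, hA0, hK0, hi0, hA, hK, hA1, hK1, hi1]; omega

end WP

/-! ### The input in terms of natural numbers -/

/-- The degree query in direction `dir`: `false` stands for outgoing, `true` for incoming edges. -/
def Query.deg (dir : Bool) : Query := if dir then .inDeg else .outDeg

/-- The neighbor query in direction `dir`. -/
def Query.head (dir : Bool) : Query := if dir then .inHead else .outHead

/-- The cross-link query in direction `dir`. -/
def Query.mate (dir : Bool) : Query := if dir then .inMate else .outMate

namespace AdjArrays

variable {n : ℕ} {G : Digraph (Fin n)} (R : AdjArrays G)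

/-- The outdegree (`dir = false`) or indegree (`dir = true`) of `u`; `0` if `u` is no vertex. -/
def deg (dir : Bool) (u : ℕ) : ℕ := (R.answer (.deg dir) u 0).getD 0

/-- The `i`th out- or inneighbor of `u`; `0` if there is none. -/
def head (dir : Bool) (u i : ℕ) : ℕ := (R.answer (.head dir) u i).getD 0

/-- The position of `u` in the array of its `i`th out- or inneighbor; `0` if there is none. -/
def mate (dir : Bool) (u i : ℕ) : ℕ := (R.answer (.mate dir) u i).getD 0

/-- `v` is an out- or inneighbor of `u`. -/
def adj (dir : Bool) (u v : ℕ) : Prop := ∃ i < R.deg dir u, R.head dir u i = v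

variable {R} {dir : Bool} {u v i : ℕ}

theorem lt_of_pos_deg (h : 0 < R.deg dir u) : u < n := by
  by_contra hu
  cases dir <;> simp [deg, Query.deg, answer, hu] at h

theorem lt_of_lt_deg (h : i < R.deg dir u) : u < n := lt_of_pos_deg (Nat.zero_lt_of_lt h)

theorem answer_deg (hu : u < n) : R.answer (.deg dir) u i = some (R.deg dir u) := by
  cases dir <;> simp [deg, Query.deg, answer, hu]

theorem deg_false (hu : u < n) : R.deg false u = R.outDeg ⟨u, hu⟩ := by
  simp [deg, Query.deg, answer, hu]

theorem deg_true (hu : u < n) : R.deg true u = R.inDeg ⟨u, hu⟩ := by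
  simp [deg, Query.deg, answer, hu]

theorem head_false (hu : u < n) (hi : i < R.outDeg ⟨u, hu⟩) :
    R.head false u i = R.outHead ⟨u, hu⟩ ⟨i, hi⟩ := by
  simp [head, Query.head, answer, hu, hi]

theorem head_true (hu : u < n) (hi : i < R.inDeg ⟨u, hu⟩) :
    R.head true u i = R.inHead ⟨u, hu⟩ ⟨i, hi⟩ := by
  simp [head, Query.head, answer, hu, hi]

theorem mate_false (hu : u < n) (hi : i < R.outDeg ⟨u, hu⟩) :
    R.mate false u i = R.outMate ⟨u, hu⟩ ⟨i, hi⟩ := by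
  simp [mate, Query.mate, answer, hu, hi]

theorem mate_true (hu : u < n) (hi : i < R.inDeg ⟨u, hu⟩) :
    R.mate true u i = R.inMate ⟨u, hu⟩ ⟨i, hi⟩ := by
  simp [mate, Query.mate, answer, hu, hi]

theorem answer_head (h : i < R.deg dir u) :
    R.answer (.head dir) u i = some (R.head dir u i) := by
  have hu := lt_of_lt_deg h
  cases dir
  · rw [deg_false hu] at h; simp [head, Query.head, answer, hu, h]
  · rw [deg_true hu] at h; simp [head, Query.head, answer, hu, h]

theorem answer_mate (h : i < R.deg dir u) :
    R.answer (.mate dir) u i = some (R.mate dir u i) := by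
  have hu := lt_of_lt_deg h
  cases dir
  · rw [deg_false hu] at h; simp [mate, Query.mate, answer, hu, h]
  · rw [deg_true hu] at h; simp [mate, Query.mate, answer, hu, h]

theorem head_lt (h : i < R.deg dir u) : R.head dir u i < n := by
  have hu := lt_of_lt_deg h
  cases dir
  · rw [deg_false hu] at h; rw [head_false hu h]; exact Fin.is_lt _
  · rw [deg_true hu] at h; rw [head_true hu h]; exact Fin.is_lt _

theorem mate_lt (h : i < R.deg dir u) : R.mate dir u i < R.deg (!dir) (R.head dir u i) := by
  have hu := lt_of_lt_deg h
  have hh := head_lt h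
  cases dir
  · rw [Bool.not_false, deg_true hh]
    rw [deg_false hu] at h; simp only [mate_false hu h, head_false hu h]
    exact Fin.is_lt _
  · rw [Bool.not_true, deg_false hh]
    rw [deg_true hu] at h; simp only [mate_true hu h, head_true hu h]
    exact Fin.is_lt _

theorem head_mate (h : i < R.deg dir u) : R.head (!dir) (R.head dir u i) (R.mate dir u i) = u := by
  have hu := lt_of_lt_deg h
  cases dir
  · rw [deg_false hu] at h
    rw [head_false hu h, mate_false hu h, Bool.not_false, head_true (Fin.is_lt _) (Fin.is_lt _)]
    exact congrArg Fin.val (R.inHead_outMate ⟨u, hu⟩ ⟨i, h⟩)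
  · rw [deg_true hu] at h
    rw [head_true hu h, mate_true hu h, Bool.not_true, head_false (Fin.is_lt _) (Fin.is_lt _)]
    exact congrArg Fin.val (R.outHead_inMate ⟨u, hu⟩ ⟨i, h⟩)

theorem head_inj {j : ℕ} (hi : i < R.deg dir u) (hj : j < R.deg dir u)
    (h : R.head dir u i = R.head dir u j) : i = j := by
  have hu := lt_of_lt_deg hi
  cases dir
  · rw [deg_false hu] at hi hj
    rw [head_false hu hi, head_false hu hj] at h
    simpa using R.outHead_injective _ (Fin.ext h)
  · rw [deg_true hu] at hi hj
    rw [head_true hu hi, head_true hu hj] at h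
    simpa using R.inHead_injective _ (Fin.ext h)

theorem mate_mate (h : i < R.deg dir u) : R.mate (!dir) (R.head dir u i) (R.mate dir u i) = i := by
  have h1 := mate_lt h
  have h2 := mate_lt h1
  have h3 := head_mate h1
  rw [head_mate h, Bool.not_not] at h2
  rw [head_mate h, Bool.not_not] at h3
  exact head_inj h2 h h3

theorem adj_not : R.adj (!dir) u v ↔ R.adj dir v u := by
  constructor
  · rintro ⟨i, hi, rfl⟩
    have h1 := mate_lt hi
    have h2 := head_mate hi
    rw [Bool.not_not] at h1 h2
    exact ⟨_, h1, h2⟩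
  · rintro ⟨i, hi, rfl⟩
    exact ⟨_, mate_lt hi, head_mate hi⟩

theorem adj_false : R.adj false u v ↔ ∃ (hu : u < n) (hv : v < n), G.Adj ⟨u, hu⟩ ⟨v, hv⟩ := by
  constructor
  · rintro ⟨i, hi, rfl⟩
    have hu := lt_of_lt_deg hi
    refine ⟨hu, head_lt hi, ?_⟩
    rw [deg_false hu] at hi
    rw [← R.exists_outHead_iff]
    exact ⟨⟨i, hi⟩, Fin.ext (head_false hu hi).symm⟩
  · rintro ⟨hu, hv, h⟩
    obtain ⟨i, hi⟩ := (R.exists_outHead_iff _ _).2 h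
    refine ⟨i, by rw [deg_false hu]; exact i.2, ?_⟩
    rw [head_false hu i.2]; exact congrArg Fin.val hi

theorem deg_le : R.deg dir u ≤ n := by
  have : Function.Injective fun i : Fin (R.deg dir u) =>
      (⟨R.head dir u i, head_lt i.2⟩ : Fin n) := by
    intro i j h
    exact Fin.ext (head_inj i.2 j.2 (congrArg Fin.val h))
  simpa using Fintype.card_le_of_injective _ this

theorem adj.pos_deg (h : R.adj dir u v) : 0 < R.deg dir u := by
  obtain ⟨i, hi, -⟩ := h; omega

theorem adj.pos_codeg (h : R.adj dir u v) : 0 < R.deg (!dir) v := (adj_not.2 h).pos_deg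

theorem adj.lt_left (h : R.adj dir u v) : u < n := lt_of_pos_deg h.pos_deg

theorem adj.lt_right (h : R.adj dir u v) : v < n := lt_of_pos_deg h.pos_codeg

theorem adj_head (h : i < R.deg dir u) : R.adj dir u (R.head dir u i) := ⟨i, h, rfl⟩

theorem sum_deg (dir : Bool) : ∑ u ∈ Finset.range n, R.deg dir u = edgeCount G := by
  classical
  have key : ∀ dir, (Finset.range n).sum (R.deg dir) =
      Nat.card {e : ℕ × ℕ // R.adj dir e.1 e.2} := by
    intro dir
    have e : (Σ u : Fin n, Fin (R.deg dir u)) ≃ {e : ℕ × ℕ // R.adj dir e.1 e.2} := by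
      refine Equiv.ofBijective (fun p => ⟨(p.1, R.head dir p.1 p.2), adj_head p.2.2⟩) ⟨?_, ?_⟩
      · rintro ⟨⟨u, hu⟩, ⟨i, hi⟩⟩ ⟨⟨v, hv⟩, ⟨j, hj⟩⟩ h
        simp only [Subtype.mk.injEq, Prod.mk.injEq] at h
        obtain ⟨rfl, h⟩ := h
        obtain rfl := head_inj hi hj h
        rfl
      · rintro ⟨⟨u, v⟩, i, hi, h⟩
        refine ⟨⟨⟨u, lt_of_lt_deg hi⟩, ⟨i, hi⟩⟩, ?_⟩
        simp only at h
        simp [h]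
    rw [← Nat.card_congr e, Nat.card_eq_fintype_card, Fintype.card_sigma]
    simp [Finset.sum_range]
  have h0 : Nat.card {e : ℕ × ℕ // R.adj false e.1 e.2} = edgeCount G := by
    rw [edgeCount, ← Nat.card_coe_set_eq]
    refine Nat.card_congr (Equiv.ofBijective
      (fun e => ⟨(⟨e.1.1, e.2.lt_left⟩, ⟨e.1.2, e.2.lt_right⟩), ?_⟩) ⟨?_, ?_⟩)
    · exact (adj_false.1 e.2).2.2
    · rintro ⟨⟨u, v⟩, h⟩ ⟨⟨u', v'⟩, h'⟩ he
      simpa using he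
    · rintro ⟨⟨u, v⟩, h⟩
      exact ⟨⟨(u, v), adj_false.2 ⟨u.2, v.2, h⟩⟩, rfl⟩
  have h1 : Nat.card {e : ℕ × ℕ // R.adj true e.1 e.2} =
      Nat.card {e : ℕ × ℕ // R.adj false e.1 e.2} :=
    Nat.card_congr ((Equiv.prodComm ℕ ℕ).subtypeEquiv fun e => by
      simpa using adj_not (R := R) (dir := false) (u := e.1) (v := e.2))
  cases dir
  · rw [key, h0]
  · rw [key, h1, h0]

variable (R)

/-- The vertex `u` has an edge. -/
def touched (u : ℕ) : Prop := 0 < R.deg false u ∨ 0 < R.deg true u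

/-- The vertex `u` has both an incoming and an outgoing edge.  Every other vertex is a strongly
connected component of its own. -/
def core (u : ℕ) : Prop := 0 < R.deg false u ∧ 0 < R.deg true u

variable {R}

theorem touched_of_deg (h : 0 < R.deg dir u) : R.touched u := by
  cases dir
  · exact .inl h
  · exact .inr h

theorem core.touched (h : R.core u) : R.touched u := .inl h.1

theorem core.lt (h : R.core u) : u < n := lt_of_pos_deg h.1

theorem touched.lt (h : R.touched u) : u < n := h.elim lt_of_pos_deg lt_of_pos_deg

theorem touched_head (h : i < R.deg dir u) : R.touched (R.head dir u i) :=
  touched_of_deg (adj_head h).pos_codeg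

end AdjArrays

/-! ### Memory layout -/

/-!
The variables `24` to `31` hold the parameters of the layout (`Layout.fx`), variable `6` holds the height
of the bit stack, `7` the length of the log, `16` the vertex considered by a pass over all vertices, and
`15` is nonzero until a component has been output. The other variables are local to small parts of the
program. The tables of the powers of `2`, `3` and `n + 1` start at the addresses `0`, `w` and `2 * w`.
-/

/-- The parameters of the memory layout: the numbers of digits per word for the bases `2`, `3` and
`n + 1`; the addresses of the bit stack, the log, the block pointers and the colors; whether block
pointers are used; the capacities of the four arrays; and the block pointers. -/
structure Layout where
  K2 : ℕ
  K3 : ℕ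
  KP : ℕ
  AST : ℕ
  ALOG : ℕ
  APTR : ℕ
  ACOL : ℕ
  LOW : ℕ
  cst : ℕ
  clog : ℕ
  cptr : ℕ
  ccol : ℕ
  p : ℕ → ℕ

/-- The values of the variables that are constant after the initialization. -/
def Layout.fx (L : Layout) : Fin 32 → ℕ := fun x =>
  if x = 24 then L.K2 else if x = 25 then L.K3 else if x = 26 then L.KP else if x = 27 then L.AST
  else if x = 28 then L.ALOG else if x = 29 then L.APTR else if x = 30 then L.ACOL else L.LOW

/-- The position of the color of the vertex `x` in the array of colors. -/
def Layout.ix (L : Layout) (w x : ℕ) : ℕ :=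
  if L.LOW = 0 then x else L.p (x / (w / 400)) * (w / 400) + x % (w / 400)

/-- The conditions under which a layout serves the algorithm. -/
structure Layout.Valid (L : Layout) {n : ℕ} {G : Digraph (Fin n)} (R : AdjArrays G) (S w : ℕ) :
    Prop where
  S_lt : S < 2 ^ w
  n_lt : 4 * (n + 2) < 2 ^ w
  cst_lt : L.cst + 2 < 2 ^ w
  clog_lt : L.clog + 2 < 2 ^ w
  ccol_lt : L.ccol + 2 < 2 ^ w
  w_pos : 400 ≤ w
  T2 : L.K2 ≤ L.AST
  T3 : w + L.K3 ≤ L.AST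
  TP : 2 * w + L.KP ≤ L.AST
  st_le : L.AST + L.cst / L.K2 + 1 ≤ L.ALOG
  log_le : L.ALOG + L.clog / L.K2 + 1 ≤ L.APTR
  ptr_le : L.APTR + L.cptr / L.KP + 1 ≤ L.ACOL
  ix_lt : ∀ x, R.touched x → L.ix w x < L.ccol
  ix_inj : ∀ x y, R.touched x → R.touched y → L.ix w x = L.ix w y → x = y
  blk_lt : L.LOW ≠ 0 → ∀ x < n, x / (w / 400) < L.cptr

/-- The variables and the memory are as prescribed by the layout, with colors `col` (of the vertices
with an edge) and with the contents `log` and `st` of the log and the bit stack. -/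
structure Good {n : ℕ} {G : Digraph (Fin n)} (R : AdjArrays G) (S w : ℕ) (L : Layout)
    (s : NState 32) (col log st : ℕ → ℕ) : Prop where
  fix : ∀ x : Fin 32, 24 ≤ x → s.v x = L.fx x
  st : DRep S w s.m L.AST 0 L.K2 2 L.cst st
  log : DRep S w s.m L.ALOG 0 L.K2 2 L.clog log
  ptr : DRep S w s.m L.APTR (2 * w) L.KP (n + 1) L.cptr L.p
  col : ∃ c, DRep S w s.m L.ACOL w L.K3 3 L.ccol c ∧ ∀ x, R.touched x → c (L.ix w x) = col x

/-- The bit stack. -/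
def arrSt : DArr := ⟨27, 24, 0, 2⟩
/-- The log. -/
def arrLog : DArr := ⟨28, 24, 0, 2⟩
/-- The block pointers. -/
def arrPtr : DArr := ⟨29, 26, Expr.wordLength * 2, Expr.numVertices + 1⟩
/-- The colors. -/
def arrCol : DArr := ⟨30, 25, Expr.wordLength, 3⟩

/-- Computes the position of the color of the vertex `x` in variable `2`. -/
def cmdIx (x : Fin 32) : Cmd 32 :=
  .ite (31 : Fin 32)
    (.assign 2 ((x : Expr 32) / (Expr.wordLength / 400)) ;;
      arrPtr.get 2 2 ;;
      .assign 2 (((2 : Fin 32) : Expr 32) * (Expr.wordLength / 400) +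
        (x : Expr 32) % (Expr.wordLength / 400)))
    (.assign 2 x)

/-- Reads the color of the vertex `x`. -/
def colGet (y x : Fin 32) : Cmd 32 := cmdIx x ;; arrCol.get y 2

/-- Sets the color of the vertex `x`. -/
def colPut (x : Fin 32) (e : Expr 32) : Cmd 32 := cmdIx x ;; arrCol.put 2 e

/-- At most the variables in `l` differ. -/
abbrev Same (l : List (Fin 32)) (s s' : NState 32) : Prop := ∀ y, y ∉ l → s'.v y = s.v y

section Interface

variable {n : ℕ} {G : Digraph (Fin n)} {R : AdjArrays G} {S w : ℕ} {L : Layout} {s : NState 32}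
  {Q : ℕ → List OutSymbol → NState 32 → Prop} {col log st : ℕ → ℕ}

theorem Good.of_same {s' : NState 32} (h : Good R S w L s col log st) (hm : s'.m = s.m)
    (hv : ∀ x : Fin 32, 24 ≤ x → s'.v x = s.v x) : Good R S w L s' col log st :=
  ⟨fun x hx => by rw [hv x hx, h.fix x hx], hm ▸ h.st, hm ▸ h.log, hm ▸ h.ptr, hm ▸ h.col⟩

theorem Good.set (h : Good R S w L s col log st) {x : Fin 32} (hx : x < 24) (a : ℕ) :
    Good R S w L (s.set x a) col log st :=
  h.of_same rfl fun y hy => NState.set_v_ne _ _ (by rintro rfl; exact absurd hy (by simpa using hx))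

theorem WP.getSt (hL : L.Valid R S w) (h : Good R S w L s col log st) {x i : Fin 32} (hx : x < 24)
    (hx0 : x ≠ 0) (hi0 : i ≠ 0) (hi : s.v i < L.cst)
    (hQ : ∀ s', Good R S w L s' col log st → s'.v x = st (s.v i) → Same [0, x] s s' → Q 0 [] s') :
    WP R S w (arrSt.get x i) s Q := by
  have h2 := hL.n_lt
  refine WP.dget h.st hL.S_lt (h.fix _ (by decide)) (h.fix _ (by decide)) (by decide) (by decide)
    hi0 hx0 (fun s' => by simp [arrSt]) (fun s' => by simp [arrSt]; omega) hi fun t => ?_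
  refine hQ _ ((h.set (by decide) t).set hx _) (by simp) fun y hy => ?_
  simp at hy
  simp [NState.set_v, hy]

theorem WP.getLog (hL : L.Valid R S w) (h : Good R S w L s col log st) {x i : Fin 32} (hx : x < 24)
    (hx0 : x ≠ 0) (hi0 : i ≠ 0) (hi : s.v i < L.clog)
    (hQ : ∀ s', Good R S w L s' col log st → s'.v x = log (s.v i) → Same [0, x] s s' → Q 0 [] s') :
    WP R S w (arrLog.get x i) s Q := by
  have h2 := hL.n_lt
  refine WP.dget h.log hL.S_lt (h.fix _ (by decide)) (h.fix _ (by decide)) (by decide) (by decide)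
    hi0 hx0 (fun s' => by simp [arrLog]) (fun s' => by simp [arrLog]; omega) hi fun t => ?_
  refine hQ _ ((h.set (by decide) t).set hx _) (by simp) fun y hy => ?_
  simp at hy
  simp [NState.set_v, hy]

theorem WP.putSt (hL : L.Valid R S w) (h : Good R S w L s col log st) {i : Fin 32} {e : Expr 32}
    {ev : ℕ} (hi0 : i ≠ 0) (hi1 : i ≠ 1) (hi : s.v i < L.cst)
    (he : ∀ t z, e.ok n w ((s.set 0 t).set 1 z) ∧ e.val n w ((s.set 0 t).set 1 z) = ev)
    (hev : ev < 2)
    (hQ : ∀ s', Good R S w L s' col log (Function.update st (s.v i) ev) → Same [0, 1] s s' →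
      Q 0 [] s') :
    WP R S w (arrSt.put i e) s Q := by
  have h2 := hL.n_lt
  refine WP.dput h.st hL.S_lt (h.fix _ (by decide)) (h.fix _ (by decide)) (by decide) (by decide)
    hi0 (by decide) (by decide) hi1
    (fun s' => by simp [arrSt]) (fun s' => by simp [arrSt]; omega) hi he hev fun t z m' hm hf => ?_
  have a1 := hL.st_le
  have a2 := hL.log_le
  have a3 := hL.ptr_le
  have a4 := hL.T2
  have a5 := hL.T3
  have a6 := hL.TP
  have z1 := Nat.zero_le (L.cst / L.K2)
  have z2 := Nat.zero_le (L.clog / L.K2)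
  have z3 := Nat.zero_le (L.cptr / L.KP)
  refine hQ _ ⟨fun y hy => ?_, hm, ?_, ?_, ?_⟩ fun y hy => ?_
  · rw [← ((h.set (x := 0) (by decide) t).set (x := 1) (by decide) z).fix y hy]
  · exact h.log.frame (fun a _ _ => hf a (by omega)) fun a _ _ => hf a (by omega)
  · exact h.ptr.frame (fun a _ _ => hf a (by omega)) fun a _ _ => hf a (by omega)
  · obtain ⟨c, hc, hc'⟩ := h.col
    exact ⟨c, hc.frame (fun a _ _ => hf a (by omega)) fun a _ _ => hf a (by omega), hc'⟩
  · simp at hy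
    simp [NState.set_v, hy]

theorem WP.putLog (hL : L.Valid R S w) (h : Good R S w L s col log st) {i : Fin 32} {e : Expr 32}
    {ev : ℕ} (hi0 : i ≠ 0) (hi1 : i ≠ 1) (hi : s.v i < L.clog)
    (he : ∀ t z, e.ok n w ((s.set 0 t).set 1 z) ∧ e.val n w ((s.set 0 t).set 1 z) = ev)
    (hev : ev < 2)
    (hQ : ∀ s', Good R S w L s' col (Function.update log (s.v i) ev) st → Same [0, 1] s s' →
      Q 0 [] s') :
    WP R S w (arrLog.put i e) s Q := by
  have h2 := hL.n_lt
  refine WP.dput h.log hL.S_lt (h.fix _ (by decide)) (h.fix _ (by decide)) (by decide) (by decide)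
    hi0 (by decide) (by decide) hi1
    (fun s' => by simp [arrLog]) (fun s' => by simp [arrLog]; omega) hi he hev fun t z m' hm hf => ?_
  have a1 := hL.st_le
  have a2 := hL.log_le
  have a3 := hL.ptr_le
  have a4 := hL.T2
  have a5 := hL.T3
  have a6 := hL.TP
  have z1 := Nat.zero_le (L.cst / L.K2)
  have z2 := Nat.zero_le (L.clog / L.K2)
  have z3 := Nat.zero_le (L.cptr / L.KP)
  refine hQ _ ⟨fun y hy => ?_, ?_, hm, ?_, ?_⟩ fun y hy => ?_
  · rw [← ((h.set (x := 0) (by decide) t).set (x := 1) (by decide) z).fix y hy]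
  · exact h.st.frame (fun a _ _ => hf a (by omega)) fun a _ _ => hf a (by omega)
  · exact h.ptr.frame (fun a _ _ => hf a (by omega)) fun a _ _ => hf a (by omega)
  · obtain ⟨c, hc, hc'⟩ := h.col
    exact ⟨c, hc.frame (fun a _ _ => hf a (by omega)) fun a _ _ => hf a (by omega), hc'⟩
  · simp at hy
    simp [NState.set_v, hy]

theorem WP.cmdIx (hL : L.Valid R S w) (h : Good R S w L s col log st) {x : Fin 32}
    (hx0 : x ≠ 0) (hx2 : x ≠ 2) (hx : R.touched (s.v x))
    (hQ : ∀ s', Good R S w L s' col log st → s'.v 2 = L.ix w (s.v x) → Same [0, 2] s s' →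
      Q 0 [] s') :
    WP R S w (cmdIx x) s Q := by
  have h2 := hL.n_lt
  have hw := hL.w_pos
  have hw' : 400 < 2 ^ w := lt_of_le_of_lt hw Nat.lt_two_pow_self
  have hix := hL.ix_lt _ hx
  have hcc := hL.ccol_lt
  have h31 : s.v 31 = L.LOW := h.fix 31 (by decide)
  refine WP.ite (by simp) (fun hb => ?_) fun hb => ?_
  · rw [Expr.val_var, h31] at hb
    have hix' : L.ix w (s.v x) = L.p (s.v x / (w / 400)) * (w / 400) + s.v x % (w / 400) := by
      simp [Layout.ix, hb]
    rw [hix'] at hix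
    have hblk := hL.blk_lt hb _ hx.lt
    refine WP.seq_assign (by simpa using hw') ?_
    refine WP.seq0 (WP.dget (h.set (by decide) _).ptr hL.S_lt ((h.set (by decide) _).fix _ (by decide))
      ((h.set (by decide) _).fix _ (by decide)) (by decide) (by decide) (by decide) (by decide)
      (fun s' => ?_) (fun s' => ?_) ?_ fun t => ⟨rfl, rfl, ?_⟩)
    · have h0 : 2 * w < 2 ^ w := by
        have h1 : w - 2 < 2 ^ (w - 2) := Nat.lt_two_pow_self
        have h3 : 2 ^ 2 * 2 ^ (w - 2) = 2 ^ w := by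
          rw [← pow_add]; congr 1; omega
        rw [← h3]
        omega
      simp [arrPtr, mul_comm w 2]; omega
    · simp [arrPtr]; omega
    · simpa using hblk
    · refine WP.assign ?_ ?_
      · simp [NState.set_v, hx0, hx2]
        have := Nat.zero_le (s.v x % (w / 400))
        have hz := Nat.zero_le (L.p (s.v x / (w / 400)) * (w / 400))
        omega
      · refine hQ _ (((h.set (by decide) _).set (by decide) _ |>.set (by decide) _).set
          (by decide) _) ?_ fun y hy => ?_
        · simp [NState.set_v, hx0, hx2, hix']
        · simp at hy
          simp [NState.set_v, hy]
  · rw [Expr.val_var, h31] at hb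
    refine WP.assign (by simp) (hQ _ (h.set (by decide) _) (by simp [Layout.ix, hb]) fun y hy => ?_)
    simp at hy
    simp [NState.set_v, hy]

theorem WP.colGet (hL : L.Valid R S w) (h : Good R S w L s col log st) {x y : Fin 32}
    (hx0 : x ≠ 0) (hx2 : x ≠ 2) (hy0 : y ≠ 0) (hy : y < 24) (hx : R.touched (s.v x))
    (hQ : ∀ s', Good R S w L s' col log st → s'.v y = col (s.v x) → Same [0, 2, y] s s' →
      Q 0 [] s') :
    WP R S w (colGet y x) s Q := by
  have h2 := hL.n_lt
  have hww : w < 2 ^ w := Nat.lt_two_pow_self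
  refine WP.seq0 (WP.cmdIx hL h hx0 hx2 hx fun s1 g1 h1 f1 => ⟨rfl, rfl, ?_⟩)
  obtain ⟨c, hc, hc'⟩ := g1.col
  refine WP.dget hc hL.S_lt (g1.fix _ (by decide)) (g1.fix _ (by decide)) (by decide) (by decide)
    (by decide) hy0 (fun s' => by simp [arrCol]) (fun s' => by simp [arrCol]; omega)
    (by rw [h1]; exact hL.ix_lt _ hx)
    fun t => ?_
  refine hQ _ ((g1.set (by decide) t).set hy _) (by simp [h1, hc' _ hx]) fun z hz => ?_
  simp at hz
  simp [NState.set_v, hz, f1]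

theorem WP.colPut (hL : L.Valid R S w) (h : Good R S w L s col log st) {x : Fin 32} {ev : ℕ}
    (hx0 : x ≠ 0) (hx2 : x ≠ 2) (hx : R.touched (s.v x)) (hev : ev < 3)
    (hQ : ∀ s', Good R S w L s' (Function.update col (s.v x) ev) log st → Same [0, 1, 2] s s' →
      Q 0 [] s') :
    WP R S w (colPut x (.const ev)) s Q := by
  have h2 := hL.n_lt
  have hww : w < 2 ^ w := Nat.lt_two_pow_self
  refine WP.seq0 (WP.cmdIx hL h hx0 hx2 hx fun s1 g1 h1 f1 => ⟨rfl, rfl, ?_⟩)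
  obtain ⟨c, hc, hc'⟩ := g1.col
  refine WP.dput hc hL.S_lt (g1.fix _ (by decide)) (g1.fix _ (by decide)) (by decide) (by decide)
    (by decide) (by decide) (by decide) (by decide)
    (fun s' => by simp [arrCol]) (fun s' => by simp [arrCol]; omega)
    (by rw [h1]; exact hL.ix_lt _ hx) (ev := ev) (fun t z => ⟨by simp; omega, rfl⟩) hev fun t z m' hm hf => ?_
  have a1 := hL.st_le
  have a2 := hL.log_le
  have a3 := hL.ptr_le
  have a4 := hL.T2
  have a5 := hL.T3
  have a6 := hL.TP
  have z1 := Nat.zero_le (L.cst / L.K2)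
  have z2 := Nat.zero_le (L.clog / L.K2)
  have z3 := Nat.zero_le (L.cptr / L.KP)
  refine hQ _ ⟨fun y hy => ?_, ?_, ?_, ?_, _, hm, fun y hy => ?_⟩ fun y hy => ?_
  · rw [← ((g1.set (x := 0) (by decide) t).set (x := 1) (by decide) z).fix y hy]
  · exact g1.st.frame (fun a _ _ => hf a (by omega)) fun a _ _ => hf a (by omega)
  · exact g1.log.frame (fun a _ _ => hf a (by omega)) fun a _ _ => hf a (by omega)
  · exact g1.ptr.frame (fun a _ _ => hf a (by omega)) fun a _ _ => hf a (by omega)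
  · rw [h1]
    by_cases hyx : y = s.v x
    · subst hyx; simp
    · rw [Function.update_of_ne hyx, Function.update_of_ne, hc' _ hy]
      exact fun hh => hyx (hL.ix_inj _ _ hy hx hh)
  · simp at hy
    simp [NState.set_v, hy, f1]

end Interface

/-! ### Bit strings on the stack and in the log -/

/-- The number with the `f` binary digits `st p, st (p + 1), …`, the least significant one first. -/
def field (st : ℕ → ℕ) (p : ℕ) : ℕ → ℕ
  | 0 => 0
  | f + 1 => st p + 2 * field st (p + 1) f

theorem field_congr {st st' : ℕ → ℕ} : ∀ {f p : ℕ},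
    (∀ i, p ≤ i → i < p + f → st' i = st i) → field st' p f = field st p f
  | 0, _, _ => rfl
  | f + 1, p, h => by
    rw [field, field, h p le_rfl (by omega), field_congr fun i h1 h2 => h i (by omega) (by omega)]

theorem field_lt {st : ℕ → ℕ} : ∀ {f p : ℕ},
    (∀ i, p ≤ i → i < p + f → st i < 2) → field st p f < 2 ^ f
  | 0, _, _ => by simp [field]
  | f + 1, p, h => by
    have h1 := h p le_rfl (by omega)
    have h2 := field_lt (f := f) (p := p + 1) fun i h1 h2 => h i (by omega) (by omega)
    rw [field, pow_succ]; omega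

/-- The number of bits used for a position in an array of `d` entries, in variable `10`, from `d` in
variable `12`. -/
def cmdBits : Cmd 32 :=
  .assign 10 (.const 0) ;; .assign 11 (.const 1) ;;
  .loop (.op .lt (11 : Fin 32) (12 : Fin 32))
    (.assign 11 (((11 : Fin 32) : Expr 32) * .const 2) ;;
      .assign 10 (((10 : Fin 32) : Expr 32) + .const 1))

/-- Pushes the binary representation of variable `9`, with the number of bits in variable `10`. -/
def cmdPush : Cmd 32 :=
  .loop (10 : Fin 32)
    (arrSt.put 6 (((9 : Fin 32) : Expr 32) % .const 2) ;;
      .assign 9 (((9 : Fin 32) : Expr 32) / .const 2) ;;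
      .assign 6 (((6 : Fin 32) : Expr 32) + .const 1) ;;
      .assign 10 (((10 : Fin 32) : Expr 32) - .const 1))

/-- Pops a number to variable `9`, with the number of bits in variable `10`. -/
def cmdPop : Cmd 32 :=
  .assign 9 (.const 0) ;;
  .loop (10 : Fin 32)
    (.assign 6 (((6 : Fin 32) : Expr 32) - .const 1) ;;
      arrSt.get 8 6 ;;
      .assign 9 (((9 : Fin 32) : Expr 32) * .const 2 + (8 : Fin 32)) ;;
      .assign 10 (((10 : Fin 32) : Expr 32) - .const 1))

/-- Appends a bit to the log. -/
def logPush (b : ℕ) : Cmd 32 :=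
  arrLog.put 7 (.const b) ;; .assign 7 (((7 : Fin 32) : Expr 32) + .const 1)

/-- Removes the last bit of the log, to variable `13`. -/
def logPop : Cmd 32 :=
  .assign 7 (((7 : Fin 32) : Expr 32) - .const 1) ;; arrLog.get 13 7

/-- The log starts with the entries of `l`. -/
def LogRep (log : ℕ → ℕ) (l : List ℕ) : Prop := ∀ i (h : i < l.length), log i = l[i]

theorem LogRep.append {log : ℕ → ℕ} {l : List ℕ} (h : LogRep log l) (b : ℕ) :
    LogRep (Function.update log l.length b) (l ++ [b]) := by
  intro i hi
  by_cases h1 : i < l.length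
  · rw [Function.update_of_ne h1.ne, List.getElem_append_left h1]; exact h i h1
  · have : i = l.length := by simp at hi; omega
    subst this; simp

theorem LogRep.of_append {log : ℕ → ℕ} {l l' : List ℕ} (h : LogRep log (l ++ l')) :
    LogRep log l := by
  intro i hi
  rw [h i (by simp; omega), List.getElem_append_left hi]

theorem LogRep.last {log : ℕ → ℕ} {l : List ℕ} {b : ℕ} (h : LogRep log (l ++ [b])) :
    log l.length = b := by
  rw [h l.length (by simp)]; simp

namespace WP

variable {n : ℕ} {G : Digraph (Fin n)} {R : AdjArrays G} {S w : ℕ} {L : Layout} {s : NState 32}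
  {Q : ℕ → List OutSymbol → NState 32 → Prop} {col log st : ℕ → ℕ}

theorem cmdBits {d : ℕ} (hd : s.v 12 = d) (hdw : 2 * d + 2 < 2 ^ w)
    (hQ : ∀ s' : NState 32, s'.m = s.m → s'.v 10 = Nat.clog 2 d → Same [10, 11] s s' →
      Q (Nat.clog 2 d) [] s') :
    WP R S w cmdBits s Q := by
  have hw0 : w ≠ 0 := by rintro rfl; simp at hdw
  refine seq_assign (by simp) (seq_assign (by simp; omega) ?_)
  refine loop_inv (fun q o s' => o = [] ∧ s'.m = s.m ∧ s'.v 10 = q ∧ s'.v 11 = 2 ^ q ∧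
    q ≤ Nat.clog 2 d ∧ Same [10, 11] s s') (fun s' => Nat.clog 2 d - s'.v 10) ?_ ?_ ?_ ?_
  · refine ⟨rfl, rfl, by simp [NState.set_v], by simp [NState.set_v], Nat.zero_le _,
      fun y hy => ?_⟩
    simp at hy; simp [NState.set_v, hy]
  · simp
  · rintro q o s' ⟨rfl, hm, h10, h11, hq, hs⟩ hb
    have h12 : s'.v 12 = d := by rw [hs 12 (by decide), hd]
    simp only [Expr.val_lt, Expr.val_var, h11, h12] at hb
    have hlt : 2 ^ q < d := by by_contra h; simp [h] at hb
    have hq' : q < Nat.clog 2 d := (Nat.lt_clog_iff_pow_lt (by norm_num)).2 hlt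
    have hq2 : q < 2 ^ q := Nat.lt_two_pow_self
    refine seq_assign (by simp [h11]; omega) (assign (by simp [NState.set_v, h10]; omega) ?_)
    refine ⟨⟨rfl, hm, by simp [NState.set_v, h10], by simp [NState.set_v, h11, pow_succ], hq',
      fun y hy => ?_⟩, ?_⟩
    · have := hs y hy
      simp at hy; simp [NState.set_v, hy, this]
    · simp [NState.set_v, h10]; omega
  · rintro q o s' ⟨rfl, hm, h10, h11, hq, hs⟩ hb
    have h12 : s'.v 12 = d := by rw [hs 12 (by decide), hd]
    simp only [Expr.val_lt, Expr.val_var, h11, h12] at hb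
    have hle : d ≤ 2 ^ q := by by_contra h; simp [not_le.1 h] at hb
    have : q = Nat.clog 2 d := le_antisymm hq ((Nat.clog_le_iff_le_pow (by norm_num)).2 hle)
    subst this
    exact hQ s' hm h10 hs

theorem cmdPush (hL : L.Valid R S w) {f : ℕ} (h : Good R S w L s col log st) (hf : s.v 10 = f)
    (hsp : s.v 6 + f ≤ L.cst)
    (hQ : ∀ s' st', Good R S w L s' col log st' → s'.v 6 = s.v 6 + f →
      (∀ i < s.v 6, st' i = st i) → field st' (s.v 6) f = s.v 9 % 2 ^ f →
      Same [0, 1, 6, 9, 10] s s' → Q f [] s') :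
    WP R S w cmdPush s Q := by
  have hn := hL.n_lt
  have hw0 := hL.w_pos
  have hc := hL.cst_lt
  induction f generalizing s st Q with
  | zero =>
    refine loop_false (by simp) (by simp [hf]) (hQ s st h (by simp) (fun _ _ => rfl) ?_
      fun _ _ => rfl)
    simp [field, Nat.mod_one]
  | succ f ih =>
    refine loop_true (by simp) (by simp [hf]) ?_
    refine seq0 (putSt hL h (ev := s.v 9 % 2) (by decide) (by decide) (by omega)
      (fun t z => ⟨by simp; omega, by simp [NState.set_v]⟩) (Nat.mod_lt _ (by norm_num))
      fun s1 g1 f1 => ⟨rfl, rfl, ?_⟩)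
    have e6 := f1 6 (by decide)
    have e9 := f1 9 (by decide)
    have e10 := f1 10 (by decide)
    refine seq_assign (by simp; omega) (seq_assign (by simp [NState.set_v, e6]; omega)
      (assign (by simp [NState.set_v, e10, hf]; omega) ?_))
    refine ih (((g1.set (by decide) _).set (by decide) _).set (by decide) _)
      (by simp [NState.set_v, e10, hf]) (by simp [NState.set_v, e6]; omega) ?_
    intro s' st' g' h6 hst hfl hs
    simp [NState.set_v, e6, e9] at h6 hst hfl
    have hq : Q (f + 1) [] s' := by
      refine hQ s' st' g' (by omega) (fun i hi => ?_) ?_ ?_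
      · rw [hst i (by omega), Function.update_of_ne hi.ne]
      · rw [field, hst _ le_rfl, Function.update_self, hfl, pow_succ',
          Nat.mod_mul]
      · intro y hy
        rw [hs y hy]
        simp at hy
        simp [NState.set_v, hy, f1]
    simpa [add_comm] using hq

theorem cmdPop (hL : L.Valid R S w) {f p : ℕ} (h : Good R S w L s col log st) (hf : s.v 10 = f)
    (hfw : f < w) (hp : s.v 6 = p + f) (hsp : p + f ≤ L.cst)
    (hQ : ∀ s', Good R S w L s' col log st → s'.v 6 = p → s'.v 9 = field st p f →
      Same [0, 6, 8, 9, 10] s s' → Q f [] s') :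
    WP R S w cmdPop s Q := by
  have hn := hL.n_lt
  have hw0 := hL.w_pos
  have hc := hL.cst_lt
  have hbit : ∀ i, i < p + f → st i < 2 := fun i hi => h.st.digit_lt (by omega)
  refine seq_assign (by simp) ?_
  suffices H : ∀ g e s1, g + e = f → Good R S w L s1 col log st → s1.v 10 = g → s1.v 6 = p + g →
      s1.v 9 = field st (p + g) e → Same [0, 6, 8, 9, 10] s s1 →
      WP R S w (.loop (10 : Fin 32)
        (.assign 6 (((6 : Fin 32) : Expr 32) - .const 1) ;;
          arrSt.get 8 6 ;;
          .assign 9 (((9 : Fin 32) : Expr 32) * .const 2 + (8 : Fin 32)) ;;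
          .assign 10 (((10 : Fin 32) : Expr 32) - .const 1))) s1
        fun q o s' => q = g ∧ o = [] ∧ Q f [] s' by
    refine (H f 0 _ rfl (h.set (by decide) _) (by simp [NState.set_v, hf])
      (by simp [NState.set_v, hp]) (by simp [field]) ?_).conseq ?_
    · intro y hy
      simp at hy; simp [NState.set_v, hy]
    · rintro q o s' ⟨rfl, rfl, h⟩; exact h
  intro g
  induction g with
  | zero =>
    intro e s1 he g1 h10 h6 h9 hs
    obtain rfl : e = f := by omega
    exact loop_false (by simp) (by simp [h10]) ⟨rfl, rfl, hQ _ g1 h6 h9 hs⟩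
  | succ g ih =>
    intro e s1 he g1 h10 h6 h9 hs
    refine loop_true (by simp) (by simp [h10]) ?_
    refine seq_assign (by simp [h6]; omega) ?_
    refine seq0 (getSt hL (g1.set (by decide) _) (by decide) (by decide) (by decide)
      (by simp [NState.set_v, h6]; omega) fun s2 g2 h8 f2 => ⟨rfl, rfl, ?_⟩)
    have e6 := f2 6 (by decide)
    have e9 := f2 9 (by decide)
    have e10 := f2 10 (by decide)
    simp [NState.set_v, h6, h9, h10] at e6 e9 e10 h8
    have e6' : s2.v 6 = p + g := by omega
    have h8' : s2.v 8 = st (p + g) := by rw [h8]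
    have hlt : field st (p + g) (e + 1) < 2 ^ w :=
      (field_lt fun i _ hi => hbit i (by omega)).trans_le
        (Nat.pow_le_pow_right (by norm_num) (by omega))
    have hfe : field st (p + g) (e + 1) = st (p + g) + 2 * field st (p + (g + 1)) e := rfl
    refine seq_assign (by simp [e9, h8']; omega)
      (assign (by simp [NState.set_v, e10]; omega) ?_)
    refine (ih (e + 1) _ (by omega) ((g2.set (by decide) _).set (by decide) _)
      (by simp [NState.set_v, e10]) (by simp [NState.set_v, e6'])
      (by simp [NState.set_v, e9, h8', hfe]; ring) fun y hy => ?_).conseq ?_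
    · have hsy := hs y hy
      simp at hy; simp [NState.set_v, hy, f2, hsy]
    · rintro q o s' ⟨rfl, rfl, h⟩; exact ⟨by omega, rfl, h⟩

theorem logPush (hL : L.Valid R S w) (h : Good R S w L s col log st) {l : List ℕ} {b : ℕ}
    (hb : b < 2) (hl : LogRep log l) (h7 : s.v 7 = l.length) (hcap : l.length < L.clog)
    (hQ : ∀ s' log', Good R S w L s' col log' st → LogRep log' (l ++ [b]) →
      s'.v 7 = (l ++ [b]).length → Same [0, 1, 7] s s' → Q 0 [] s') :
    WP R S w (logPush b) s Q := by
  have hn := hL.n_lt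
  have hw0 := hL.w_pos
  have hc := hL.clog_lt
  refine seq0 (putLog hL h (ev := b) (by decide) (by decide) (by omega)
    (fun t z => ⟨by simp; omega, by simp⟩) hb fun s1 g1 f1 => ⟨rfl, rfl, ?_⟩)
  have e7 := f1 7 (by decide)
  refine assign (by simp [e7]; omega) ?_
  refine hQ _ _ (g1.set (by decide) _) (h7 ▸ hl.append b) (by simp [NState.set_v, e7, h7])
    fun y hy => ?_
  simp at hy; simp [NState.set_v, hy, f1]

theorem logPop (hL : L.Valid R S w) (h : Good R S w L s col log st) {l : List ℕ} {b : ℕ}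
    (hl : LogRep log (l ++ [b])) (h7 : s.v 7 = (l ++ [b]).length)
    (hcap : (l ++ [b]).length ≤ L.clog)
    (hQ : ∀ s', Good R S w L s' col log st → LogRep log l →
      s'.v 7 = l.length → s'.v 13 = b → Same [0, 7, 13] s s' → Q 0 [] s') :
    WP R S w logPop s Q := by
  have hn := hL.n_lt
  have hw0 := hL.w_pos
  simp at h7 hcap
  refine seq_assign (by simp [h7]; omega) ?_
  refine getLog hL (h.set (by decide) _) (by decide) (by decide) (by decide)
    (by simp [NState.set_v, h7]; omega) fun s1 g1 h13 f1 => ?_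
  refine hQ _ g1 hl.of_append (by rw [f1 7 (by decide)]; simp [NState.set_v, h7]) ?_ fun y hy => ?_
  · rw [h13]; simp [NState.set_v, h7, hl.last]
  · simp at hy; simp [NState.set_v, hy, f1]

end WP

/-! ### Depth-first search -/

/-- The histories of a depth-first search from `r` that enters the vertices with `ok`.
`Hist deg head ok r v i p D l f` says that the search can be at the `i`th edge of the vertex `v`, with
the tree edges leading to `v` listed in `p` as pairs of a vertex and a position, last edge first,
after it has discovered the vertices in `D` and finished those in `f`, in this order.  The log `l` has an
entry `0` for each edge not followed and an entry `1` for each tree edge along which the search has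
returned. -/
inductive Hist (deg : ℕ → ℕ) (head : ℕ → ℕ → ℕ) (ok : ℕ → Prop) (r : ℕ) :
    ℕ → ℕ → List (ℕ × ℕ) → List ℕ → List ℕ → List ℕ → Prop
  | start : Hist deg head ok r r 0 [] [r] [] []
  | skip {v i p D l f} : Hist deg head ok r v i p D l f → i < deg v →
      (head v i ∈ D ∨ ¬ ok (head v i)) → Hist deg head ok r v (i + 1) p D (l ++ [0]) f
  | down {v i p D l f} : Hist deg head ok r v i p D l f → i < deg v → head v i ∉ D →
      ok (head v i) → Hist deg head ok r (head v i) 0 ((v, i) :: p) (D ++ [head v i]) l f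
  | up {v u j p D l f} : Hist deg head ok r v (deg v) ((u, j) :: p) D l f →
      Hist deg head ok r u (j + 1) p D (l ++ [1]) (f ++ [v])

/-- `p` is a list of edges, last edge first, that form a path from `r` to `v`. -/
def IsPath (deg : ℕ → ℕ) (head : ℕ → ℕ → ℕ) (r : ℕ) : ℕ → List (ℕ × ℕ) → Prop
  | v, [] => v = r
  | v, (u, j) :: p => j < deg u ∧ head u j = v ∧ IsPath deg head r u p

theorem pair_sublist_append {D : List ℕ} {g x y : ℕ} (h : [g, x].Sublist (D ++ [y])) :
    [g, x].Sublist D ∨ x = y := by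
  rw [List.sublist_append_iff] at h
  obtain ⟨a, b, hab, ha, hb⟩ := h
  rcases b with _ | ⟨c, b⟩
  · left; simpa [hab] using ha
  · right
    have hb' : c :: b = [y] := by
      have := hb.length_le
      rcases b with _ | ⟨d, b⟩
      · simpa using hb
      · simp at this
    rw [hb'] at hab
    have := congrArg List.getLast? hab
    simpa using this

namespace Hist

variable {deg : ℕ → ℕ} {head : ℕ → ℕ → ℕ} {ok : ℕ → Prop} {r v i : ℕ} {p : List (ℕ × ℕ)}
  {D l f : List ℕ}

theorem isPath (h : Hist deg head ok r v i p D l f) : IsPath deg head r v p := by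
  induction h with
  | start => rfl
  | skip _ _ _ ih => exact ih
  | down _ hi _ _ ih => exact ⟨hi, rfl, ih⟩
  | up _ ih => exact ih.2.2

theorem le_deg (h : Hist deg head ok r v i p D l f) : i ≤ deg v := by
  induction h with
  | start => exact Nat.zero_le _
  | skip _ hi _ _ => exact hi
  | down _ _ _ _ _ => exact Nat.zero_le _
  | up h _ => exact h.isPath.1

theorem nodup (h : Hist deg head ok r v i p D l f) : D.Nodup := by
  induction h with
  | start => simp
  | skip _ _ _ ih => exact ih
  | down _ _ hD _ ih => exact List.nodup_append.2 ⟨ih, by simp, by simp; rintro _ h rfl; exact hD h⟩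
  | up _ ih => exact ih

theorem perm (h : Hist deg head ok r v i p D l f) : D.Perm (f ++ v :: p.map Prod.fst) := by
  induction h with
  | start => exact .refl _
  | skip _ _ _ ih => exact ih
  | @down v i p D l f _ _ hD _ ih =>
    refine (ih.append_right _).trans ?_
    simp only [List.map_cons]
    rw [List.append_assoc]
    refine List.Perm.append_left _ ?_
    exact List.perm_append_comm
  | up _ ih => simpa using ih

theorem mem_iff (h : Hist deg head ok r v i p D l f) {x : ℕ} :
    x ∈ D ↔ x ∈ f ∨ x = v ∨ x ∈ p.map Prod.fst := by
  rw [h.perm.mem_iff]; simp only [List.mem_append, List.mem_cons]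

theorem ok_of_mem (hr : ok r) (h : Hist deg head ok r v i p D l f) {x : ℕ} (hx : x ∈ D) : ok x := by
  induction h with
  | start => simp at hx; exact hx ▸ hr
  | skip _ _ _ ih => exact ih hx
  | down _ _ _ hok ih =>
    rcases List.mem_append.1 hx with hx | hx
    · exact ih hx
    · simp at hx; exact hx ▸ hok
  | up _ ih => exact ih hx

theorem root_mem (h : Hist deg head ok r v i p D l f) : r ∈ D := by
  induction h with
  | start => simp
  | skip _ _ _ ih => exact ih
  | down _ _ _ _ ih => exact List.mem_append_left _ ih
  | up _ ih => exact ih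

theorem eq_root_iff (h : Hist deg head ok r v i p D l f) : v = r ↔ p = [] := by
  induction h with
  | start => simp
  | skip _ _ _ ih => exact ih
  | down h _ hD _ ih =>
    simp only [reduceCtorEq, iff_false]
    rintro he
    exact hD (he ▸ h.root_mem)
  | @up v u j p D l f h ih =>
    constructor
    · rintro rfl
      rcases p with _ | ⟨⟨u', j'⟩, p⟩
      · rfl
      · -- a root further down would occur twice on the path
        exfalso
        have hn : (f ++ v :: ((u, j) :: (u', j') :: p).map Prod.fst).Nodup :=
          h.perm.nodup_iff.1 h.nodup
        have hlast : ∀ (q : List (ℕ × ℕ)) (x : ℕ), IsPath deg head u x q → x ≠ u → 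
            u ∈ q.map Prod.fst := by
          intro q
          induction q with
          | nil => intro x hx hxu; exact absurd hx hxu
          | cons a q ihq =>
            rintro x ⟨-, -, hp⟩ -
            by_cases ha : a.1 = u
            · simp [ha]
            · exact List.mem_cons_of_mem _ (ihq _ hp ha)
        have hp := h.isPath.2.2.2.2
        simp only [List.map_cons, List.nodup_append, List.nodup_cons, List.mem_cons] at hn
        have hu' : u' ≠ u := fun e => hn.2.1.2.1 (.inl e.symm)
        exact hn.2.1.2.1 (.inr (hlast _ _ hp hu'))
    · rintro rfl
      exact h.isPath.2.2

theorem length (h : Hist deg head ok r v i p D l f) :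
    l.length = (f.map deg).sum + i + (p.map Prod.snd).sum := by
  induction h with
  | start => rfl
  | skip _ _ _ ih => simp [ih]; omega
  | down _ _ _ _ ih => simp [ih, add_assoc]
  | up _ ih => simp [ih]; omega

/-- The edges that have been examined lead to discovered or to forbidden vertices. -/
theorem scanned (h : Hist deg head ok r v i p D l f) :
    (∀ x ∈ f, ∀ j < deg x, head x j ∈ D ∨ ¬ ok (head x j)) ∧
    (∀ j < i, head v j ∈ D ∨ ¬ ok (head v j)) ∧
    ∀ e ∈ p, ∀ j < e.2, head e.1 j ∈ D ∨ ¬ ok (head e.1 j) := by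
  induction h with
  | start => simp
  | skip h hi hh ih =>
    refine ⟨ih.1, fun j hj => ?_, ih.2.2⟩
    rcases Nat.lt_succ_iff_lt_or_eq.1 hj with hj | rfl
    · exact ih.2.1 j hj
    · exact hh
  | down h hi hD hok ih =>
    refine ⟨fun x hx j hj => ?_, fun j hj => absurd hj (Nat.not_lt_zero _), fun e he j hj => ?_⟩
    · exact (ih.1 x hx j hj).imp_left (List.mem_append_left _)
    · rcases List.mem_cons.1 he with rfl | he
      · exact (ih.2.1 j hj).imp_left (List.mem_append_left _)
      · exact (ih.2.2 e he j hj).imp_left (List.mem_append_left _)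
  | @up v u j p D l f h ih =>
    refine ⟨fun x hx k hk => ?_, fun k hk => ?_, fun e he => ih.2.2 e (List.mem_cons_of_mem _ he)⟩
    · rcases List.mem_append.1 hx with hx | hx
      · exact ih.1 x hx k hk
      · simp at hx; subst hx; exact ih.2.1 k hk
    · rcases Nat.lt_succ_iff_lt_or_eq.1 hk with hk | rfl
      · exact ih.2.2 _ (List.mem_cons_self ..) k hk
      · left; rw [h.isPath.2.1, h.mem_iff]; simp

/-- The edge relation of the graph that is searched. -/
def Step (deg : ℕ → ℕ) (head : ℕ → ℕ → ℕ) (x y : ℕ) : Prop := ∃ i < deg x, head x i = y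

theorem reach_of_path (h : Hist deg head ok r v i p D l f) {g : ℕ} (hg : g ∈ v :: p.map Prod.fst) :
    Relation.ReflTransGen (Step deg head) g v := by
  have key : ∀ (p : List (ℕ × ℕ)) (v : ℕ), IsPath deg head r v p → g ∈ v :: p.map Prod.fst →
      Relation.ReflTransGen (Step deg head) g v := by
    intro p
    induction p with
    | nil => intro v _ hg; simp at hg; subst hg; exact .refl
    | cons a p ih =>
      intro v hp hg
      obtain ⟨hj, hv, hp⟩ := hp
      rcases List.mem_cons.1 hg with rfl | hg
      · exact .refl
      · exact (ih _ hp hg).tail ⟨_, hj, hv⟩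
  exact key p v h.isPath hg

/-- The discovered vertices are reachable from `r` through vertices with `ok`. -/
theorem reach_root (h : Hist deg head ok r v i p D l f) {x : ℕ} (hx : x ∈ D) :
    Relation.ReflTransGen (fun a b => Step deg head a b ∧ ok b) r x := by
  induction h generalizing x with
  | start => simp at hx; subst hx; exact .refl
  | skip _ _ _ ih => exact ih hx
  | down h hi hD hok ih =>
    rcases List.mem_append.1 hx with hx | hx
    · exact ih hx
    · simp at hx; subst hx
      exact (ih (h.mem_iff.2 (.inr (.inl rfl)))).tail ⟨⟨_, hi, rfl⟩, hok⟩
  | up _ ih => exact ih hx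

/-- At the end of the search, the discovered vertices are those reachable from `r` through vertices
with `ok`. -/
theorem mem_iff_reach (h : Hist deg head ok r r (deg r) [] D l f) {x : ℕ} :
    x ∈ D ↔ Relation.ReflTransGen (fun a b => Step deg head a b ∧ ok b) r x := by
  refine ⟨h.reach_root, fun hx => ?_⟩
  induction hx with
  | refl => exact h.root_mem
  | tail _ hs ih =>
    obtain ⟨⟨j, hj, rfl⟩, hok⟩ := hs
    rcases h.mem_iff.1 ih with hf | rfl | hp
    · exact (h.scanned.1 _ hf j hj).resolve_right (not_not.2 hok)
    · exact (h.scanned.2.1 j hj).resolve_right (not_not.2 hok)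
    · simp at hp

/-- The vertices on the current path have been discovered in the order in which they lie on it. -/
theorem path_sublist (h : Hist deg head ok r v i p D l f) :
    (v :: p.map Prod.fst).reverse.Sublist D := by
  induction h with
  | start => simp
  | skip _ _ _ ih => exact ih
  | down _ _ _ _ ih =>
    simp only [List.map_cons, List.reverse_cons] at ih ⊢
    exact ih.append (List.Sublist.refl _)
  | up _ ih =>
    refine List.Sublist.trans ?_ ih
    simp only [List.map_cons, List.reverse_cons]
    exact List.sublist_append_left _ _

/-- While a vertex `g` is on the path, the vertices discovered after `g` are reachable from `g`, and
no finished vertex that was discovered before `g` has an edge to `g` or to one of them. -/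
theorem after (h : Hist deg head ok r v i p D l f) {g : ℕ} (hg : g ∈ v :: p.map Prod.fst) :
    (∀ z, [g, z].Sublist D → Relation.ReflTransGen (Step deg head) g z) ∧
    ∀ x ∈ f, ∀ j < deg x, (head x j = g ∨ [g, head x j].Sublist D) → [g, x].Sublist D := by
  induction h generalizing g with
  | start =>
    refine ⟨fun z hz => ?_, by simp⟩
    have := hz.length_le; simp at this
  | skip _ _ _ ih => exact ih hg
  | @down v i p D l f h hi hD hok ih =>
    have hmono : ∀ z, [g, z].Sublist D → [g, z].Sublist (D ++ [head v i]) := fun z hz =>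
      hz.trans (List.sublist_append_left _ _)
    have hx : ∀ x ∈ f, ∀ j < deg x, head x j ≠ head v i := by
      intro x hx j hj he
      rcases h.scanned.1 x hx j hj with h1 | h1
      · exact hD (he ▸ h1)
      · exact h1 (he ▸ hok)
    rcases List.mem_cons.1 hg with rfl | hg
    · have hno : ∀ z, ¬ [head v i, z].Sublist (D ++ [head v i]) := by
        intro z hz
        rcases pair_sublist_append hz with h1 | rfl
        · exact hD (h1.subset (by simp))
        · have h2 := (h.down hi hD hok).nodup.sublist hz
          simp at h2
      refine ⟨fun z hz => absurd hz (hno z), fun x hxf j hj hh => ?_⟩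
      rcases hh with hh | hh
      · exact absurd hh (hx x hxf j hj)
      · exact absurd hh (hno _)
    · obtain ⟨h1, h2⟩ := ih hg
      refine ⟨fun z hz => ?_, fun x hxf j hj hh => hmono _ (h2 x hxf j hj ?_)⟩
      · rcases pair_sublist_append hz with hz | rfl
        · exact h1 z hz
        · exact (h.reach_of_path hg).tail ⟨i, hi, rfl⟩
      · refine hh.imp_right fun hh => ?_
        rcases pair_sublist_append hh with hh | hh
        · exact hh
        · exact absurd hh (hx x hxf j hj)
  | @up v u j p D l f h ih =>
    obtain ⟨h1, h2⟩ := ih (List.mem_cons_of_mem _ hg)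
    refine ⟨h1, fun x hx k hk hh => ?_⟩
    rcases List.mem_append.1 hx with hx | hx
    · exact h2 x hx k hk hh
    · simp at hx; subst hx
      refine List.Sublist.trans ?_ h.path_sublist
      rw [List.reverse_cons]
      exact (List.singleton_sublist.2 (List.mem_reverse.2 hg)).append (List.Sublist.refl [x])

end Hist

/-- `v` reaches every vertex from which there is a path to `v` that meets only `v` and vertices
with `A`. -/
def FinProp (deg : ℕ → ℕ) (head : ℕ → ℕ → ℕ) (A : ℕ → Prop) (v : ℕ) : Prop :=
  ∀ u, Relation.ReflTransGen (fun x y => A x ∧ Hist.Step deg head x y) u v →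
    Relation.ReflTransGen (Hist.Step deg head) v u

/-- Every vertex in the list `F` satisfies `FinProp` with respect to the vertices before it. -/
def FinOrder (deg : ℕ → ℕ) (head : ℕ → ℕ → ℕ) (F : List ℕ) : Prop :=
  ∀ f₁ v f₂, F = f₁ ++ v :: f₂ → FinProp deg head (· ∈ f₁) v

theorem FinOrder.append {deg : ℕ → ℕ} {head : ℕ → ℕ → ℕ} {F : List ℕ} {v : ℕ}
    (h : FinOrder deg head F) (hv : FinProp deg head (· ∈ F) v) :
    FinOrder deg head (F ++ [v]) := by
  intro f₁ x f₂ he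
  rcases List.eq_nil_or_concat f₂ with rfl | ⟨f₂, y, rfl⟩
  · obtain ⟨rfl, h2⟩ := List.append_inj' he rfl
    simp at h2; exact h2 ▸ hv
  · have : F ++ [v] = (f₁ ++ x :: f₂) ++ [y] := by simp [he]
    exact h _ _ _ (List.append_inj' this rfl).1

namespace Hist

variable {deg : ℕ → ℕ} {head : ℕ → ℕ → ℕ} {ok : ℕ → Prop} {r v i : ℕ} {p : List (ℕ × ℕ)}
  {D l f F : List ℕ}

/-- A vertex that is finished reaches all vertices finished before it that reach it through such
vertices.  This also holds if vertices `F` without edges to vertices with `ok` were finished before the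
search. -/
theorem finProp (h : Hist deg head ok r v i p D l f) (hr : ok r)
    (hF : ∀ x ∈ F, ∀ j < deg x, ¬ ok (head x j)) : FinProp deg head (· ∈ F ++ f) v := by
  intro u hu
  have hv : v ∈ D := h.mem_iff.2 (.inr (.inl rfl))
  obtain ⟨h1, h2⟩ := h.after (List.mem_cons_self (a := v))
  have key : u = v ∨ [v, u].Sublist D := by
    induction hu using Relation.ReflTransGen.head_induction_on with
    | refl => exact .inl rfl
    | head hs _ ih =>
      obtain ⟨hA, j, hj, rfl⟩ := hs
      right
      rcases List.mem_append.1 hA with hA | hA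
      · refine absurd ?_ (hF _ hA j hj)
        rcases ih with ih | ih
        · rw [ih]; exact h.ok_of_mem hr hv
        · exact h.ok_of_mem hr (ih.subset (by simp))
      · exact h2 _ hA j hj ih
  rcases key with rfl | key
  · exact .refl
  · exact h1 _ key

theorem finOrder (h : Hist deg head ok r v i p D l f) (hr : ok r)
    (hF : ∀ x ∈ F, ∀ j < deg x, ¬ ok (head x j)) (hFo : FinOrder deg head F) :
    FinOrder deg head (F ++ f) := by
  induction h with
  | start => simpa using hFo
  | skip _ _ _ ih => exact ih
  | down _ _ _ _ ih => exact ih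
  | up h ih => rw [← List.append_assoc]; exact ih.append (h.finProp hr hF)

end Hist

/-! ### The depth-first search program -/

/-- Outputs the vertex in variable `3` (if `vs`) and its outgoing edges whose heads have a nonzero
color (if `es`). -/
def emitCmd (vs es : Bool) : Cmd 32 :=
  (if vs then .emitVertex (3 : Fin 32) else .skip) ;;
  (if es then
    .assign 20 (.const 0) ;; .query 21 (.deg false) (3 : Fin 32) (.const 0) ;;
    .loop (.op .lt (20 : Fin 32) (21 : Fin 32))
      (.query 22 (.head false) (3 : Fin 32) (20 : Fin 32) ;;
        colGet 23 22 ;;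
        .ite (23 : Fin 32) (.emitEdge (3 : Fin 32) (22 : Fin 32)) .skip ;;
        .assign 20 (((20 : Fin 32) : Expr 32) + .const 1))
   else .skip)

/-- One step of a depth-first search along the edges in direction `dir` that enters the vertices of
color `a` and gives them color `b`.  The current vertex and the position in its array are in the
variables `3` and `4`, the root is in `5`, and `14` is nonzero until the search ends.  When the search
leaves a vertex, it finds the parent by means of the position, kept on the stack, of the parent in the array
of the vertex for the opposite direction. -/
def dfsBody (dir : Bool) (a b : ℕ) (hookD hookS hookF : Cmd 32) : Cmd 32 :=
  .query 12 (.deg dir) (3 : Fin 32) (.const 0) ;;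
  .ite (.op .lt (4 : Fin 32) (12 : Fin 32))
    (.query 8 (.head dir) (3 : Fin 32) (4 : Fin 32) ;;
      colGet 13 8 ;;
      .ite (.op .eq (13 : Fin 32) (.const a))
        (.query 9 (.mate dir) (3 : Fin 32) (4 : Fin 32) ;;
          .query 12 (.deg !dir) (8 : Fin 32) (.const 0) ;;
          cmdBits ;; cmdPush ;; colPut 8 (.const b) ;;
          .assign 3 (8 : Fin 32) ;; .assign 4 (.const 0) ;; hookD)
        (.assign 4 (((4 : Fin 32) : Expr 32) + .const 1) ;; hookS))
    (hookF ;;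
      .ite (.op .eq (3 : Fin 32) (5 : Fin 32))
        (.assign 14 (.const 0))
        (.query 12 (.deg !dir) (3 : Fin 32) (.const 0) ;;
          cmdBits ;; cmdPop ;;
          .query 8 (.head !dir) (3 : Fin 32) (9 : Fin 32) ;;
          .query 4 (.mate !dir) (3 : Fin 32) (9 : Fin 32) ;;
          .assign 4 (((4 : Fin 32) : Expr 32) + .const 1) ;;
          .assign 3 (8 : Fin 32)))

/-- The depth-first search from the vertex in variable `5`, which already has color `b`, with a log if
`logging` and with the output of the vertices discovered if `emit`. -/
def dfs (vs es dir : Bool) (a b : ℕ) (logging emit : Bool) : Cmd 32 :=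
  .assign 3 (5 : Fin 32) ;; .assign 4 (.const 0) ;; .assign 14 (.const 1) ;;
  (if emit then emitCmd vs es else .skip) ;;
  .loop (14 : Fin 32) (dfsBody dir a b (if emit then emitCmd vs es else .skip)
    (if logging then logPush 0 else .skip) (if logging then logPush 1 else .skip))

section

variable {n : ℕ} {G : Digraph (Fin n)} (R : AdjArrays G)

/-- The output of `emitCmd` for the vertex `x` under the coloring `col`. -/
def emission (vs es : Bool) (col : ℕ → ℕ) (x : ℕ) : List OutSymbol :=
  (if vs then [.vertex x] else []) ++
  if es then ((List.range (R.deg false x)).filter fun i => col (R.head false x i) ≠ 0).map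
    fun i => .edge x (R.head false x i) else []

/-- The number of bits used on the stack for the vertex `v`. -/
def stBits (dir : Bool) (v : ℕ) : ℕ := Nat.clog 2 (R.deg (!dir) v)

/-- The number of bits on the stack for a path of tree edges. -/
def pathBits (dir : Bool) : ℕ → List (ℕ × ℕ) → ℕ
  | _, [] => 0
  | v, (u, _) :: p => pathBits dir u p + stBits R dir v

/-- From position `base` on, the stack represents the path `p` to the vertex `v`. -/
def StkRep (dir : Bool) (st : ℕ → ℕ) (base : ℕ) : ℕ → List (ℕ × ℕ) → Prop
  | _, [] => True
  | v, (u, j) :: p => StkRep dir st base u p ∧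
      field st (base + pathBits R dir u p) (stBits R dir v) = R.mate dir u j

variable {R}

theorem StkRep.congr {dir : Bool} {st st' : ℕ → ℕ} {base : ℕ} : ∀ {p : List (ℕ × ℕ)} {v : ℕ},
    StkRep R dir st base v p →
    (∀ i, base ≤ i → i < base + pathBits R dir v p → st' i = st i) → StkRep R dir st' base v p
  | [], _, _, _ => trivial
  | (u, j) :: p, v, ⟨h1, h2⟩, h => by
    rw [pathBits] at h
    refine ⟨h1.congr fun i hi hi' => h i hi (by omega), ?_⟩
    rw [← h2]
    exact field_congr fun i hi hi' => h i (by omega) (by omega)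

theorem emission_congr {vs es : Bool} {col col' : ℕ → ℕ} {x : ℕ}
    (h : ∀ y, col y = 0 ↔ col' y = 0) : emission R vs es col x = emission R vs es col' x := by
  simp [emission, h]

theorem clog_le_self (d : ℕ) : Nat.clog 2 d ≤ d :=
  (Nat.clog_le_iff_le_pow (by norm_num)).2 (Nat.lt_two_pow_self).le

theorem WP.emitCmd {S w : ℕ} {L : Layout} {s : NState 32}
    {Q : ℕ → List OutSymbol → NState 32 → Prop} {col log st : ℕ → ℕ} (vs es : Bool)
    (hL : L.Valid R S w) (h : Good R S w L s col log st) (hx : s.v 3 < n)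
    (hQ : ∀ q s', Good R S w L s' col log st → q ≤ R.deg false (s.v 3) →
      Same [0, 2, 20, 21, 22, 23] s s' → Q q (emission R vs es col (s.v 3)) s') :
    WP R S w (emitCmd vs es) s Q := by
  have hn := hL.n_lt
  have hw := hL.w_pos
  have hw0 : w ≠ 0 := by omega
  have hdn : R.deg false (s.v 3) ≤ n := AdjArrays.deg_le
  have part2 : WP R S w (if es then
      .assign 20 (.const 0) ;; .query 21 (.deg false) (3 : Fin 32) (.const 0) ;;
      .loop (.op .lt (20 : Fin 32) (21 : Fin 32))
        (.query 22 (.head false) (3 : Fin 32) (20 : Fin 32) ;;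
          _root_.colGet 23 22 ;;
          .ite (23 : Fin 32) (.emitEdge (3 : Fin 32) (22 : Fin 32)) .skip ;;
          .assign 20 (((20 : Fin 32) : Expr 32) + .const 1))
      else .skip) s fun q o s' => Q q ((if vs then [.vertex (s.v 3)] else []) ++ o) s' := by
    cases es with
    | false => 
      exact WP.skip (by simpa [emission] using hQ 0 s h (Nat.zero_le _) fun _ _ => rfl)
    | true =>
      refine WP.seq_assign (by simp) (WP.seq_query (R.deg false (s.v 3)) (by simp) (by simp)
        (by simpa [NState.set_v] using AdjArrays.answer_deg hx) (by omega) ?_)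
      refine WP.loop_inv (fun q o s' => Good R S w L s' col log st ∧ s'.v 20 = q ∧
        q ≤ R.deg false (s.v 3) ∧ s'.v 21 = R.deg false (s.v 3) ∧
        Same [0, 2, 20, 21, 22, 23] s s' ∧
        o = ((List.range q).filter fun i => col (R.head false (s.v 3) i) ≠ 0).map
          fun i => .edge (s.v 3) (R.head false (s.v 3) i))
        (fun s' => R.deg false (s.v 3) - s'.v 20) ?_ ?_ ?_ ?_
      · refine ⟨(h.set (by decide) _).set (by decide) _, by simp [NState.set_v], Nat.zero_le _,
          by simp [NState.set_v], fun y hy => ?_, by simp⟩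
        simp at hy; simp [NState.set_v, hy]
      · simp
      · rintro q o s' ⟨g, h20, hq, h21, hs, ho⟩ hb
        have hlt : q < R.deg false (s.v 3) := by
          by_contra hc; simp [h20, h21, hc] at hb
        have h3 := hs 3 (by decide)
        have hhn : R.head false (s.v 3) q < n := AdjArrays.head_lt hlt
        refine WP.seq_query (R.head false (s.v 3) q) (by simp) (by simp)
          (by simpa [h3, h20] using AdjArrays.answer_head hlt) (by omega) ?_
        refine WP.seq0 (WP.colGet hL (g.set (by decide) _) (by decide) (by decide) (by decide)
          (by decide) (by simpa using AdjArrays.touched_head hlt) fun s2 g2 h23 f2 => ⟨rfl, rfl, ?_⟩)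
        have e20 : s2.v 20 = q := by rw [f2 20 (by decide)]; simp [NState.set_v, h20]
        have e21 : s2.v 21 = R.deg false (s.v 3) := by
          rw [f2 21 (by decide)]; simp [NState.set_v, h21]
        have e22 : s2.v 22 = R.head false (s.v 3) q := by
          rw [f2 22 (by decide)]; simp
        have e3 : s2.v 3 = s.v 3 := by rw [f2 3 (by decide)]; simp [NState.set_v, h3]
        simp only [NState.set_v_self] at h23
        have hfin : ∀ o', o' = (if col (R.head false (s.v 3) q) ≠ 0 then
            [OutSymbol.edge (s.v 3) (R.head false (s.v 3) q)] else []) →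
            WP R S w (.assign 20 (((20 : Fin 32) : Expr 32) + .const 1)) s2 fun q' o2 s'' =>
            (Good R S w L s'' col log st ∧ s''.v 20 = q + 1 + (0 + q') ∧
            q + 1 + (0 + q') ≤ R.deg false (s.v 3) ∧ s''.v 21 = R.deg false (s.v 3) ∧
            Same [0, 2, 20, 21, 22, 23] s s'' ∧
            o ++ (o' ++ o2) = ((List.range (q + 1 + (0 + q'))).filter fun i =>
              col (R.head false (s.v 3) i) ≠ 0).map fun i => .edge (s.v 3) (R.head false (s.v 3) i))
            ∧ R.deg false (s.v 3) - s''.v 20 < R.deg false (s.v 3) - s'.v 20 := by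
          rintro o' rfl
          refine WP.assign (by simp [e20]; omega) ⟨⟨g2.set (by decide) _, by simp [e20], hlt,
            by simpa [NState.set_v] using e21, fun y hy => ?_, ?_⟩, ?_⟩
          · have hsy := hs y hy
            simp at hy; simp [NState.set_v, hy, f2, hsy]
          · rw [ho, show q + 1 + (0 + 0) = q + 1 from rfl, List.range_succ, List.filter_append,
              List.map_append]
            by_cases hc : col (R.head false (s.v 3) q) = 0 <;> simp [hc]
          · simp [e20, h20]; omega
        refine WP.seq (WP.ite (by simp) (fun hb => WP.emitEdge (by simp) (by simp) ?_)
          fun hb => WP.skip ?_)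
        · rw [Expr.val_var, h23] at hb
          simpa only [Expr.val_var, e3, e22] using hfin _ (by simp [hb])
        · rw [Expr.val_var, h23] at hb
          simpa only using hfin _ (by simp [hb])
      · rintro q o s' ⟨g, h20, hq, h21, hs, ho⟩ hb
        have hge : ¬ q < R.deg false (s.v 3) := by
          intro hc; simp [h20, h21, hc] at hb
        obtain rfl : q = R.deg false (s.v 3) := by omega
        rw [ho]
        simpa [emission] using hQ _ s' g le_rfl hs
  refine WP.seq ?_
  cases vs with
  | false => exact WP.skip (part2.conseq fun q o s' hq => by simpa using hq)
  | true => exact WP.emitVertex (by simp) (part2.conseq fun q o s' hq => by simpa using hq)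

end

section

variable {n : ℕ} {G : Digraph (Fin n)}

/-- The coloring that gives the vertices in `D` the color `b` and agrees with `col` elsewhere. -/
def recolor (b : ℕ) (col : ℕ → ℕ) (D : List ℕ) : ℕ → ℕ := fun x => if x ∈ D then b else col x

/-- The log after a search that appends `l` if it keeps a log. -/
def addLog (logging : Bool) (l₀ l : List ℕ) : List ℕ := l₀ ++ if logging then l else []

/-- The variables that a depth-first search may change. -/
def dfsVars : List (Fin 32) := [0, 1, 2, 3, 4, 6, 7, 8, 9, 10, 11, 12, 13, 14, 20, 21, 22, 23]

/-- The parameters of a depth-first search and the initial contents of its data structures. -/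
structure DfsPar where
  vs : Bool
  es : Bool
  dir : Bool
  a : ℕ
  b : ℕ
  logging : Bool
  emit : Bool
  r : ℕ
  base : ℕ
  col : ℕ → ℕ
  st : ℕ → ℕ
  l : List ℕ

/-- The histories of the search with the given parameters. -/
abbrev DfsPar.H (P : DfsPar) (R : AdjArrays G) :=
  Hist (R.deg P.dir) (R.head P.dir) (fun x => P.col x = P.a) P.r

/-- What the search outputs if it discovers the vertices in `E`. -/
def DfsPar.out (P : DfsPar) (R : AdjArrays G) (E : List ℕ) : List OutSymbol :=
  if P.emit then (E.map (emission R P.vs P.es P.col)).flatten else []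

/-- The assumptions on the parameters. -/
structure DfsPar.Valid (P : DfsPar) (R : AdjArrays G) (S w : ℕ) (L : Layout) : Prop where
  hL : L.Valid R S w
  hab : P.a ≠ P.b
  ha : P.a < 3
  hb : P.b < 3
  hr : P.col P.r = P.a
  hrt : R.touched P.r
  hem : P.emit = true → P.a ≠ 0 ∧ P.b ≠ 0
  capS : ∀ {v i p D l f}, P.H R v i p D l f → P.base + pathBits R P.dir v p ≤ L.cst
  capL : P.logging = true → ∀ {v i p D l f}, P.H R v i p D l f → P.l.length + l.length + 1 ≤ L.clog

/-- The state `s` represents the search at edge number `i` of the vertex `v` at the end of the path `p`,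
with discovered vertices `D` and log `l`, in a search started in `s₀`. -/
structure DfsPar.Inv (P : DfsPar) (R : AdjArrays G) (S w : ℕ) (L : Layout) (s₀ : NState 32)
    (v i : ℕ) (p : List (ℕ × ℕ)) (D l : List ℕ) (s : NState 32) : Prop where
  good : ∃ log st, Good R S w L s (recolor P.b P.col D) log st ∧ StkRep R P.dir st P.base v p ∧
    (∀ x < P.base, st x = P.st x) ∧ LogRep log (addLog P.logging P.l l)
  v3 : s.v 3 = v
  v4 : s.v 4 = i
  v5 : s.v 5 = P.r
  v6 : s.v 6 = P.base + pathBits R P.dir v p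
  v7 : s.v 7 = (addLog P.logging P.l l).length
  same : Same dfsVars s₀ s

/-- The number of executions of loop bodies that account for the progress of a search. -/
def DfsPar.spent (P : DfsPar) (R : AdjArrays G) (D l f : List ℕ) : ℕ :=
  l.length + (D.map fun x => 1 + 2 * stBits R P.dir x + R.deg false x).sum +
    (f.map fun x => 2 * stBits R P.dir x).sum

theorem recolor_append {b : ℕ} {col : ℕ → ℕ} {D : List ℕ} {y : ℕ} :
    Function.update (recolor b col D) y b = recolor b col (D ++ [y]) := by
  funext x
  by_cases h : x = y
  · subst h; simp [recolor]
  · simp [recolor, h]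

theorem DfsPar.touched_of_mem {P : DfsPar} {R : AdjArrays G} (hrt : R.touched P.r)
    {v i : ℕ} {p : List (ℕ × ℕ)} {D l f : List ℕ} (h : P.H R v i p D l f) {x : ℕ}
    (hx : x ∈ D) : R.touched x := by
  induction h with
  | start => simp at hx; exact hx ▸ hrt
  | skip _ _ _ ih => exact ih hx
  | down _ hi _ _ ih =>
    rcases List.mem_append.1 hx with hx | hx
    · exact ih hx
    · simp at hx; exact hx ▸ AdjArrays.touched_head hi
  | up _ ih => exact ih hx

theorem WP.hookLog {R : AdjArrays G} {S w : ℕ} {L : Layout} {s : NState 32}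
    {Q : ℕ → List OutSymbol → NState 32 → Prop} {col log st : ℕ → ℕ} (logging : Bool)
    {l₀ l : List ℕ} {b : ℕ} (hL : L.Valid R S w) (h : Good R S w L s col log st) (hb : b < 2)
    (hl : LogRep log (addLog logging l₀ l)) (h7 : s.v 7 = (addLog logging l₀ l).length)
    (hcap : logging = true → l₀.length + l.length + 1 ≤ L.clog)
    (hQ : ∀ s' log', Good R S w L s' col log' st → LogRep log' (addLog logging l₀ (l ++ [b])) →
      s'.v 7 = (addLog logging l₀ (l ++ [b])).length → Same [0, 1, 7] s s' → Q 0 [] s') :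
    WP R S w (if logging then _root_.logPush b else .skip) s Q := by
  cases logging with
  | false => exact WP.skip (hQ s log h hl h7 fun _ _ => rfl)
  | true =>
    have hcap := hcap rfl
    simp only [addLog, if_true] at *
    refine WP.logPush hL h hb hl h7 (by simp; omega) fun s' log' g1 g2 g3 g4 => ?_
    rw [List.append_assoc] at g2 g3
    exact hQ s' log' g1 g2 g3 g4

theorem DfsPar.spent_skip {P : DfsPar} {R : AdjArrays G} {D l f : List ℕ} {x : ℕ} :
    P.spent R D (l ++ [x]) f = P.spent R D l f + 1 := by
  simp [spent]; omega

variable {R : AdjArrays G} {S w : ℕ} {L : Layout} {P : DfsPar} {s₀ s : NState 32}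
  {v i : ℕ} {p : List (ℕ × ℕ)} {D l f : List ℕ}

/-- The postcondition of `dfsBody`: either the search has made a step, or it has ended. -/
def DfsPar.BodyPost (P : DfsPar) (R : AdjArrays G) (S w : ℕ) (L : Layout) (s₀ : NState 32)
    (v i : ℕ) (p : List (ℕ × ℕ)) (D l f : List ℕ) (q : ℕ) (o : List OutSymbol) (s' : NState 32) :
    Prop :=
  (s'.v 14 = 1 ∧ ∃ v' i' p' D' l' f' E, P.H R v' i' p' D' l' f' ∧
    P.Inv R S w L s₀ v' i' p' D' l' s' ∧ l.length + D.length < l'.length + D'.length ∧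
    D' = D ++ E ∧ o = P.out R E ∧ q + 1 + P.spent R D l f ≤ P.spent R D' l' f') ∨
  (s'.v 14 = 0 ∧ q = 0 ∧ o = [] ∧ v = P.r ∧ i = R.deg P.dir v ∧ p = [] ∧
    P.Inv R S w L s₀ v i p D (l ++ [1]) s')

theorem DfsPar.Inv.set_same {s' : NState 32} {l' : List (Fin 32)} (h : Same dfsVars s₀ s)
    (h' : Same l' s s') (hl : ∀ x ∈ l', x ∈ dfsVars) : Same dfsVars s₀ s' := by
  intro y hy
  rw [h' y fun hc => hy (hl y hc), h y hy]

theorem WP.dfsBody (hP : P.Valid R S w L) (hH : P.H R v i p D l f)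
    (hI : P.Inv R S w L s₀ v i p D l s) (h14 : s.v 14 = 1) :
    WP R S w (_root_.dfsBody P.dir P.a P.b (if P.emit then _root_.emitCmd P.vs P.es else .skip)
      (if P.logging then _root_.logPush 0 else .skip)
      (if P.logging then _root_.logPush 1 else .skip)) s
      (P.BodyPost R S w L s₀ v i p D l f) := by
  obtain ⟨hL, hab, ha, hb, hr, hrt, hem, capS, capL⟩ := hP
  obtain ⟨⟨log, st, g, hst, hst0, hlog⟩, h3, h4, h5, h6, h7, hsame⟩ := hI
  have hn := hL.n_lt
  have hw := hL.w_pos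
  have hw0 : w ≠ 0 := by omega
  have hvD : v ∈ D := hH.mem_iff.2 (.inr (.inl rfl))
  have hvt : R.touched v := DfsPar.touched_of_mem hrt hH hvD
  have hvn := hvt.lt
  have hdeg : ∀ d x, R.deg d x ≤ n := fun d x => AdjArrays.deg_le
  have hdv := hdeg P.dir v
  have hid := hH.le_deg
  refine seq_query (R.deg P.dir v) (by simp) (by simp)
    (by simpa [h3] using AdjArrays.answer_deg hvn) (by omega) (ite (by simp) (fun hb0 => ?_) fun hb0 => ?_)
  · -- there is a next edge
    have hi : i < R.deg P.dir v := by
      by_contra hc; simp [NState.set_v, h4, hc] at hb0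
    have hyt : R.touched (R.head P.dir v i) := AdjArrays.touched_head hi
    have hyn := hyt.lt
    refine seq_query (R.head P.dir v i) (by simp) (by simp)
      (by simpa [NState.set_v, h3, h4] using AdjArrays.answer_head hi) (by omega) ?_
    refine seq0 (colGet hL ((g.set (by decide) _).set (by decide) _) (by decide) (by decide)
      (by decide) (by decide) (by simpa using hyt) fun s1 g1 h13 f1 => ⟨rfl, rfl, ?_⟩)
    have f1' : Same [0, 2, 13, 12, 8] s s1 := fun y hy => by
      simp at hy; rw [f1 y (by simp [hy])]; simp [NState.set_v, hy]
    have k8 : s1.v 8 = R.head P.dir v i := by rw [f1 8 (by decide)]; simp [NState.set_v]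
    simp only [NState.set_v_self] at h13
    clear f1
    generalize hy : R.head P.dir v i = y at *
    refine ite (by simp; omega) (fun hb1 => ?_) fun hb1 => ?_
    · -- the edge leads to a new vertex
      have hcy : recolor P.b P.col D y = P.a := by
        by_contra hc; simp [h13, hc] at hb1
      have hyD : y ∉ D := fun hc => by simp [recolor, hc] at hcy; exact hab hcy.symm
      have hok : P.col y = P.a := by simpa [recolor, hyD] using hcy
      have hH' : P.H R y 0 ((v, i) :: p) (D ++ [y]) l f := by
        subst hy; exact hH.down hi hyD hok
      have hcapS := capS hH'
      simp only [pathBits] at hcapS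
      have hm : R.mate P.dir v i < R.deg (!P.dir) y := hy ▸ AdjArrays.mate_lt hi
      have hdy := hdeg (!P.dir) y
      refine seq_query (R.mate P.dir v i) (by simp) (by simp)
        (by simpa [f1' 3 (by decide), f1' 4 (by decide), h3, h4] using AdjArrays.answer_mate hi)
        (by omega) ?_
      refine seq_query (R.deg (!P.dir) y) (by simp) (by simp)
        (by simpa [NState.set_v, k8] using AdjArrays.answer_deg hyn) (by omega) ?_
      refine seq (cmdBits (d := R.deg (!P.dir) y) (by simp) (by omega) fun s2 m2 h10 f2 => ?_)
      have g2 : Good R S w L s2 (recolor P.b P.col D) log st :=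
        (((g1.set (by decide) _).set (by decide) _).of_same m2 fun x hx => f2 x (by
          simp; constructor <;> rintro rfl <;> exact absurd hx (by decide)) :)
      have f2' : Same [0, 2, 13, 12, 8, 9, 10, 11] s s2 := fun y hy => by
        simp at hy; rw [f2 y (by simp [hy])]; simp [NState.set_v, hy, f1']
      have k8' : s2.v 8 = y := by rw [f2 8 (by decide)]; simp [NState.set_v, k8]
      have k9' : s2.v 9 = R.mate P.dir v i := by rw [f2 9 (by decide)]; simp [NState.set_v]
      clear f2
      have e6 : s2.v 6 = P.base + pathBits R P.dir v p := by rw [f2' 6 (by decide), h6]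
      refine seq (cmdPush hL g2 h10 (by rw [e6]; simpa [stBits, add_assoc] using hcapS)
        fun s3 st3 g3 h6' hst3 hfl f3 => ?_)
      refine seq0 (colPut hL g3 (x := 8) (ev := P.b) (by decide) (by decide)
        (by rw [f3 8 (by decide), k8']; exact hyt) hb fun s4 g4 f4 => ⟨rfl, rfl, ?_⟩)
      have e8 : s4.v 8 = y := by rw [f4 8 (by decide), f3 8 (by decide), k8']
      rw [f3 8 (by decide), k8', recolor_append] at g4
      refine seq_assign (by simp) (seq_assign (by simp) ?_)
      have f4' : Same dfsVars s₀ s4 := by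
        refine DfsPar.Inv.set_same hsame (l' := [0, 1, 2, 13, 12, 8, 9, 10, 11, 6]) (fun z hz => ?_)
          (by decide)
        simp at hz
        rw [f4 z (by simp [hz]), f3 z (by simp [hz]), f2' z (by simp [hz])]
      have e5 : s4.v 5 = P.r := by
        rw [f4 5 (by decide), f3 5 (by decide), f2' 5 (by decide), h5]
      have e7 : s4.v 7 = (addLog P.logging P.l l).length := by
        rw [f4 7 (by decide), f3 7 (by decide), f2' 7 (by decide), h7]
      have e14 : s4.v 14 = 1 := by
        rw [f4 14 (by decide), f3 14 (by decide), f2' 14 (by decide), h14]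
      have e6' : s4.v 6 = P.base + pathBits R P.dir y ((v, i) :: p) := by
        rw [f4 6 (by decide), h6', e6, pathBits, stBits]; omega
      have hstk : StkRep R P.dir st3 P.base y ((v, i) :: p) := by
        refine ⟨hst.congr fun x hx hx' => hst3 x (by omega), ?_⟩
        rw [← e6, stBits, hfl, k9']
        refine Nat.mod_eq_of_lt (hm.trans_le ?_)
        exact (Nat.clog_le_iff_le_pow (by norm_num)).1 le_rfl
      simp only [Expr.val_var, e8, Expr.val_const]
      have hsp : ∀ q, q ≤ R.deg false y →
          Nat.clog 2 (R.deg (!P.dir) y) + (Nat.clog 2 (R.deg (!P.dir) y) + q) + 1 +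
            P.spent R D l f ≤ P.spent R (D ++ [y]) l f := by
        intro q hq
        simp [DfsPar.spent, stBits]; omega
      have hinv : ∀ s5, Good R S w L s5 (recolor P.b P.col (D ++ [y])) log st3 →
          Same [0, 2, 20, 21, 22, 23] ((s4.set 3 y).set 4 0) s5 →
          P.Inv R S w L s₀ y 0 ((v, i) :: p) (D ++ [y]) l s5 := by
        intro s5 g5 f5
        refine ⟨⟨log, st3, g5, hstk, fun x hx => ?_, hlog⟩, ?_, ?_, ?_, ?_, ?_, ?_⟩
        · rw [hst3 x (by omega), hst0 x hx]
        · rw [f5 3 (by decide)]; simp [NState.set_v]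
        · rw [f5 4 (by decide)]; simp [NState.set_v]
        · rw [f5 5 (by decide)]; simp [NState.set_v, e5]
        · rw [f5 6 (by decide)]; simpa [NState.set_v] using e6'
        · rw [f5 7 (by decide)]; simpa [NState.set_v] using e7
        · refine DfsPar.Inv.set_same f4' (l' := [3, 4, 0, 2, 20, 21, 22, 23]) (fun z hz => ?_)
            (by decide)
          simp at hz
          rw [f5 z (by simp [hz])]; simp [NState.set_v, hz]
      have g4' := (g4.set (x := 3) (by decide) y).set (x := 4) (by decide) 0
      cases hemit : P.emit with
      | false =>
        refine skip ?_
        refine .inl ⟨by simpa [NState.set_v] using e14, y, 0, (v, i) :: p, D ++ [y], l, f, [y], hH',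
          hinv _ g4' fun _ _ => rfl, by simp, rfl, by simp [DfsPar.out, hemit], hsp 0 (Nat.zero_le _)⟩
      | true =>
        refine emitCmd P.vs P.es hL g4' (by simpa [NState.set_v] using hyn) fun q s5 g5 hq f5 => ?_
        have e3 : ((s4.set 3 y).set 4 0).v 3 = y := by simp [NState.set_v]
        rw [e3] at hq ⊢
        refine .inl ⟨?_, y, 0, (v, i) :: p, D ++ [y], l, f, [y], hH',
          hinv _ g5 f5, by simp, rfl, ?_, hsp q hq⟩
        · rw [f5 14 (by decide)]; simpa [NState.set_v] using e14
        · simp only [DfsPar.out, hemit, if_true, List.map_cons, List.map_nil, List.flatten_cons,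
            List.flatten_nil, List.append_nil, List.nil_append]
          refine emission_congr fun x => ?_
          by_cases hx : x ∈ D ++ [y]
          · have : P.col x = P.a := Hist.ok_of_mem (ok := fun x => P.col x = P.a) hr hH' hx
            have := hem hemit
            simp only [recolor, hx, if_true]; omega
          · simp [recolor, hx]
    · -- the edge is not followed
      have hcy : recolor P.b P.col D y ≠ P.a := by
        intro hc; simp [h13, hc] at hb1
      have hskip : y ∈ D ∨ ¬ P.col y = P.a := by
        by_cases hyD : y ∈ D
        · exact .inl hyD
        · right; simpa [recolor, hyD] using hcy
      have hH' : P.H R v (i + 1) p D (l ++ [0]) f := by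
        subst hy; exact hH.skip hi hskip
      have e4 : s1.v 4 = i := by rw [f1' 4 (by decide), h4]
      have e7 : s1.v 7 = (addLog P.logging P.l l).length := by rw [f1' 7 (by decide), h7]
      refine seq_assign (by simp [e4]; omega) ?_
      refine hookLog P.logging hL (g1.set (by decide) _) (by norm_num) hlog
        (by simpa [NState.set_v] using e7)
        (fun h => capL h hH) fun s2 log2 g2 hl2 h72 f2 => ?_
      refine .inl ⟨?_, v, i + 1, p, D, l ++ [0], f, [], hH', ⟨⟨log2, st, g2, hst, hst0, hl2⟩,
        ?_, ?_, ?_, ?_, h72, ?_⟩, by simp, by simp, by simp [DfsPar.out],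
        by rw [DfsPar.spent_skip]; omega⟩
      · rw [f2 14 (by decide)]; simp [NState.set_v, f1', h14]
      · rw [f2 3 (by decide)]; simp [NState.set_v, f1', h3]
      · rw [f2 4 (by decide)]; simp [e4]
      · rw [f2 5 (by decide)]; simp [NState.set_v, f1', h5]
      · rw [f2 6 (by decide)]; simp [NState.set_v, f1', h6]
      · refine DfsPar.Inv.set_same hsame (l' := [0, 1, 7, 4, 2, 13, 12, 8]) (fun z hz => ?_)
          (by decide)
        simp at hz
        rw [f2 z (by simp [hz])]; simp [NState.set_v, hz, f1']
  · -- all edges have been examined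
    have hi : i = R.deg P.dir v := by
      by_contra hc; simp [NState.set_v, h4] at hb0; omega
    refine seq0 (hookLog P.logging hL (g.set (by decide) _) (by norm_num) hlog
      (by simpa [NState.set_v] using h7) (fun h => capL h hH)
      fun s1 log1 g1 hl1 h71 f1 => ⟨rfl, rfl, ?_⟩)
    have f1' : Same [0, 1, 7, 12] s s1 := fun y hy => by
      simp at hy; rw [f1 y (by simp [hy])]; simp [NState.set_v, hy]
    clear f1
    have e3 : s1.v 3 = v := by rw [f1' 3 (by decide), h3]
    have e5 : s1.v 5 = P.r := by rw [f1' 5 (by decide), h5]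
    have e6 : s1.v 6 = P.base + pathBits R P.dir v p := by rw [f1' 6 (by decide), h6]
    refine ite (by simp) (fun hb1 => ?_) fun hb1 => ?_
    · have hvr : v = P.r := by
        by_contra hc; simp [e3, e5, hc] at hb1
      have hp : p = [] := hH.eq_root_iff.1 hvr
      refine assign (by simp) (.inr ⟨by simp, rfl, rfl, hvr, hi, hp,
        ⟨log1, st, g1.set (by decide) _, hst, hst0, hl1⟩, ?_, ?_, ?_, ?_, ?_, ?_⟩)
      · simpa [NState.set_v] using e3
      · simp [NState.set_v, f1', h4]
      · simpa [NState.set_v] using e5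
      · simpa [NState.set_v] using e6
      · simpa [NState.set_v] using h71
      · refine DfsPar.Inv.set_same hsame (l' := [0, 1, 7, 12, 14]) (fun z hz => ?_) (by decide)
        simp at hz; simp [NState.set_v, hz, f1']
    · have hvr : v ≠ P.r := by
        intro hc; simp [e3, e5, hc] at hb1
      rcases p with _ | ⟨⟨u, j⟩, p⟩
      · exact absurd (hH.eq_root_iff.2 rfl) hvr
      subst hi
      have hH' := hH.up
      have hcapS := capS hH
      obtain ⟨hj, hhead, hpath⟩ := hH.isPath
      have hm : R.mate P.dir u j < R.deg (!P.dir) v := hhead ▸ AdjArrays.mate_lt hj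
      have hcv := hdeg (!P.dir) v
      have hun : u < n := AdjArrays.lt_of_lt_deg hj
      have hdu := hdeg P.dir u
      refine seq_query (R.deg (!P.dir) v) (by simp) (by simp)
        (by simpa [e3] using AdjArrays.answer_deg hvn) (by omega) ?_
      refine seq (cmdBits (d := R.deg (!P.dir) v) (by simp) (by omega) fun s2 m2 h10 f2 => ?_)
      have g2 : Good R S w L s2 (recolor P.b P.col D) log1 st :=
        ((g1.set (by decide) _).of_same m2 fun x hx => f2 x (by
          simp; constructor <;> rintro rfl <;> exact absurd hx (by decide)) :)
      have f2' : Same [0, 1, 7, 12, 10, 11] s s2 := fun y hy => by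
        simp at hy; rw [f2 y (by simp [hy])]; simp [NState.set_v, hy, f1']
      have e7 : s2.v 7 = (addLog P.logging P.l (l ++ [1])).length := by
        rw [f2 7 (by decide)]; simpa [NState.set_v] using h71
      clear f2
      have hn1 : n ≤ 2 ^ (w - 1) := by
        have : 2 ^ w = 2 * 2 ^ (w - 1) := by rw [← pow_succ']; congr 1; omega
        omega
      have hclw : Nat.clog 2 (R.deg (!P.dir) v) < w := by
        refine lt_of_le_of_lt (Nat.clog_mono_right 2 (hcv.trans hn1)) ?_
        rw [Nat.clog_pow _ _ (by norm_num)]; omega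
      simp only [pathBits] at hcapS
      refine seq (cmdPop hL (p := P.base + pathBits R P.dir u p) g2 h10 hclw
        (by rw [f2' 6 (by decide), h6]; simp [pathBits, stBits, add_assoc])
        (by simpa [stBits, add_assoc] using hcapS) fun s3 g3 h63 h93 f3 => ?_)
      have h93' : s3.v 9 = R.mate P.dir u j := by rw [h93]; exact hst.2
      have e3' : s3.v 3 = v := by rw [f3 3 (by decide), f2' 3 (by decide), h3]
      have q1 := AdjArrays.head_mate hj
      have q2 := AdjArrays.mate_mate hj
      rw [hhead] at q1 q2
      refine seq_query u (by simp) (by simp)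
        (by simpa [e3', h93', q1] using AdjArrays.answer_head hm) (by omega) ?_
      refine seq_query j (by simp) (by simp)
        (by simpa [NState.set_v, e3', h93', q2] using AdjArrays.answer_mate hm) (by omega) ?_
      refine seq_assign (by simp; omega) (assign (by simp) ?_)
      refine .inl ⟨?_, u, j + 1, p, D, l ++ [1], f ++ [v], [], hH', ⟨⟨log1, st, ?_, hst.1, hst0,
        hl1⟩, ?_, ?_, ?_, ?_, ?_, ?_⟩, by simp, by simp, by simp [DfsPar.out], ?_⟩
      · simp [NState.set_v, f3, f2', h14]
      · exact (((g3.set (by decide) _).set (by decide) _).set (by decide) _).set (by decide) _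
      · simp [NState.set_v]
      · simp [NState.set_v]
      · simp [NState.set_v, f3, f2', h5]
      · simpa [NState.set_v] using h63
      · rw [← e7]; simp [NState.set_v, f3]
      · refine DfsPar.Inv.set_same hsame (l' := [0, 1, 7, 12, 10, 11, 6, 8, 9, 4, 3])
          (fun z hz => ?_) (by decide)
        simp at hz
        simp [NState.set_v, hz, f3, f2']
      · simp [DfsPar.spent, stBits]; omega

end

section

variable {n : ℕ} {G : Digraph (Fin n)}

theorem sum_map_le_sum_range {D : List ℕ} (hD : D.Nodup) (h : ∀ x ∈ D, x < n) (g : ℕ → ℕ) :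
    (D.map g).sum ≤ ∑ x ∈ Finset.range n, g x := by
  rw [← List.sum_toFinset g hD]
  exact Finset.sum_le_sum_of_subset fun x hx => by simpa using h x (by simpa using hx)

theorem sum_map_le_sum_filter {D : List ℕ} {p : ℕ → Prop} [DecidablePred p] (hD : D.Nodup)
    (h : ∀ x ∈ D, x < n ∧ p x) (g : ℕ → ℕ) :
    (D.map g).sum ≤ ∑ x ∈ (Finset.range n).filter p, g x := by
  rw [← List.sum_toFinset g hD]
  exact Finset.sum_le_sum_of_subset fun x hx => by simpa using h x (by simpa using hx)

theorem Hist.length_le {deg : ℕ → ℕ} {head : ℕ → ℕ → ℕ} {ok : ℕ → Prop} {r v i : ℕ}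
    {p : List (ℕ × ℕ)} {D l f : List ℕ} (h : Hist deg head ok r v i p D l f) :
    l.length ≤ (D.map deg).sum := by
  have hp : ∀ (p : List (ℕ × ℕ)) v, IsPath deg head r v p →
      (p.map Prod.snd).sum ≤ ((p.map Prod.fst).map deg).sum := by
    intro p
    induction p with
    | nil => simp
    | cons a p ih =>
      rintro v ⟨h1, -, h2⟩
      simp only [List.map_cons, List.sum_cons]
      exact Nat.add_le_add h1.le (ih _ h2)
  rw [(h.perm.map deg).sum_eq, h.length]
  have := hp _ _ h.isPath
  have := h.le_deg
  simp only [List.map_append, List.map_cons, List.sum_append, List.sum_cons]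
  omega

namespace AdjArrays

variable (R : AdjArrays G)

/-- An upper bound on the work spent by a search on the vertex `x`. -/
def cost (x : ℕ) : ℕ := 1 + 5 * R.deg false x + 5 * R.deg true x

/-- The number of bits that the vertices on a path can need on the stack, for the direction `dir` of
the edges from which the parents are found. -/
noncomputable def stTot (dir : Bool) : ℕ :=
  open Classical in ∑ x ∈ (Finset.range n).filter R.core, Nat.clog 2 (R.deg dir x)

variable {R}

theorem sum_cost : ∑ x ∈ Finset.range n, R.cost x = n + 10 * edgeCount G := by
  simp only [cost, Finset.sum_add_distrib, ← Finset.mul_sum, sum_deg]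
  simp; ring

theorem core_of_hist {dir : Bool} {ok : ℕ → Prop} {r : ℕ} (hr : R.core r)
    (hok : ∀ x, 0 < R.deg (!dir) x → ok x → R.core x)
    {v i : ℕ} {p : List (ℕ × ℕ)} {D l f : List ℕ}
    (h : Hist (R.deg dir) (R.head dir) ok r v i p D l f) {x : ℕ} (hx : x ∈ D) : R.core x := by
  induction h with
  | start => simp at hx; exact hx ▸ hr
  | skip _ _ _ ih => exact ih hx
  | down _ hi _ hk ih =>
    rcases List.mem_append.1 hx with hx | hx
    · exact ih hx
    · simp at hx; exact hx ▸ hok _ (adj_head hi).pos_codeg hk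
  | up _ ih => exact ih hx

/-- The vertices on the path of a search among core vertices are distinct, so that they need at most
`stTot` bits on the stack. -/
theorem pathBits_le {dir : Bool} {ok : ℕ → Prop} {r : ℕ} (hr : R.core r)
    (hok : ∀ x, 0 < R.deg (!dir) x → ok x → R.core x)
    {v i : ℕ} {p : List (ℕ × ℕ)} {D l f : List ℕ}
    (h : Hist (R.deg dir) (R.head dir) ok r v i p D l f) :
    pathBits R dir v p ≤ R.stTot !dir := by
  classical
  have key : ∀ (p : List (ℕ × ℕ)) v, pathBits R dir v p ≤
      ((v :: p.map Prod.fst).map fun x => Nat.clog 2 (R.deg (!dir) x)).sum := by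
    intro p
    induction p with
    | nil => intro v; exact Nat.zero_le _
    | cons a p ih =>
      intro v
      have := ih a.1
      simp only [pathBits, stBits, List.map_cons, List.sum_cons] at this ⊢
      omega
  refine (key p v).trans ?_
  have hn : (v :: p.map Prod.fst).Nodup := (List.nodup_append.1 (h.perm.nodup_iff.1 h.nodup)).2.1
  rw [stTot]
  refine sum_map_le_sum_filter hn (fun x hx => ?_) _
  have := core_of_hist hr hok h (x := x) (h.mem_iff.2 (.inr (by simpa using hx)))
  exact ⟨this.lt, this⟩

end AdjArrays

/-- The number of executions of loop bodies that account for the moves of a search. -/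
theorem DfsPar.spent_le {P : DfsPar} {R : AdjArrays G} {v i : ℕ} {p : List (ℕ × ℕ)}
    {D l f : List ℕ} (h : P.H R v i p D l f) : P.spent R D l f ≤ (D.map R.cost).sum := by
  have h1 := h.length_le
  have h2 : (f.map fun x => 2 * stBits R P.dir x).sum ≤
      (D.map fun x => 2 * stBits R P.dir x).sum := by
    rw [(h.perm.map _).sum_eq]; simp
  have h3 : ∀ D : List ℕ, (D.map (R.deg P.dir)).sum +
      (D.map fun x => 1 + 2 * stBits R P.dir x + R.deg false x).sum +
      (D.map fun x => 2 * stBits R P.dir x).sum ≤ (D.map R.cost).sum := by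
    intro D
    induction D with
    | nil => simp
    | cons x D ih =>
      have hx : stBits R P.dir x ≤ R.deg (!P.dir) x := clog_le_self _
      have : R.deg P.dir x + (1 + 2 * stBits R P.dir x + R.deg false x) + 2 * stBits R P.dir x ≤
          R.cost x := by
        rw [AdjArrays.cost]
        cases hd : P.dir <;> simp only [hd, Bool.not_false, Bool.not_true] at hx ⊢ <;> omega
      simp only [List.map_cons, List.sum_cons] at ih ⊢
      omega
  have := h3 D
  rw [spent]; omega

variable {R : AdjArrays G} {S w : ℕ} {L : Layout} {P : DfsPar} {s₀ s : NState 32}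

/-- A search runs to its end.  Each iteration extends the history, which has bounded length. -/
theorem WP.dfsLoop (hP : P.Valid R S w L) {v i : ℕ} {p : List (ℕ × ℕ)} {D l f : List ℕ}
    (hH : P.H R v i p D l f) (hI : P.Inv R S w L s₀ v i p D l s) (h14 : s.v 14 = 1) :
    WP R S w (.loop (14 : Fin 32) (_root_.dfsBody P.dir P.a P.b
      (if P.emit then _root_.emitCmd P.vs P.es else .skip)
      (if P.logging then _root_.logPush 0 else .skip)
      (if P.logging then _root_.logPush 1 else .skip))) s
      fun q o s' => ∃ l' f' E, P.H R P.r (R.deg P.dir P.r) [] (D ++ E) l' f' ∧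
        P.Inv R S w L s₀ P.r (R.deg P.dir P.r) [] (D ++ E) (l' ++ [1]) s' ∧
        o = P.out R E ∧ q + P.spent R D l f ≤ P.spent R (D ++ E) l' f' + 1 := by
  have bound : ∀ {v i p D l f}, P.H R v i p D l f → l.length + D.length ≤ edgeCount G + n := by
    intro v i p D l f h
    have hlt : ∀ x ∈ D, x < n := fun x hx => (DfsPar.touched_of_mem hP.hrt h hx).lt
    have h1 := sum_map_le_sum_range h.nodup hlt (R.deg P.dir)
    have h2 := sum_map_le_sum_range h.nodup hlt fun _ => 1
    have h3 := h.length_le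
    rw [AdjArrays.sum_deg] at h1
    simp at h2
    omega
  obtain ⟨N, hN⟩ : ∃ N, edgeCount G + n < N + (l.length + D.length) :=
    ⟨edgeCount G + n + 1, by omega⟩
  induction N generalizing v i p D l f s with
  | zero => have := bound hH; omega
  | succ N ih =>
    refine loop_true (by simp) (by simp [h14]) ((dfsBody hP hH hI h14).conseq ?_)
    rintro q o s' (⟨h14', v', i', p', D', l', f', E, hH', hI', hlt, rfl, rfl, hq⟩ |
      ⟨h14', rfl, rfl, rfl, rfl, rfl, hI'⟩)
    · refine (ih hH' hI' h14' (by omega)).conseq ?_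
      rintro q' o' s'' ⟨l'', f'', E', hH'', hI'', rfl, hq'⟩
      refine ⟨l'', f'', E ++ E', by simpa using hH'', by simpa using hI'', ?_, ?_⟩
      · by_cases he : P.emit <;> simp [DfsPar.out, he]
      · rw [← List.append_assoc]; omega
    · exact loop_false (by simp) (by simp [h14']) ⟨l, f, [], by simpa using hH, by simpa using hI',
        by simp [DfsPar.out], by simp; omega⟩

/-- The variables that a depth-first search may change permanently. -/
def dfsVars' : List (Fin 32) := [0, 1, 2, 3, 4, 7, 8, 9, 10, 11, 12, 13, 14, 20, 21, 22, 23]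

theorem WP.dfs {Q : ℕ → List OutSymbol → NState 32 → Prop} {log : ℕ → ℕ}
    (hP : P.Valid R S w L)
    (g : Good R S w L s (Function.update P.col P.r P.b) log P.st) (h5 : s.v 5 = P.r)
    (h6 : s.v 6 = P.base) (h7 : s.v 7 = P.l.length) (hl : LogRep log P.l)
    (hQ : ∀ q s' D l f log' st', P.H R P.r (R.deg P.dir P.r) [] D l f →
      Good R S w L s' (recolor P.b P.col D) log' st' → (∀ x < P.base, st' x = P.st x) →
      LogRep log' (addLog P.logging P.l (l ++ [1])) →
      s'.v 7 = (addLog P.logging P.l (l ++ [1])).length → Same dfsVars' s s' →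
      q ≤ (D.map R.cost).sum → Q q (P.out R D) s') :
    WP R S w (dfs P.vs P.es P.dir P.a P.b P.logging P.emit) s Q := by
  have hrn := hP.hrt.lt
  have hw := hP.hL.w_pos
  have hw0 : w ≠ 0 := by omega
  have hcol : Function.update P.col P.r P.b = recolor P.b P.col [P.r] := by
    funext x
    by_cases h : x = P.r
    · subst h; simp [recolor]
    · simp [recolor, h]
  refine seq_assign (by simp) (seq_assign (by simp) (seq_assign (by simp; omega) ?_))
  simp only [Expr.val_var, h5, Expr.val_const]
  have g' : Good R S w L (((s.set 3 P.r).set 4 0).set 14 1) (recolor P.b P.col [P.r]) log P.st :=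
    hcol ▸ ((g.set (by decide) _).set (by decide) _).set (by decide) _
  have hinv : ∀ s5, Good R S w L s5 (recolor P.b P.col [P.r]) log P.st →
      Same [0, 2, 20, 21, 22, 23] (((s.set 3 P.r).set 4 0).set 14 1) s5 →
      P.Inv R S w L s P.r 0 [] [P.r] [] s5 ∧ s5.v 14 = 1 := by
    intro s5 g5 f5
    refine ⟨⟨⟨log, P.st, g5, trivial, fun x _ => rfl, by simpa [addLog] using hl⟩,
      ?_, ?_, ?_, ?_, ?_, ?_⟩, ?_⟩
    · rw [f5 3 (by decide)]; simp [NState.set_v]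
    · rw [f5 4 (by decide)]; simp [NState.set_v]
    · rw [f5 5 (by decide)]; simp [NState.set_v, h5]
    · rw [f5 6 (by decide)]; simpa [NState.set_v, pathBits] using h6
    · rw [f5 7 (by decide)]; simpa [NState.set_v, addLog] using h7
    · intro z hz
      simp [dfsVars] at hz
      rw [f5 z (by simp [hz])]; simp [NState.set_v, hz]
    · rw [f5 14 (by decide)]; simp [NState.set_v]
  have hloop : ∀ s5 q0, Good R S w L s5 (recolor P.b P.col [P.r]) log P.st →
      Same [0, 2, 20, 21, 22, 23] (((s.set 3 P.r).set 4 0).set 14 1) s5 →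
      q0 ≤ R.deg false P.r →
      WP R S w (.loop (14 : Fin 32) (_root_.dfsBody P.dir P.a P.b
        (if P.emit then _root_.emitCmd P.vs P.es else .skip)
        (if P.logging then _root_.logPush 0 else .skip)
        (if P.logging then _root_.logPush 1 else .skip))) s5
      fun q o s' => Q (q0 + q) (P.out R [P.r] ++ o) s' := by
    intro s5 q0 g5 f5 hq0
    obtain ⟨hI, h14⟩ := hinv s5 g5 f5
    refine (WP.dfsLoop hP Hist.start hI h14).conseq ?_
    rintro q o s' ⟨l', f', E, hH, ⟨⟨log', st', g6, -, hst, hlog⟩, i3, i4, i5, i6, i7, hs⟩, rfl, hq⟩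
    have := hQ (q0 + q) s' _ l' f' log' st' hH g6 hst hlog i7 (fun y hy => ?_) ?_
    · by_cases he : P.emit <;> simpa [DfsPar.out, he] using this
    · by_cases h : y = 6
      · subst h; rw [i6, h6]; rfl
      · exact hs y (by simp [dfsVars, dfsVars'] at hy ⊢; simp [hy, h])
    · have := P.spent_le hH
      have h0 : P.spent R [P.r] [] [] = 1 + 2 * stBits R P.dir P.r + R.deg false P.r := by
        simp [DfsPar.spent]
      omega
  cases hem : P.emit with
  | false =>
    refine seq (skip ?_)
    simpa [hem, DfsPar.out] using hloop _ 0 g' (fun _ _ => rfl) (Nat.zero_le _)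
  | true =>
    refine seq (emitCmd P.vs P.es hP.hL g' (by simpa [NState.set_v] using hrn)
      fun q s5 g5 hq f5 => ?_)
    have e3 : (((s.set 3 P.r).set 4 0).set 14 1).v 3 = P.r := by simp [NState.set_v]
    rw [e3] at hq ⊢
    have := hloop s5 q g5 f5 hq
    have he : emission R P.vs P.es (recolor P.b P.col [P.r]) P.r =
        emission R P.vs P.es P.col P.r := by
      refine emission_congr fun x => ?_
      have := hP.hem hem
      have := hP.hr
      by_cases hx : x = P.r
      · subst hx; simp [recolor]; omega
      · simp [recolor, hx]
    simpa [hem, DfsPar.out, he] using this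

end

/-! ### Strongly connected components and the finishing order -/

section

variable {n : ℕ} {G : Digraph (Fin n)} (R : AdjArrays G)

namespace AdjArrays

/-- There is a path from `u` to `v`. -/
abbrev Reach (u v : ℕ) : Prop := Relation.ReflTransGen (R.adj false) u v

/-- `D` lists the vertices of a strongly connected component. -/
def IsComp (D : List ℕ) : Prop :=
  D.Nodup ∧ ∃ u < n, ∀ x, x ∈ D ↔ R.Reach u x ∧ R.Reach x u

variable {R}

theorem Reach.lt {u v : ℕ} (h : R.Reach u v) (hu : u < n) : v < n := by
  induction h with
  | refl => exact hu
  | tail _ h _ => exact h.lt_right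

theorem IsComp.lt {D : List ℕ} (h : R.IsComp D) {x : ℕ} (hx : x ∈ D) : x < n := by
  obtain ⟨-, u, hu, h⟩ := h
  exact ((h x).1 hx).1.lt hu

theorem reach_iff {u v : Fin n} :
    Relation.ReflTransGen G.Adj u v ↔ R.Reach u v := by
  constructor
  · intro h
    induction h with
    | refl => exact .refl
    | tail _ h ih => exact ih.tail (adj_false.2 ⟨Fin.is_lt _, Fin.is_lt _, h⟩)
  · have key : ∀ x, R.Reach u x → ∀ hx : x < n, Relation.ReflTransGen G.Adj u ⟨x, hx⟩ := by
      intro x h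
      induction h with
      | refl => exact fun _ => .refl
      | tail _ h ih =>
        intro hx
        obtain ⟨hb, hc, h⟩ := adj_false.1 h
        exact (ih hb).tail h
    exact fun h => key _ h v.2

/-- A vertex without incoming or without outgoing edges is a component of its own. -/
theorem isComp_singleton {v : ℕ} (hv : v < n) (h : ¬ R.core v) : R.IsComp [v] := by
  refine ⟨by simp, v, hv, fun x => ?_⟩
  simp only [List.mem_singleton]
  refine ⟨fun hx => hx ▸ ⟨.refl, .refl⟩, fun ⟨h1, h2⟩ => ?_⟩
  rcases Relation.ReflTransGen.cases_head h1 with rfl | ⟨y, hy, -⟩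
  · rfl
  · rcases Relation.ReflTransGen.cases_tail h2 with rfl | ⟨z, -, hz⟩
    · rfl
    · exact absurd ⟨hy.pos_deg, hz.pos_codeg⟩ h

end AdjArrays

/-- The coloring when the vertices in `A` have been output: they have the color `2`, except that
vertices without outgoing edges keep the color `0`. -/
def doneCol (A : List ℕ) (x : ℕ) : ℕ := if 0 < R.deg false x ∧ x ∈ A then 2 else 0

/-- The invariant of the second phase of the algorithm: the vertices in `A` have been output, and
those in `F` may still have to be considered. -/
structure KInv (A F : List ℕ) : Prop where
  triv : ∀ x < n, ¬ R.core x → x ∈ A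
  pred : ∀ u x, R.adj false u x → 0 < R.deg false x → x ∈ A → u ∈ A
  cover : ∀ x, R.core x → x ∈ F ∨ x ∈ A

variable {R} {A F D l f : List ℕ} {v : ℕ}

theorem doneCol_eq_zero {x : ℕ} : doneCol R A x = 0 ↔ (0 < R.deg false x → x ∉ A) := by
  simp [doneCol]

theorem doneCol_ne_one {x : ℕ} : doneCol R A x ≠ 1 := by
  rw [doneCol]; split <;> simp

theorem KInv.core_of (h : KInv R A F) {x : ℕ} (hx : 0 < R.deg false x)
    (h0 : doneCol R A x = 0) : R.core x := by
  by_contra hc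
  exact doneCol_eq_zero.1 h0 hx (h.triv x (AdjArrays.lt_of_pos_deg hx) hc)

theorem KInv.reach (h : KInv R A F) {u x : ℕ} (hux : R.Reach u x) (hx : x ∈ A)
    (hd : 0 < R.deg false x) : u ∈ A := by
  have : u ∈ A ∧ 0 < R.deg false u := by
    induction hux using Relation.ReflTransGen.head_induction_on with
    | refl => exact ⟨hx, hd⟩
    | head hs _ ih => exact ⟨h.pred _ _ hs ih.2 ih.1, hs.pos_deg⟩
  exact this.1

/-- The backward search from the last vertex in the finishing order that has not been output finds
its component. -/
theorem KInv.mem_iff (h : KInv R A (F ++ [v])) (hv : R.core v) (hvA : v ∉ A)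
    (hF : FinProp (R.deg false) (R.head false) (· ∈ F) v)
    (hD : Hist (R.deg true) (R.head true) (fun x => doneCol R A x = 0) v v (R.deg true v) [] D l f)
    (x : ℕ) : x ∈ D ↔ R.Reach v x ∧ R.Reach x v := by
  have hA : ∀ x ∈ D, R.core x ∧ x ∉ A := by
    intro x hx
    have hc := AdjArrays.core_of_hist (dir := true) hv (fun x hx h0 => h.core_of hx h0) hD hx
    have h0 := Hist.ok_of_mem (ok := fun x => doneCol R A x = 0)
      (doneCol_eq_zero.2 fun _ => hvA) hD hx
    exact ⟨hc, doneCol_eq_zero.1 h0 hc.1⟩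
  constructor
  · intro hx
    have hr := hD.mem_iff_reach.1 hx
    have key : R.Reach x v ∧
        Relation.ReflTransGen (fun a b => a ∈ F ∧ R.adj false a b) x v := by
      clear hx
      induction hr with
      | refl => exact ⟨.refl, .refl⟩
      | @tail b c hb hs ih =>
        have hcD : c ∈ D := hD.mem_iff_reach.2 (hb.tail hs)
        have hadj : R.adj false c b := AdjArrays.adj_not.1 hs.1
        refine ⟨.head hadj ih.1, ?_⟩
        by_cases hcv : c = v
        · rw [hcv]
        · have := (h.cover c (hA c hcD).1).resolve_right (hA c hcD).2
          simp [hcv] at this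
          exact .head ⟨this, hadj⟩ ih.2
    exact ⟨hF x key.2, key.1⟩
  · rintro ⟨h1, h2⟩
    induction h2 using Relation.ReflTransGen.head_induction_on with
    | refl => exact hD.root_mem
    | @head a c hs _ ih =>
      refine hD.mem_iff_reach.2 ((hD.mem_iff_reach.1 (ih (h1.tail hs))).tail
        ⟨AdjArrays.adj_not.2 hs, doneCol_eq_zero.2 fun hd ha => hvA (h.reach h1 ha hd)⟩)

/-- Outputting the component found by the backward search keeps the invariant. -/
theorem KInv.step (h : KInv R A (F ++ [v])) (hv : R.core v) (hvA : v ∉ A)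
    (hD : Hist (R.deg true) (R.head true) (fun x => doneCol R A x = 0) v v (R.deg true v) [] D l f) :
    KInv R (A ++ D) F := by
  refine ⟨fun x hx hc => List.mem_append_left _ (h.triv x hx hc), fun u x hs hd hx => ?_,
    fun x hx => ?_⟩
  · rw [List.mem_append] at hx ⊢
    by_cases hu : u ∈ A
    · exact .inl hu
    · have hxD : x ∈ D := hx.resolve_left fun hx => hu (h.pred u x hs hd hx)
      exact .inr (hD.mem_iff_reach.2 ((hD.mem_iff_reach.1 hxD).tail
        ⟨AdjArrays.adj_not.2 hs, doneCol_eq_zero.2 fun _ => hu⟩))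
  · rw [List.mem_append]
    rcases h.cover x hx with hx | hx
    · rcases List.mem_append.1 hx with hx | hx
      · exact .inl hx
      · simp at hx; subst hx; exact .inr (.inr hD.root_mem)
    · exact .inr (.inl hx)

theorem KInv.skip (h : KInv R A (F ++ [v])) (hvA : v ∈ A) : KInv R A F :=
  ⟨h.triv, h.pred, fun x hx => by
    rcases h.cover x hx with hx | hx
    · rcases List.mem_append.1 hx with hx | hx
      · exact .inl hx
      · simp at hx; subst hx; exact .inr hvA
    · exact .inr hx⟩

theorem recolor_one_iff {x : ℕ} : recolor 1 (doneCol R A) D x = 1 ↔ x ∈ D := by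
  by_cases hx : x ∈ D
  · simp [recolor, hx]
  · simp [recolor, hx, doneCol_ne_one]

/-- A second search from the same root finds the same vertices. -/
theorem mem_second_search {l' f' D' : List ℕ}
    (hD : Hist (R.deg true) (R.head true) (fun x => doneCol R A x = 0) v v (R.deg true v) [] D l f)
    (hD' : Hist (R.deg true) (R.head true) (fun x => recolor 1 (doneCol R A) D x = 1) v v
      (R.deg true v) [] D' l' f') (x : ℕ) : x ∈ D' ↔ x ∈ D := by
  constructor
  · intro hx
    exact recolor_one_iff.1 (Hist.ok_of_mem (ok := fun x => recolor 1 (doneCol R A) D x = 1)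
      (recolor_one_iff.2 hD.root_mem) hD' hx)
  · intro hx
    have hr := hD.mem_iff_reach.1 hx
    clear hx
    induction hr with
    | refl => exact hD'.root_mem
    | tail hb hs ih =>
      exact hD'.mem_iff_reach.2 ((hD'.mem_iff_reach.1 ih).tail
        ⟨hs.1, recolor_one_iff.2 (hD.mem_iff_reach.2 (hb.tail hs))⟩)

/-! ### The form of the output -/

theorem emission_congr_head {vs es : Bool} {col col' : ℕ → ℕ} {x : ℕ}
    (h : ∀ y, R.adj false x y → (col y = 0 ↔ col' y = 0)) :
    emission R vs es col x = emission R vs es col' x := by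
  rw [emission, emission]
  congr 2
  refine congrArg _ (List.filter_congr fun i hi => ?_)
  simp [h _ (AdjArrays.adj_head (List.mem_range.1 hi))]

variable (R)

/-- The block for the component with the vertices `D`. -/
def blockOf (vs es : Bool) (D : List ℕ) : List OutSymbol :=
  (D.map (emission R vs es fun y => if y ∈ D then 1 else 0)).flatten

/-- The output for the components in the list `C`. -/
def outOf (vs es : Bool) (C : List (List ℕ)) : List OutSymbol :=
  [OutSymbol.sep].intercalate (C.map (blockOf R vs es))

variable {R} {vs es : Bool}

theorem outOf_concat (C : List (List ℕ)) (D : List ℕ) : outOf R vs es (C ++ [D]) =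
    outOf R vs es C ++ (if C = [] then [] else [OutSymbol.sep]) ++ blockOf R vs es D := by
  rcases C with _ | ⟨a, C⟩
  · simp [outOf, List.intercalate]
  · rw [if_neg (by simp)]
    induction C generalizing a with
    | nil => simp [outOf, List.intercalate]
    | cons b C ih =>
      have h := ih b
      simp only [outOf, List.intercalate, List.cons_append, List.map_cons,
        List.intersperse_cons_cons, List.flatten_cons] at h ⊢
      rw [h]
      simp

theorem blockOf_singleton {v : ℕ} (h : ¬ R.core v) :
    blockOf R vs es [v] = if vs then [.vertex v] else [] := by
  have h0 : emission R vs es (fun y => if y ∈ [v] then 1 else 0) v =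
      emission R vs es (fun _ => 0) v := by
    refine emission_congr_head fun y hy => ?_
    have : y ≠ v := by rintro rfl; exact h ⟨hy.pos_deg, hy.pos_codeg⟩
    simp [this]
  rw [blockOf, List.map_singleton, h0]
  simp [emission]

/-- The second search outputs the block of the component. -/
theorem flatten_emission_eq_blockOf {D' : List ℕ} (h : KInv R A F) (hA : ∀ x ∈ D, x ∉ A)
    (hm : ∀ x, x ∈ D' ↔ x ∈ D) :
    (D'.map (emission R vs es (recolor 1 (doneCol R A) D))).flatten = blockOf R vs es D' := by
  rw [blockOf]
  congr 1
  refine List.map_congr_left fun x hx => emission_congr_head fun y hy => ?_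
  by_cases hyD : y ∈ D
  · simp [recolor, hyD, (hm y).2 hyD]
  · have : doneCol R A y = 0 := doneCol_eq_zero.2 fun hd hyA =>
      hA x ((hm x).1 hx) (h.pred x y hy hd hyA)
    simp [recolor, hyD, (hm y), this]

theorem mem_emission {col : ℕ → ℕ} {x : ℕ} {s : OutSymbol} : s ∈ emission R vs es col x ↔
    (vs = true ∧ s = .vertex x) ∨
    (es = true ∧ ∃ y, R.adj false x y ∧ col y ≠ 0 ∧ s = .edge x y) := by
  rw [emission, List.mem_append]
  refine or_congr (by cases vs <;> simp) ?_
  cases es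
  · simp
  · simp only [if_true, List.mem_map, List.mem_filter, List.mem_range, decide_eq_true_eq, true_and]
    constructor
    · rintro ⟨i, ⟨hi, hc⟩, rfl⟩
      exact ⟨_, AdjArrays.adj_head hi, hc, rfl⟩
    · rintro ⟨y, ⟨i, hi, rfl⟩, hc, rfl⟩
      exact ⟨i, ⟨hi, hc⟩, rfl⟩

theorem nodup_emission {col : ℕ → ℕ} {x : ℕ} : (emission R vs es col x).Nodup := by
  rw [emission, List.nodup_append]
  refine ⟨by cases vs <;> simp, ?_, ?_⟩
  · cases es
    · simp
    · refine (List.Nodup.filter _ List.nodup_range).map_on fun i hi j hj he => ?_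
      simp only [List.mem_filter, List.mem_range] at hi hj
      simp only [OutSymbol.edge.injEq, true_and] at he
      exact AdjArrays.head_inj hi.1 hj.1 he
  · cases vs <;> cases es <;> simp
    rintro a i _ _ rfl
    simp

theorem mem_blockOf {s : OutSymbol} : s ∈ blockOf R vs es D ↔
    (vs = true ∧ ∃ x ∈ D, s = .vertex x) ∨
    (es = true ∧ ∃ x ∈ D, ∃ y ∈ D, R.adj false x y ∧ s = .edge x y) := by
  simp only [blockOf, List.mem_flatten, List.mem_map]
  constructor
  · rintro ⟨_, ⟨x, hx, rfl⟩, hs⟩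
    rcases mem_emission.1 hs with ⟨h, rfl⟩ | ⟨h, y, hy, hc, rfl⟩
    · exact .inl ⟨h, x, hx, rfl⟩
    · exact .inr ⟨h, x, hx, y, by by_contra hyD; simp [hyD] at hc, hy, rfl⟩
  · rintro (⟨h, x, hx, rfl⟩ | ⟨h, x, hx, y, hyD, hy, rfl⟩)
    · exact ⟨_, ⟨x, hx, rfl⟩, mem_emission.2 (.inl ⟨h, rfl⟩)⟩
    · exact ⟨_, ⟨x, hx, rfl⟩, mem_emission.2 (.inr ⟨h, y, hy, by simp [hyD], rfl⟩)⟩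

theorem nodup_blockOf (hD : D.Nodup) : (blockOf R vs es D).Nodup := by
  rw [blockOf, List.nodup_flatten]
  refine ⟨?_, ?_⟩
  · intro l hl
    obtain ⟨x, -, rfl⟩ := List.mem_map.1 hl
    exact nodup_emission
  · refine List.pairwise_map.2 (hD.imp fun {x y} hxy s hs ht => ?_)
    rcases mem_emission.1 hs with ⟨-, rfl⟩ | ⟨-, _, -, -, rfl⟩ <;>
      rcases mem_emission.1 ht with ⟨-, h⟩ | ⟨-, _, -, -, h⟩ <;> simp at h
    · exact hxy h
    · exact hxy h.1

/-- The output for a list of all components is correct. -/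
theorem isSCCOutput_outOf {C : List (List ℕ)} (hC : ∀ D ∈ C, R.IsComp D) (hn : C.flatten.Nodup)
    (hall : ∀ x < n, x ∈ C.flatten) : IsSCCOutput G vs es (outOf R vs es C) := by
  have hscc : ∀ D ∈ C, ∀ u : Fin n, (u : ℕ) ∈ D →
      {v : Fin n | (v : ℕ) ∈ D} = {v | StronglyEquiv G u v} := by
    intro D hD u hu
    obtain ⟨-, r, hr, h⟩ := hC D hD
    ext v
    simp only [Set.mem_ofPred_eq, StronglyEquiv, AdjArrays.reach_iff (R := R)]
    obtain ⟨h1, h2⟩ := (h u).1 hu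
    rw [h]
    exact ⟨fun ⟨h3, h4⟩ => ⟨h2.trans h3, h4.trans h1⟩, fun ⟨h3, h4⟩ => ⟨h1.trans h3, h4.trans h2⟩⟩
  have hne : ∀ D ∈ C, ∃ u : Fin n, (u : ℕ) ∈ D := by
    intro D hD
    obtain ⟨-, r, hr, h⟩ := hC D hD
    exact ⟨⟨r, hr⟩, (h r).2 ⟨.refl, .refl⟩⟩
  refine ⟨C.map fun D => {v : Fin n | (v : ℕ) ∈ D}, C.map (blockOf R vs es), ?_, ?_, ?_, rfl⟩
  · have hp := (List.nodup_flatten.1 hn).2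
    refine List.pairwise_map.2 (hp.imp_of_mem fun {D D'} hD hD' hd he => ?_)
    obtain ⟨u, hu⟩ := hne D hD
    have : u ∈ {v : Fin n | (v : ℕ) ∈ D'} := he ▸ hu
    exact hd hu this
  · intro A
    simp only [List.mem_map]
    constructor
    · rintro ⟨D, hD, rfl⟩
      obtain ⟨u, hu⟩ := hne D hD
      exact ⟨u, hscc D hD u hu⟩
    · rintro ⟨u, rfl⟩
      obtain ⟨D, hD, hu⟩ := List.mem_flatten.1 (hall u u.2)
      exact ⟨D, hD, hscc D hD u hu⟩
  · rw [List.forall₂_map_left_iff, List.forall₂_map_right_iff, List.forall₂_same]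
    intro D hD
    refine ⟨nodup_blockOf (hC D hD).1, fun s => ?_⟩
    rw [mem_blockOf, componentSymbols]
    simp only [Set.mem_union, Set.mem_ofPred_eq]
    refine or_congr (and_congr_right fun _ => ?_) (and_congr_right fun _ => ?_)
    · exact ⟨fun ⟨x, hx, h⟩ => ⟨⟨x, (hC D hD).lt hx⟩, hx, h⟩, fun ⟨x, hx, h⟩ => ⟨x, hx, h⟩⟩
    · constructor
      · rintro ⟨x, hx, y, hy, ha, rfl⟩
        obtain ⟨h1, h2, h3⟩ := AdjArrays.adj_false.1 ha
        exact ⟨⟨x, h1⟩, hx, ⟨y, h2⟩, hy, h3, rfl⟩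
      · rintro ⟨x, hx, y, hy, ha, rfl⟩
        exact ⟨x, hx, y, hy, AdjArrays.adj_false.2 ⟨x.2, y.2, ha⟩, rfl⟩

end

/-! ### Loops over the vertices, and the first phase -/

/-- Executes `c` with the values `0, …, n - 1` of variable `16`. -/
def forUp (c : Cmd 32) : Cmd 32 :=
  .assign 16 (.const 0) ;;
  .loop (.op .lt (16 : Fin 32) Expr.numVertices)
    (c ;; .assign 16 (((16 : Fin 32) : Expr 32) + .const 1))

/-- Distinguishes whether the vertex in variable `16` has outgoing and incoming edges. -/
def byDegrees (both out inn none : Cmd 32) : Cmd 32 :=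
  .query 12 (.deg false) (16 : Fin 32) (.const 0) ;;
  .query 8 (.deg true) (16 : Fin 32) (.const 0) ;;
  .ite (12 : Fin 32) (.ite (8 : Fin 32) both out) (.ite (8 : Fin 32) inn none)

/-- Writes a separator, except on the first occasion. -/
def sepCmd : Cmd 32 := .ite (15 : Fin 32) (.assign 15 (.const 0)) .emitSep

/-- Outputs the components that consist of a vertex without incoming or without outgoing edges, and
gives these vertices the color `1`. -/
def trivialPass (vs : Bool) : Cmd 32 :=
  let single : Cmd 32 := sepCmd ;; if vs then .emitVertex (16 : Fin 32) else .skip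
  .assign 15 (.const 1) ;;
  forUp (byDegrees .skip (single ;; colPut 16 (.const 1)) (single ;; colPut 16 (.const 1))
    (single ;; .skip))

/-- Depth-first searches along the outgoing edges, with a log, from all vertices that have not
been discovered yet. -/
def logPass (vs es : Bool) : Cmd 32 :=
  forUp (byDegrees
    (colGet 13 16 ;;
      .ite (13 : Fin 32) (logPush 0)
        (colPut 16 (.const 1) ;; .assign 5 (16 : Fin 32) ;; dfs vs es false 0 1 true false))
    .skip .skip .skip)

/-- Sets the colors as the second phase requires. -/
def recolorPass : Cmd 32 :=
  forUp (byDegrees (colPut 16 (.const 0)) (colPut 16 (.const 2)) (colPut 16 (.const 0)) .skip)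

section

variable {n : ℕ} {G : Digraph (Fin n)} {R : AdjArrays G} {S w : ℕ} {L : Layout} {s : NState 32}
  {Q : ℕ → List OutSymbol → NState 32 → Prop} {col log st : ℕ → ℕ}

theorem Good.congr {col' : ℕ → ℕ} (h : Good R S w L s col log st)
    (hc : ∀ x, R.touched x → col x = col' x) : Good R S w L s col' log st :=
  ⟨h.fix, h.st, h.log, h.ptr, h.col.imp fun _ hc' => ⟨hc'.1, fun x hx => (hc'.2 x hx).trans (hc x hx)⟩⟩

theorem WP.forUp {c : Cmd 32} (I : ℕ → ℕ → List OutSymbol → NState 32 → Prop)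
    (hn : n + 1 < 2 ^ w) (h0 : I 0 0 [] (s.set 16 0))
    (hbody : ∀ r q o s', r < n → I r q o s' → s'.v 16 = r → WP R S w c s' fun q' o' s'' =>
      s''.v 16 = r ∧ I (r + 1) (q + 1 + q') (o ++ o') (s''.set 16 (r + 1)))
    (hend : ∀ q o s', I n q o s' → Q q o s') : WP R S w (forUp c) s Q := by
  have hw0 : w ≠ 0 := by rintro rfl; simp at hn
  refine seq_assign (by simp) ?_
  refine loop_inv (fun q o s' => s'.v 16 ≤ n ∧ I (s'.v 16) q o s') (fun s' => n - s'.v 16)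
    (by simpa using h0) (fun q o s' _ => by simp; omega) ?_ ?_
  · rintro q o s' ⟨hle, hI⟩ hb
    have hlt : s'.v 16 < n := by by_contra hc; simp [hc] at hb
    refine seq ((hbody _ q o s' hlt hI rfl).conseq ?_)
    rintro q' o' s'' ⟨h16, hI'⟩
    refine assign (by simp [h16]; omega) ?_
    simp only [Expr.val_add, Expr.val_var, Expr.val_const, h16, NState.set_v_self, add_zero,
      List.append_nil]
    exact ⟨⟨hlt, hI'⟩, by omega⟩
  · rintro q o s' ⟨hle, hI⟩ hb
    have hge : ¬ s'.v 16 < n := by intro hc; simp [hc] at hb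
    rw [show s'.v 16 = n by omega] at hI
    exact hend q o s' hI

theorem WP.byDegrees {both out inn none : Cmd 32} {x : ℕ} (hn : 4 * (n + 2) < 2 ^ w)
    (h16 : s.v 16 = x) (hx : x < n)
    (h1 : R.core x → ∀ s' : NState 32, s'.m = s.m → Same [8, 12] s s' → WP R S w both s' Q)
    (h2 : 0 < R.deg false x → R.deg true x = 0 →
      ∀ s' : NState 32, s'.m = s.m → Same [8, 12] s s' → WP R S w out s' Q)
    (h3 : R.deg false x = 0 → 0 < R.deg true x →
      ∀ s' : NState 32, s'.m = s.m → Same [8, 12] s s' → WP R S w inn s' Q)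
    (h4 : R.deg false x = 0 → R.deg true x = 0 →
      ∀ s' : NState 32, s'.m = s.m → Same [8, 12] s s' → WP R S w none s' Q) :
    WP R S w (byDegrees both out inn none) s Q := by
  have hd1 : R.deg false x ≤ n := AdjArrays.deg_le
  have hd2 : R.deg true x ≤ n := AdjArrays.deg_le
  refine seq_query (R.deg false x) (by simp) (by simp)
    (by simpa [h16] using AdjArrays.answer_deg hx) (by omega) ?_
  refine seq_query (R.deg true x) (by simp) (by simp)
    (by simpa [NState.set_v, h16] using AdjArrays.answer_deg hx) (by omega) ?_
  have hs : Same [8, 12] s ((s.set 12 (R.deg false x)).set 8 (R.deg true x)) := fun y hy => by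
    simp at hy; simp [NState.set_v, hy]
  refine WP.ite (by simp) (fun hb => WP.ite (by simp) (fun hb' => ?_) fun hb' => ?_)
    fun hb => WP.ite (by simp) (fun hb' => ?_) fun hb' => ?_
  all_goals simp [NState.set_v] at hb hb'
  · exact h1 ⟨by omega, by omega⟩ _ rfl hs
  · exact h2 (by omega) (by omega) _ rfl hs
  · exact h3 (by omega) (by omega) _ rfl hs
  · exact h4 (by omega) (by omega) _ rfl hs

theorem WP.sepCmd {b : Prop} [Decidable b] (h15 : s.v 15 = if b then 1 else 0)
    (hQ : ∀ s' : NState 32, s'.m = s.m → s'.v 15 = 0 → Same [15] s s' →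
      Q 0 (if b then [] else [.sep]) s') : WP R S w sepCmd s Q := by
  refine WP.ite (by simp) (fun hb => WP.assign (by simp) ?_) fun hb => WP.emitSep ?_
  all_goals
    rw [Expr.val_var, h15] at hb
    simp at hb
    simp only [hb, if_true, if_false] at hQ
    first
    | exact hQ _ rfl (by simp) fun y hy => by simp at hy; simp [NState.set_v, hy]
    | exact hQ _ rfl (by simp [h15, hb]) fun _ _ => rfl

/-- The coloring in the first phase, when the vertices in `F` are finished. -/
noncomputable def logCol (R : AdjArrays G) (F : List ℕ) (x : ℕ) : ℕ :=
  open Classical in if R.core x ∧ x ∉ F then 0 else 1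

/-- The trivial components among the vertices smaller than `r`. -/
noncomputable def trivComps (R : AdjArrays G) (r : ℕ) : List (List ℕ) :=
  open Classical in ((List.range r).filter fun x => ¬ R.core x).map fun x => [x]

theorem trivComps_succ_of_core {r : ℕ} (h : R.core r) : trivComps R (r + 1) = trivComps R r := by
  simp [trivComps, List.range_succ, List.filter_append, h]

theorem trivComps_succ {r : ℕ} (h : ¬ R.core r) :
    trivComps R (r + 1) = trivComps R r ++ [[r]] := by
  simp [trivComps, List.range_succ, List.filter_append, h]

theorem mem_trivComps {r : ℕ} {D : List ℕ} :
    D ∈ trivComps R r ↔ ∃ x < r, ¬ R.core x ∧ D = [x] := by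
  simp [trivComps]
  aesop

theorem flatten_trivComps {r : ℕ} : (trivComps R r).flatten.Nodup ∧
    ∀ x, x ∈ (trivComps R r).flatten ↔ x < r ∧ ¬ R.core x := by
  classical
  have : ∀ l : List ℕ, (l.map fun x => [x]).flatten = l := by
    intro l; induction l with
    | nil => rfl
    | cons a l ih => simp [ih]
  rw [trivComps, this]
  exact ⟨List.Nodup.filter _ List.nodup_range, fun x => by simp⟩

theorem WP.trivialPass (vs es : Bool) (hL : L.Valid R S w) (g : Good R S w L s (fun _ => 0) log st)
    (hQ : ∀ q s', Good R S w L s' (logCol R []) log st →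
      s'.v 15 = (if trivComps R n = [] then 1 else 0) → Same [0, 1, 2, 8, 12, 15, 16] s s' →
      q ≤ n → Q q (outOf R vs es (trivComps R n)) s') : WP R S w (trivialPass vs) s Q := by
  classical
  have hn := hL.n_lt
  have hw := hL.w_pos
  have hw0 : w ≠ 0 := by omega
  refine WP.seq_assign (by simp; omega) ?_
  refine WP.forUp (fun r q o s' =>
    Good R S w L s' (fun x => if x < r then logCol R [] x else 0) log st ∧
    s'.v 15 = (if trivComps R r = [] then 1 else 0) ∧ Same [0, 1, 2, 8, 12, 15, 16] s s' ∧
    q = r ∧ o = outOf R vs es (trivComps R r)) (by omega) ?_ ?_ ?_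
  · refine ⟨by simpa using (g.set (by decide) _).set (by decide) _, by simp [NState.set_v, trivComps],
      fun y hy => ?_, rfl, by simp [outOf, trivComps, List.intercalate]⟩
    simp at hy; simp [NState.set_v, hy]
  · rintro r q o s1 hr ⟨g1, h15, hs, rfl, rfl⟩ h16
    have hdone : ∀ s2, Good R S w L s2 (fun x => if x < q + 1 then logCol R [] x else 0) log st →
        ¬ R.core q → s2.v 15 = 0 → Same [0, 1, 2, 8, 12, 15] s1 s2 →
        s2.v 16 = q ∧ Good R S w L (s2.set 16 (q + 1))
          (fun x => if x < q + 1 then logCol R [] x else 0) log st ∧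
          (s2.set 16 (q + 1)).v 15 = (if trivComps R (q + 1) = [] then 1 else 0) ∧
          Same [0, 1, 2, 8, 12, 15, 16] s (s2.set 16 (q + 1)) := by
      intro s2 g2 hc h15' f2
      refine ⟨by rw [f2 16 (by decide), h16], g2.set (by decide) _, ?_, fun y hy => ?_⟩
      · simp [NState.set_v, h15', trivComps_succ hc]
      · have := hs y hy
        simp at hy
        simp [NState.set_v, hy, f2, this]
    have hsing : ∀ s2 d, ¬ R.core q → s2.m = s1.m → Same [8, 12] s1 s2 →
        (∀ s3, Good R S w L s3 (fun x => if x < q then logCol R [] x else 0) log st →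
          s3.v 15 = 0 → Same [8, 12, 15] s1 s3 → WP R S w d s3 fun q' o' s' => q' = 0 ∧ o' = [] ∧
            Good R S w L s' (fun x => if x < q + 1 then logCol R [] x else 0) log st ∧
            s'.v 15 = 0 ∧ Same [0, 1, 2, 8, 12, 15] s1 s') →
        WP R S w ((_root_.sepCmd ;; if vs then .emitVertex (16 : Fin 32) else .skip) ;; d) s2
          fun q' o' s' => s'.v 16 = q ∧ Good R S w L (s'.set 16 (q + 1))
            (fun x => if x < q + 1 then logCol R [] x else 0) log st ∧
            (s'.set 16 (q + 1)).v 15 = (if trivComps R (q + 1) = [] then 1 else 0) ∧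
            Same [0, 1, 2, 8, 12, 15, 16] s (s'.set 16 (q + 1)) ∧ q + 1 + q' = q + 1 ∧
            outOf R vs es (trivComps R q) ++ o' = outOf R vs es (trivComps R (q + 1)) := by
      intro s2 d hc hm f2 hd
      refine WP.seq (WP.seq (WP.sepCmd (b := trivComps R q = [])
        (by rw [f2 15 (by decide), h15]) fun s3 m3 h15' f3 => ?_))
      have f3' : Same [8, 12, 15] s1 s3 := fun y hy => by
        simp at hy; rw [f3 y (by simp [hy]), f2 y (by simp [hy])]
      have g3 := g1.of_same (s' := s3) (m3.trans hm) fun x hx => f3' x (by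
        simp; refine ⟨?_, ?_, ?_⟩ <;> rintro rfl <;> exact absurd hx (by decide))
      have fin := hd s3 g3 h15' f3'
      have key : WP R S w d s3 fun q' o' s' => s'.v 16 = q ∧ Good R S w L (s'.set 16 (q + 1))
            (fun x => if x < q + 1 then logCol R [] x else 0) log st ∧
            (s'.set 16 (q + 1)).v 15 = (if trivComps R (q + 1) = [] then 1 else 0) ∧
            Same [0, 1, 2, 8, 12, 15, 16] s (s'.set 16 (q + 1)) ∧ q + 1 + q' = q + 1 ∧
            outOf R vs es (trivComps R q) ++ ((if trivComps R q = [] then [] else [.sep]) ++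
              ((if vs then [.vertex q] else []) ++ o')) =
            outOf R vs es (trivComps R (q + 1)) := by
        refine fin.conseq ?_
        rintro q' o' s' ⟨rfl, rfl, g4, h4, f4⟩
        obtain ⟨a1, a2, a3, a4⟩ := hdone s' g4 hc h4 f4
        refine ⟨a1, a2, a3, a4, rfl, ?_⟩
        rw [trivComps_succ hc, outOf_concat, blockOf_singleton hc]
        simp
      cases hv : vs with
      | false =>
        refine WP.skip ?_
        simpa [hv] using key
      | true =>
        refine WP.emitVertex (by simp) ?_
        have e16 : s3.v 16 = q := by rw [f3' 16 (by decide), h16]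
        simpa [hv, e16, List.append_assoc] using key
    have hput : ¬ R.core q → R.touched q → ∀ s3,
        Good R S w L s3 (fun x => if x < q then logCol R [] x else 0) log st →
        s3.v 15 = 0 → Same [8, 12, 15] s1 s3 →
        WP R S w (_root_.colPut 16 (.const 1)) s3 fun q' o' s' => q' = 0 ∧ o' = [] ∧
            Good R S w L s' (fun x => if x < q + 1 then logCol R [] x else 0) log st ∧
            s'.v 15 = 0 ∧ Same [0, 1, 2, 8, 12, 15] s1 s' := by
      intro hc ht s3 g3 h15' f3
      have e16 : s3.v 16 = q := by rw [f3 16 (by decide), h16]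
      refine WP.colPut hL g3 (by decide) (by decide) (by rw [e16]; exact ht) (by norm_num)
        fun s4 g4 f4 => ⟨rfl, rfl, ?_, by rw [f4 15 (by decide), h15'], fun y hy => ?_⟩
      · convert g4 using 1
        funext x
        rw [e16]
        by_cases hx : x = q
        · subst hx; simp [logCol, hc]
        · simp only [Function.update_of_ne hx]
          congr 1
          simp; omega
      · simp at hy; rw [f4 y (by simp [hy]), f3 y (by simp [hy])]
    refine WP.byDegrees hn h16 hr ?_ ?_ ?_ ?_
    · intro hc s2 m2 f2
      refine WP.skip ⟨by rw [f2 16 (by decide), h16], ?_, ?_, fun y hy => ?_, rfl, ?_⟩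
      · have g2 := g1.of_same (s' := s2) m2 fun x hx => f2 x (by
          simp; refine ⟨?_, ?_⟩ <;> rintro rfl <;> exact absurd hx (by decide))
        refine (g2.set (by decide) _).congr fun x hx => ?_
        by_cases hxq : x = q
        · subst hxq; simp [logCol, hc]
        · congr 1; simp; omega
      · rw [trivComps_succ_of_core hc]; simp [NState.set_v, f2, h15]
      · have := hs y hy
        simp at hy; simp [NState.set_v, hy, f2, this]
      · rw [trivComps_succ_of_core hc, List.append_nil]
    · intro h1 h2 s2 m2 f2
      have hc : ¬ R.core q := fun h => by have := h.2; omega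
      exact hsing s2 _ hc m2 f2 (hput hc (.inl h1))
    · intro h1 h2 s2 m2 f2
      have hc : ¬ R.core q := fun h => by have := h.1; omega
      exact hsing s2 _ hc m2 f2 (hput hc (.inr h2))
    · intro h1 h2 s2 m2 f2
      have hc : ¬ R.core q := fun h => by have := h.1; omega
      have ht : ¬ R.touched q := by rintro (h | h) <;> omega
      refine hsing s2 .skip hc m2 f2 fun s3 g3 h15' f3 => WP.skip ⟨rfl, rfl,
        g3.congr fun x hx => ?_, h15', fun y hy => ?_⟩
      · have hxq : x ≠ q := by rintro rfl; exact ht hx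
        congr 1; simp; omega
      · simp at hy; rw [f3 y (by simp [hy])]
  · rintro q o s' ⟨g', h15, hs, rfl, rfl⟩
    refine hQ _ s' (g'.congr fun x hx => if_pos hx.lt) h15 hs le_rfl

end

section

variable {n : ℕ} {G : Digraph (Fin n)} (R : AdjArrays G)

/-- The histories of the first phase: `Hist1 R r l F` says that, when the vertices smaller than `r` have
been considered, the log is `l`, and the vertices in `F` are finished, in this order.  The log has an
entry `0` for each root that was discovered before, and otherwise the log of the search, followed by `1`. -/
inductive Hist1 : ℕ → List ℕ → List ℕ → Prop
  | start : Hist1 0 [] []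
  | triv {r l F} : Hist1 r l F → ¬ R.core r → Hist1 (r + 1) l F
  | seen {r l F} : Hist1 r l F → R.core r → r ∈ F → Hist1 (r + 1) (l ++ [0]) F
  | run {r l F D l' f} : Hist1 r l F → R.core r → r ∉ F →
      Hist (R.deg false) (R.head false) (fun x => logCol R F x = 0) r r (R.deg false r) [] D l' f →
      Hist1 (r + 1) (l ++ (l' ++ [1])) (F ++ (f ++ [r]))

/-- The number of vertices smaller than `r` with both incoming and outgoing edges. -/
noncomputable def coreCount (r : ℕ) : ℕ :=
  open Classical in ((Finset.range r).filter R.core).card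

variable {R} {r : ℕ} {l F : List ℕ}

theorem logCol_eq_zero {x : ℕ} : logCol R F x = 0 ↔ R.core x ∧ x ∉ F := by
  simp only [logCol]; split_ifs with h <;> simp [h]

theorem recolor_logCol {D f : List ℕ} {v : ℕ} (h : D.Perm (f ++ [v])) :
    recolor 1 (logCol R F) D = logCol R (F ++ (f ++ [v])) := by
  funext x
  have := h.mem_iff (a := x)
  by_cases hx : x ∈ D
  · simp only [recolor, hx, if_true, logCol]
    rw [if_neg]
    exact fun hc => hc.2 (List.mem_append_right _ (this.1 hx))
  · have hx' : x ∉ f ++ [v] := fun h => hx (this.2 h)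
    have hiff : x ∈ F ++ (f ++ [v]) ↔ x ∈ F := by rw [List.mem_append, or_iff_left hx']
    simp only [recolor, hx, if_false, logCol]
    by_cases hc : R.core x ∧ x ∉ F
    · rw [if_pos hc, if_pos (by rwa [hiff])]
    · rw [if_neg hc, if_neg (by rwa [hiff])]

theorem coreCount_succ_of_core (h : R.core r) : coreCount R (r + 1) = coreCount R r + 1 := by
  classical
  simp [coreCount, Finset.range_add_one, Finset.filter_insert, h]

theorem coreCount_succ (h : ¬ R.core r) : coreCount R (r + 1) = coreCount R r := by
  classical
  simp [coreCount, Finset.range_add_one, Finset.filter_insert, h]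

theorem coreCount_mono {r' : ℕ} (h : r ≤ r') : coreCount R r ≤ coreCount R r' := by
  classical
  exact Finset.card_le_card (Finset.filter_subset_filter _ (Finset.range_mono h))

namespace Hist1

theorem nodup (h : Hist1 R r l F) : F.Nodup := by
  induction h with
  | start => simp
  | triv _ _ ih => exact ih
  | seen _ _ _ ih => exact ih
  | @run r l F D l' f _ hc hr hD ih =>
    have hp : D.Perm (f ++ [r]) := hD.perm
    refine List.nodup_append.2 ⟨ih, hp.nodup_iff.1 hD.nodup, fun a ha b hb hab => ?_⟩
    subst hab
    exact (logCol_eq_zero.1 (Hist.ok_of_mem (ok := fun x => logCol R F x = 0)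
      (logCol_eq_zero.2 ⟨hc, hr⟩) hD (hp.mem_iff.2 hb))).2 ha

theorem core (h : Hist1 R r l F) : ∀ x ∈ F, R.core x := by
  induction h with
  | start => simp
  | triv _ _ ih => exact ih
  | seen _ _ _ ih => exact ih
  | @run r l F D l' f _ hc hr hD ih =>
    intro x hx
    rcases List.mem_append.1 hx with hx | hx
    · exact ih x hx
    · exact (logCol_eq_zero.1 (Hist.ok_of_mem (ok := fun x => logCol R F x = 0)
        (logCol_eq_zero.2 ⟨hc, hr⟩) hD (hD.perm.mem_iff.2 hx))).1

theorem mem (h : Hist1 R r l F) : ∀ x < r, R.core x → x ∈ F := by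
  induction h with
  | start => simp
  | triv _ h ih =>
    intro x hx hc
    rcases Nat.lt_succ_iff_lt_or_eq.1 hx with hx | rfl
    · exact ih x hx hc
    · exact absurd hc h
  | seen _ _ hr ih =>
    intro x hx hc
    rcases Nat.lt_succ_iff_lt_or_eq.1 hx with hx | rfl
    · exact ih x hx hc
    · exact hr
  | run _ _ _ _ ih =>
    intro x hx hc
    rcases Nat.lt_succ_iff_lt_or_eq.1 hx with hx | rfl
    · exact List.mem_append_left _ (ih x hx hc)
    · simp

/-- The finished vertices have no edges to undiscovered vertices. -/
theorem closed (h : Hist1 R r l F) :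
    ∀ x ∈ F, ∀ j < R.deg false x, ¬ logCol R F (R.head false x j) = 0 := by
  induction h with
  | start => simp
  | triv _ _ ih => exact ih
  | seen _ _ _ ih => exact ih
  | @run r l F D l' f _ hc hr hD ih =>
    intro x hx j hj h0
    obtain ⟨h1, h2⟩ := logCol_eq_zero.1 h0
    rw [List.mem_append, not_or] at h2
    have hk : logCol R F (R.head false x j) = 0 := logCol_eq_zero.2 ⟨h1, h2.1⟩
    rcases List.mem_append.1 hx with hx | hx
    · exact ih x hx j hj hk
    · have hxD := hD.mem_iff_reach.1 (hD.perm.mem_iff.2 hx)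
      exact h2.2 (hD.perm.mem_iff.1 (hD.mem_iff_reach.2 (hxD.tail ⟨⟨j, hj, rfl⟩, hk⟩)))

theorem finOrder (h : Hist1 R r l F) : FinOrder (R.deg false) (R.head false) F := by
  induction h with
  | start => intro f₁ v f₂ h; simp at h
  | triv _ _ ih => exact ih
  | seen _ _ _ ih => exact ih
  | @run r l F D l' f h hc hr hD ih =>
    rw [← List.append_assoc]
    have hr0 := logCol_eq_zero.2 ⟨hc, hr⟩
    exact (Hist.finOrder (ok := fun x => logCol R F x = 0) hD hr0 h.closed ih).append
      (Hist.finProp (ok := fun x => logCol R F x = 0) hD hr0 h.closed)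

theorem length (h : Hist1 R r l F) : l.length = (F.map (R.deg false)).sum + coreCount R r := by
  induction h with
  | start => simp [coreCount]
  | triv _ h ih => rw [coreCount_succ h, ih]
  | seen _ h _ ih => rw [coreCount_succ_of_core h, List.length_append, ih]; rfl
  | run _ h _ hD ih =>
    rw [coreCount_succ_of_core h, List.length_append, ih, List.length_append, hD.length]
    simp; omega

theorem length_run {v i : ℕ} {p : List (ℕ × ℕ)} {D l' f : List ℕ} (h : Hist1 R r l F)
    (hc : R.core r) (hr : r ∉ F)
    (hD : Hist (R.deg false) (R.head false) (fun x => logCol R F x = 0) r v i p D l' f) :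
    l.length + l'.length + 1 ≤ edgeCount G + coreCount R n := by
  have hr0 := logCol_eq_zero.2 ⟨hc, hr⟩
  have hDc : ∀ x ∈ D, R.core x ∧ x ∉ F := fun x hx => logCol_eq_zero.1
    (Hist.ok_of_mem (ok := fun x => logCol R F x = 0) hr0 hD hx)
  have hn : (F ++ D).Nodup := List.nodup_append.2
    ⟨h.nodup, hD.nodup, fun a ha b hb hab => (hDc b hb).2 (hab ▸ ha)⟩
  have h1 := sum_map_le_sum_range (n := n) hn (fun x hx => by
    rcases List.mem_append.1 hx with hx | hx
    · exact (h.core x hx).lt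
    · exact (hDc x hx).1.lt) (R.deg false)
  rw [AdjArrays.sum_deg, List.map_append, List.sum_append] at h1
  have h2 := hD.length_le
  have h3 := coreCount_mono (R := R) (show r + 1 ≤ n from hc.lt)
  rw [coreCount_succ_of_core hc] at h3
  rw [h.length]
  omega

theorem length_seen (h : Hist1 R r l F) (hc : R.core r) :
    l.length + 1 ≤ edgeCount G + coreCount R n := by
  have h1 := sum_map_le_sum_range (n := n) h.nodup (fun x hx => (h.core x hx).lt) (R.deg false)
  rw [AdjArrays.sum_deg] at h1
  have h3 := coreCount_mono (R := R) (show r + 1 ≤ n from hc.lt)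
  rw [coreCount_succ_of_core hc] at h3
  rw [h.length]
  omega

theorem length_le (h : Hist1 R n l F) : l.length ≤ edgeCount G + coreCount R n := by
  have h1 := sum_map_le_sum_range (n := n) h.nodup (fun x hx => (h.core x hx).lt) (R.deg false)
  rw [AdjArrays.sum_deg] at h1
  rw [h.length]
  omega

end Hist1

/-- The capacities of the log and of the bit stack suffice. -/
structure Layout.Caps (L : Layout) (R : AdjArrays G) : Prop where
  log : edgeCount G + coreCount R n ≤ L.clog
  st : R.stTot false + R.stTot true ≤ L.cst

variable {S w : ℕ} {L : Layout} {s : NState 32}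
  {Q : ℕ → List OutSymbol → NState 32 → Prop} {log st : ℕ → ℕ}

/-- The variables that the passes over the vertices may change. -/
def passVars : List (Fin 32) :=
  [0, 1, 2, 3, 4, 5, 7, 8, 9, 10, 11, 12, 13, 14, 16, 20, 21, 22, 23]

theorem WP.logPass (vs es : Bool) (hL : L.Valid R S w) (hC : L.Caps R)
    (g : Good R S w L s (logCol R []) log st) (h6 : s.v 6 = 0) (h7 : s.v 7 = 0)
    (hQ : ∀ q s' l F log' st', Hist1 R n l F → Good R S w L s' (logCol R F) log' st' →
      LogRep log' l → s'.v 7 = l.length → Same passVars s s' →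
      q ≤ n + (F.map R.cost).sum → Q q [] s') : WP R S w (logPass vs es) s Q := by
  classical
  have hn := hL.n_lt
  have hw := hL.w_pos
  have hw0 : w ≠ 0 := by omega
  refine WP.forUp (fun r q o s' => o = [] ∧ Same passVars s s' ∧ ∃ l F log' st', Hist1 R r l F ∧
    Good R S w L s' (logCol R F) log' st' ∧ LogRep log' l ∧ s'.v 7 = l.length ∧
    q ≤ r + (F.map R.cost).sum) (by omega) ?_ ?_ ?_
  · refine ⟨rfl, fun y hy => ?_, [], [], log, st, .start, g.set (by decide) _,
      fun i hi => by simp at hi, by simpa [NState.set_v] using h7, by simp⟩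
    simp [passVars] at hy; simp [NState.set_v, hy]
  · rintro r q o s1 hr ⟨rfl, hs, l, F, log1, st1, hH, g1, hl, h71, hq⟩ h16
    have hsame : ∀ s2 : NState 32, Same passVars s1 s2 → Same passVars s (s2.set 16 (r + 1)) := by
      intro s2 f2 y hy
      have e1 := hs y hy
      have e2 := f2 y hy
      simp [passVars] at hy; simp [NState.set_v, hy, e1, e2]
    have hskip : ¬ R.core r → ∀ s2 : NState 32, s2.m = s1.m → Same [8, 12] s1 s2 →
        WP R S w .skip s2 fun q' o' s'' => s''.v 16 = r ∧ ([] ++ o' = [] ∧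
          Same passVars s (s''.set 16 (r + 1)) ∧ ∃ l F log' st', Hist1 R (r + 1) l F ∧
          Good R S w L (s''.set 16 (r + 1)) (logCol R F) log' st' ∧ LogRep log' l ∧
          (s''.set 16 (r + 1)).v 7 = l.length ∧ q + 1 + q' ≤ r + 1 + (F.map R.cost).sum) := by
      intro hc s2 m2 f2
      have g2 := g1.of_same (s' := s2) m2 fun x hx => f2 x (by
          simp; refine ⟨?_, ?_⟩ <;> rintro rfl <;> exact absurd hx (by decide))
      refine WP.skip ⟨by rw [f2 16 (by decide), h16], rfl, hsame _ fun y hy => f2 y ?_,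
        l, F, log1, st1, hH.triv hc, g2.set (by decide) _, hl, ?_, by omega⟩
      · simp [passVars] at hy; simp [hy]
      · simpa [NState.set_v, f2] using h71
    refine WP.byDegrees hn h16 hr ?_ ?_ ?_ ?_
    · intro hc s2 m2 f2
      have g2 := g1.of_same (s' := s2) m2 fun x hx => f2 x (by
          simp; refine ⟨?_, ?_⟩ <;> rintro rfl <;> exact absurd hx (by decide))
      have e16 : s2.v 16 = r := by rw [f2 16 (by decide), h16]
      refine WP.seq0 (WP.colGet hL g2 (by decide) (by decide) (by decide) (by decide)
        (by rw [e16]; exact hc.touched) fun s3 g3 h13 f3 => ⟨rfl, rfl, ?_⟩)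
      rw [e16] at h13
      have e16' : s3.v 16 = r := by rw [f3 16 (by decide), e16]
      have e7 : s3.v 7 = l.length := by rw [f3 7 (by decide), f2 7 (by decide), h71]
      have e6 : s3.v 6 = 0 := by rw [f3 6 (by decide), f2 6 (by decide), hs 6 (by decide), h6]
      have f3' : Same passVars s1 s3 := fun y hy => by
        simp [passVars] at hy; rw [f3 y (by simp [hy]), f2 y (by simp [hy])]
      refine WP.ite (by simp) (fun hb => ?_) fun hb => ?_
      · rw [Expr.val_var, h13] at hb
        have hrF : r ∈ F := by
          by_contra hrF; exact hb (logCol_eq_zero.2 ⟨hc, hrF⟩)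
        have hcap := hH.length_seen hc
        refine WP.logPush hL g3 (by norm_num) hl e7 (by have := hC.log; omega)
          fun s4 log4 g4 hl4 h74 f4 => ⟨by rw [f4 16 (by decide), e16'], rfl, hsame _ fun y hy => ?_,
            l ++ [0], F, log4, st1, hH.seen hc hrF, g4.set (by decide) _, hl4, ?_, by omega⟩
        · have := f3' y hy
          simp [passVars] at hy; rw [f4 y (by simp [hy]), this]
        · simpa [NState.set_v] using h74
      · rw [Expr.val_var, h13] at hb
        have hrF := (logCol_eq_zero.1 hb).2
        refine WP.seq0 (WP.colPut hL g3 (by decide) (by decide)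
          (by rw [e16']; exact hc.touched) (by norm_num) fun s4 g4 f4 => ⟨rfl, rfl, ?_⟩)
        rw [e16'] at g4
        refine WP.seq_assign (by simp) ?_
        have e16'' : s4.v 16 = r := by rw [f4 16 (by decide), e16']
        simp only [Expr.val_var, e16'']
        let P : DfsPar := ⟨vs, es, false, 0, 1, true, false, r, 0, logCol R F, st1, l⟩
        have hok : ∀ x, 0 < R.deg (!false) x → logCol R F x = 0 → R.core x :=
          fun x _ h => (logCol_eq_zero.1 h).1
        have hP : P.Valid R S w L := by
          refine ⟨hL, by simp [P], by simp [P], by simp [P], hb, hc.touched, by simp [P], ?_, ?_⟩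
          · intro v i p D l' f h
            have h1 := AdjArrays.pathBits_le hc hok h
            have := hC.st
            simp only [P, zero_add] at h1 ⊢
            rw [Bool.not_false] at h1
            omega
          · intro _ v i p D l' f h
            have := hH.length_run hc hrF h
            have := hC.log
            simp only [P]; omega
        refine WP.dfs (P := P) hP (g4.set (by decide) _) (by simp [P])
          (by simpa [P, NState.set_v, f4] using e6) (by simpa [P, NState.set_v, f4] using e7) hl
          fun q' s5 D l' f log5 st5 hD g5 _ hl5 h75 f5 hq5 => ?_
        have hp : D.Perm (f ++ [r]) := hD.perm
        have hcol : recolor P.b P.col D = logCol R (F ++ (f ++ [r])) := recolor_logCol hp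
        rw [hcol] at g5
        refine ⟨?_, rfl, hsame _ fun y hy => ?_, l ++ (l' ++ [1]), F ++ (f ++ [r]), log5, st5,
          hH.run hc hrF hD, g5.set (by decide) _, hl5, ?_, ?_⟩
        · rw [f5 16 (by decide)]; simp [NState.set_v, e16'']
        · have := f3' y hy
          simp [passVars] at hy
          rw [f5 y (by simp [dfsVars', hy])]; simp [NState.set_v, hy, f4, this]
        · simpa [NState.set_v, P, addLog] using h75
        · rw [(hp.map R.cost).sum_eq] at hq5
          rw [List.map_append, List.sum_append]
          omega
    · exact fun h1 h2 => hskip fun h => by have := h.2; omega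
    · exact fun h1 h2 => hskip fun h => by have := h.1; omega
    · exact fun h1 h2 => hskip fun h => by have := h.1; omega
  · rintro q o s' ⟨rfl, hs, l, F, log', st', hH, g', hl, h7', hq⟩
    exact hQ q s' l F log' st' hH g' hl h7' hs hq

theorem WP.recolorPass {col : ℕ → ℕ} {A : List ℕ} (hA : ∀ x < n, x ∈ A ↔ ¬ R.core x)
    (hL : L.Valid R S w) (g : Good R S w L s col log st)
    (hQ : ∀ s', Good R S w L s' (doneCol R A) log st → Same [0, 1, 2, 8, 12, 16] s s' →
      Q n [] s') : WP R S w recolorPass s Q := by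
  have hn := hL.n_lt
  have hw := hL.w_pos
  have hw0 : w ≠ 0 := by omega
  refine WP.forUp (fun r q o s' => o = [] ∧ q = r ∧ Same [0, 1, 2, 8, 12, 16] s s' ∧
    Good R S w L s' (fun x => if x < r then doneCol R A x else col x) log st) (by omega) ?_ ?_ ?_
  · refine ⟨rfl, rfl, fun y hy => ?_, by simpa using g.set (by decide) _⟩
    simp at hy; simp [NState.set_v, hy]
  · rintro r q o s1 hr ⟨rfl, rfl, hs, g1⟩ h16
    have hput : ∀ e, R.touched q → doneCol R A q = e → e < 3 → ∀ s2 : NState 32, s2.m = s1.m →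
        Same [8, 12] s1 s2 → WP R S w (_root_.colPut 16 (.const e)) s2 fun q' o' s'' =>
          s''.v 16 = q ∧ [] ++ o' = [] ∧ q + 1 + q' = q + 1 ∧
          Same [0, 1, 2, 8, 12, 16] s (s''.set 16 (q + 1)) ∧
          Good R S w L (s''.set 16 (q + 1))
            (fun x => if x < q + 1 then doneCol R A x else col x) log st := by
      intro e ht he he3 s2 m2 f2
      have g2 := g1.of_same (s' := s2) m2 fun x hx => f2 x (by
          simp; refine ⟨?_, ?_⟩ <;> rintro rfl <;> exact absurd hx (by decide))
      have e16 : s2.v 16 = q := by rw [f2 16 (by decide), h16]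
      refine WP.colPut hL g2 (by decide) (by decide) (by rw [e16]; exact ht) he3
        fun s3 g3 f3 => ⟨by rw [f3 16 (by decide), e16], rfl, rfl, fun y hy => ?_, ?_⟩
      · have := hs y hy
        simp at hy; simp [NState.set_v, hy, f3, f2, this]
      · refine (g3.set (by decide) _).congr fun x _ => ?_
        rw [e16]
        by_cases hx : x = q
        · subst hx; simp [he]
        · simp only [Function.update_of_ne hx]
          congr 1; simp; omega
    refine WP.byDegrees hn h16 hr (fun hc => hput 0 hc.touched ?_ (by norm_num))
      (fun h1 h2 => hput 2 (.inl h1) ?_ (by norm_num))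
      (fun h1 h2 => hput 0 (.inr h2) ?_ (by norm_num)) fun h1 h2 s2 m2 f2 => ?_
    · exact doneCol_eq_zero.2 fun _ => by rw [hA q hr]; exact not_not.2 hc
    · have : q ∈ A := (hA q hr).2 fun h => by have := h.2; omega
      simp [doneCol, h1, this]
    · simp [doneCol, h1]
    · have ht : ¬ R.touched q := by rintro (h | h) <;> omega
      have g2 := g1.of_same (s' := s2) m2 fun x hx => f2 x (by
          simp; refine ⟨?_, ?_⟩ <;> rintro rfl <;> exact absurd hx (by decide))
      refine WP.skip ⟨by rw [f2 16 (by decide), h16], rfl, rfl, fun y hy => ?_,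
        (g2.set (by decide) _).congr fun x hx => ?_⟩
      · have := hs y hy
        simp at hy; simp [NState.set_v, hy, f2, this]
      · have : x ≠ q := by rintro rfl; exact ht hx
        congr 1; simp; omega
  · rintro q o s' ⟨rfl, rfl, hs, g'⟩
    exact hQ s' (g'.congr fun x hx => if_pos hx.lt) hs

end

/-! ### The second phase -/

/-- Unless the vertex in variable `17` has been output, finds its component by a backward search among
the vertices of color `0`, and outputs the component in the course of a second search. -/
def visit (vs es : Bool) : Cmd 32 :=
  colGet 13 17 ;;
  .ite (13 : Fin 32) .skip
    (sepCmd ;;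
      colPut 17 (.const 1) ;; .assign 5 (17 : Fin 32) ;; dfs vs es true 0 1 false false ;;
      colPut 17 (.const 2) ;; .assign 5 (17 : Fin 32) ;; dfs vs es true 1 2 false true)

/-- Undoes one step of a depth-first search from the vertex in variable `16`, by means of the log.  The
current vertex and the position in its out-array are in the variables `17` and `18`.  Vertices are
visited in the reverse of the order in which they were finished. -/
def undoStep (vs es : Bool) : Cmd 32 :=
  .ite (18 : Fin 32)
    (.assign 18 (((18 : Fin 32) : Expr 32) - .const 1) ;; logPop ;;
      .ite (13 : Fin 32)
        (.query 8 (.head false) (17 : Fin 32) (18 : Fin 32) ;;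
          .query 9 (.mate false) (17 : Fin 32) (18 : Fin 32) ;;
          .query 12 (.deg true) (8 : Fin 32) (.const 0) ;;
          cmdBits ;; cmdPush ;;
          .assign 17 (8 : Fin 32) ;; .query 18 (.deg false) (17 : Fin 32) (.const 0) ;;
          visit vs es)
        .skip)
    (.ite (.op .eq (17 : Fin 32) (16 : Fin 32))
      (.assign 19 (.const 0))
      (.query 12 (.deg true) (17 : Fin 32) (.const 0) ;;
        cmdBits ;; cmdPop ;;
        .query 18 (.mate true) (17 : Fin 32) (9 : Fin 32) ;;
        .query 17 (.head true) (17 : Fin 32) (9 : Fin 32)))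

/-- Undoes the first phase and outputs the nontrivial components. -/
def undoPass (vs es : Bool) : Cmd 32 :=
  .assign 16 Expr.numVertices ;;
  .loop (16 : Fin 32)
    (.assign 16 (((16 : Fin 32) : Expr 32) - .const 1) ;;
      byDegrees
        (logPop ;;
          .ite (13 : Fin 32)
            (.assign 17 (16 : Fin 32) ;; .query 18 (.deg false) (17 : Fin 32) (.const 0) ;;
              .assign 19 (.const 1) ;; visit vs es ;; .loop (19 : Fin 32) (undoStep vs es))
            .skip)
        .skip .skip .skip)

section

variable {n : ℕ} {G : Digraph (Fin n)} (R : AdjArrays G)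

/-- The components in the list `C` have been output, and the vertices in `F` may still have to be
considered. -/
structure CInv (C : List (List ℕ)) (F : List ℕ) : Prop where
  inv : KInv R C.flatten F
  nodup : C.flatten.Nodup
  comp : ∀ D ∈ C, R.IsComp D

/-- The state represents a situation of the second phase in which the components in `C` have been
output and the log `l` remains. -/
structure Undo (S w : ℕ) (L : Layout) (C : List (List ℕ)) (l : List ℕ) (st : ℕ → ℕ)
    (s : NState 32) : Prop where
  good : ∃ log, Good R S w L s (doneCol R C.flatten) log st ∧ LogRep log l
  v7 : s.v 7 = l.length
  v15 : s.v 15 = if C = [] then 1 else 0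

/-- The work accounted for by the components in `C`. -/
def compCost (C : List (List ℕ)) : ℕ := 2 * (C.flatten.map R.cost).sum

variable {R} {S w : ℕ} {L : Layout} {s : NState 32} {C : List (List ℕ)} {F l : List ℕ} {st : ℕ → ℕ}
  {Q : ℕ → List OutSymbol → NState 32 → Prop} {v base : ℕ}

theorem KInv.congr {A A' : List ℕ} (h : KInv R A F) (hA : ∀ x, x ∈ A ↔ x ∈ A') : KInv R A' F :=
  ⟨fun x hx hc => (hA x).1 (h.triv x hx hc),
    fun u x h1 h2 h3 => (hA u).1 (h.pred u x h1 h2 ((hA x).2 h3)),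
    fun x hx => (h.cover x hx).imp_right (hA x).1⟩

/-- The variables that `visit` may change. -/
def visitVars : List (Fin 32) :=
  [0, 1, 2, 3, 4, 5, 7, 8, 9, 10, 11, 12, 13, 14, 15, 20, 21, 22, 23]

theorem WP.visit (vs es : Bool) (hL : L.Valid R S w) (hC : L.Caps R)
    (hU : Undo R S w L C l st s) (hI : CInv R C (F ++ [v])) (hv : R.core v) (h17 : s.v 17 = v)
    (h6 : s.v 6 = base) (hb : base ≤ R.stTot true)
    (hF : FinProp (R.deg false) (R.head false) (· ∈ F) v)
    (hQ : ∀ q o s' C' st', Undo R S w L C' l st' s' → CInv R C' F →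
      (∀ x < base, st' x = st x) → outOf R vs es C ++ o = outOf R vs es C' →
      Same visitVars s s' → q + compCost R C ≤ compCost R C' → Q q o s') :
    WP R S w (visit vs es) s Q := by
  obtain ⟨⟨log, g, hl⟩, h7, h15⟩ := hU
  have hw := hL.w_pos
  have hw0 : w ≠ 0 := by omega
  refine WP.seq0 (WP.colGet hL g (by decide) (by decide) (by decide) (by decide)
    (by rw [h17]; exact hv.touched) fun s1 g1 h13 f1 => ⟨rfl, rfl, ?_⟩)
  rw [h17] at h13
  refine WP.ite (by simp) (fun hb0 => ?_) fun hb0 => ?_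
  · rw [Expr.val_var, h13] at hb0
    have hvA : v ∈ C.flatten := by
      by_contra hvA; exact hb0 (doneCol_eq_zero.2 fun _ => hvA)
    refine WP.skip (hQ 0 [] s1 C st ⟨⟨log, g1, hl⟩, by rw [f1 7 (by decide), h7],
      by rw [f1 15 (by decide), h15]⟩ ⟨hI.inv.skip hvA, hI.nodup, hI.comp⟩ (fun _ _ => rfl)
      (by simp) (fun y hy => f1 y ?_) (by omega))
    simp [visitVars] at hy; simp [hy]
  · rw [Expr.val_var, h13] at hb0
    have hvA : v ∉ C.flatten := doneCol_eq_zero.1 hb0 hv.1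
    refine WP.seq (WP.sepCmd (b := C = []) (by rw [f1 15 (by decide), h15]) fun s2 m2 h152 f2 => ?_)
    have g2 := g1.of_same (s' := s2) m2 fun x hx => f2 x (by
      simp; rintro rfl; exact absurd hx (by decide))
    have e17 : s2.v 17 = v := by rw [f2 17 (by decide), f1 17 (by decide), h17]
    refine WP.seq0 (WP.colPut hL g2 (by decide) (by decide) (by rw [e17]; exact hv.touched)
      (by norm_num) fun s3 g3 f3 => ⟨rfl, rfl, ?_⟩)
    rw [e17] at g3
    have e17' : s3.v 17 = v := by rw [f3 17 (by decide), e17]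
    have f3' : Same visitVars s s3 := fun y hy => by
      simp [visitVars] at hy
      rw [f3 y (by simp [hy]), f2 y (by simp [hy]), f1 y (by simp [hy])]
    have e6 : s3.v 6 = base := by rw [f3' 6 (by decide), h6]
    have e7 : s3.v 7 = l.length := by
      rw [f3 7 (by decide), f2 7 (by decide), f1 7 (by decide), h7]
    have e15 : s3.v 15 = 0 := by rw [f3 15 (by decide), h152]
    refine WP.seq_assign (by simp) ?_
    simp only [Expr.val_var, e17']
    let P : DfsPar := ⟨vs, es, true, 0, 1, false, false, v, base, doneCol R C.flatten, st, l⟩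
    have hP : P.Valid R S w L := by
      refine ⟨hL, by simp [P], by simp [P], by simp [P], hb0, hv.touched, by simp [P],
        fun {v i p D l f} h => ?_, by simp [P]⟩
      have h1 := AdjArrays.pathBits_le (dir := true) hv (fun x hx h0 => hI.inv.core_of hx h0) h
      have := hC.st
      simp only [P] at h1 ⊢
      rw [Bool.not_true] at h1
      omega
    refine WP.seq (WP.dfs (P := P) hP (g3.set (by decide) _) (by simp [P])
      (by simpa [P, NState.set_v] using e6) (by simpa [P, NState.set_v] using e7) hl
      fun q1 s4 D l1 fD log4 st4 hD g4 hst4 hl4 h74 f4 hq1 => ?_)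
    have e17'' : s4.v 17 = v := by rw [f4 17 (by decide)]; simp [NState.set_v, e17']
    have hDcore : ∀ x ∈ D, R.core x ∧ x ∉ C.flatten := by
      intro x hx
      have hc := AdjArrays.core_of_hist (dir := true) hv (fun x hx h0 => hI.inv.core_of hx h0) hD hx
      exact ⟨hc, doneCol_eq_zero.1 (Hist.ok_of_mem (ok := fun x => doneCol R C.flatten x = 0)
        hb0 hD hx) hc.1⟩
    refine WP.seq0 (WP.colPut hL g4 (by decide) (by decide) (by rw [e17'']; exact hv.touched)
      (by norm_num) fun s5 g5 f5 => ⟨rfl, rfl, ?_⟩)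
    rw [e17''] at g5
    have e17''' : s5.v 17 = v := by rw [f5 17 (by decide), e17'']
    have f5' : Same visitVars s s5 := fun y hy => by
      have := f3' y hy
      simp [visitVars] at hy
      rw [f5 y (by simp [hy]), f4 y (by simp [dfsVars', hy])]; simp [NState.set_v, hy, this]
    refine WP.seq_assign (by simp) ?_
    simp only [Expr.val_var, e17''']
    let P' : DfsPar := ⟨vs, es, true, 1, 2, false, true, v, base,
      recolor 1 (doneCol R C.flatten) D, st4, l⟩
    have hl4' : LogRep log4 l := by simpa [P, addLog] using hl4
    have h74' : s4.v 7 = l.length := by simpa [P, addLog] using h74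
    have hvD : v ∈ D := hD.root_mem
    have hP' : P'.Valid R S w L := by
      refine ⟨hL, by simp [P'], by simp [P'], by simp [P'], recolor_one_iff.2 hvD, hv.touched,
        by simp [P'], fun {v i p D l f} h => ?_, by simp [P']⟩
      have h1 := AdjArrays.pathBits_le (dir := true) hv
        (fun x _ h0 => (hDcore x (recolor_one_iff.1 h0)).1) h
      have := hC.st
      simp only [P'] at h1 ⊢
      rw [Bool.not_true] at h1
      omega
    refine WP.dfs (P := P') hP' (g5.set (by decide) _) (by simp [P'])
      (by simp only [P', NState.set_v]; rw [if_neg (by decide), f5' 6 (by decide), h6])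
      (by simp only [P', NState.set_v]; rw [if_neg (by decide), f5 7 (by decide), h74']) hl4'
      fun q2 s6 D' l2 fD' log6 st6 hD' g6 hst6 hl6 h76 f6 hq2 => ?_
    have hm := mem_second_search hD hD'
    have hperm : D.Perm D' := (List.perm_ext_iff_of_nodup hD.nodup hD'.nodup).2 fun x => (hm x).symm
    have hstep := (hI.inv.step hv hvA hD).congr (A' := (C ++ [D']).flatten) fun x => by simp [hm x]
    have hcomp : R.IsComp D' := ⟨hD'.nodup, v, hv.lt, fun x => by
      rw [hm]; exact hI.inv.mem_iff hv hvA hF hD x⟩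
    have hblock := flatten_emission_eq_blockOf (vs := vs) (es := es) hI.inv
      (fun x hx => (hDcore x hx).2) hm
    have hnd : (C ++ [D']).flatten.Nodup := by
      rw [List.flatten_append, List.nodup_append]
      refine ⟨hI.nodup, by simpa using hD'.nodup, fun a ha b hb' hab => ?_⟩
      have : b ∈ D' := by simpa using hb'
      exact (hDcore b ((hm b).1 this)).2 (hab ▸ ha)
    have hout : P'.out R D' = blockOf R vs es D' := by simpa [DfsPar.out, P'] using hblock
    have hout0 : P.out R D = [] := by simp [DfsPar.out, P]
    rw [hout, hout0]
    refine hQ _ _ s6 (C ++ [D']) st6 ⟨⟨log6, g6.congr fun x _ => ?_, ?_⟩, ?_, ?_⟩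
      ⟨hstep, hnd, fun E hE => ?_⟩ (fun x hx => ?_) ?_ (fun y hy => ?_) ?_
    · simp only [P', recolor, doneCol, hm x]
      by_cases hx : x ∈ D
      · simp [hx, hm x, (hDcore x hx).1.1]
      · simp [hx, hm x]
    · simpa [P', addLog] using hl6
    · simpa [P', addLog] using h76
    · rw [f6 15 (by decide)]
      simp only [NState.set_v]
      rw [if_neg (by decide), f5 15 (by decide), f4 15 (by decide)]
      simp [NState.set_v, e15]
    · rcases List.mem_append.1 hE with hE | hE
      · exact hI.comp E hE
      · simp at hE; exact hE ▸ hcomp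
    · rw [hst6 x hx]; exact hst4 x hx
    · rw [outOf_concat]; simp
    · have := f5' y hy
      simp [visitVars] at hy
      rw [f6 y (by simp [dfsVars', hy])]; simp [NState.set_v, hy, this]
    · rw [(hperm.map R.cost).sum_eq] at hq1
      simp only [compCost, List.flatten_append, List.map_append, List.sum_append,
        List.flatten_singleton]
      omega

/-- The parameters of a search of the first phase. -/
noncomputable def logPar (R : AdjArrays G) (F : List ℕ) (r : ℕ) : DfsPar :=
  ⟨false, false, false, 0, 1, true, false, r, 0, logCol R F, fun _ => 0, []⟩

/-- Undoing a search: `visit` is applied to the vertices finished by the search, the last one first, so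
that `F₀ ++ f` shrinks to `F₀`.  The backward searches use the part of the stack above the path, and the
stack represents the path in the same way as in the search that is undone. -/
theorem WP.undoLoop (vs es : Bool) (hL : L.Valid R S w) (hC : L.Caps R) {r i : ℕ}
    {p : List (ℕ × ℕ)} {D l₀ f : List ℕ} {F₀ : List ℕ} (hr : R.core r) (hrF : r ∉ F)
    (hH : (logPar R F r).H R v i p D l f)
    (hcap : (l₀ ++ l).length ≤ L.clog) (hFo : FinOrder (R.deg false) (R.head false) (F₀ ++ f))
    (hI : CInv R C (F₀ ++ f)) (hU : Undo R S w L C (l₀ ++ l) st s)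
    (hst : StkRep R false st 0 v p) (h6 : s.v 6 = pathBits R false v p) (h16 : s.v 16 = r)
    (h17 : s.v 17 = v) (h18 : s.v 18 = i) (h19 : s.v 19 = 1)
    (hQ : ∀ q o s' C' st', Undo R S w L C' l₀ st' s' → CInv R C' F₀ →
      outOf R vs es C ++ o = outOf R vs es C' → s'.v 16 = r → s'.v 6 = 0 →
      q + compCost R C ≤ compCost R C' + (logPar R F r).spent R D l f → Q q o s') :
    WP R S w (.loop (19 : Fin 32) (undoStep vs es)) s Q := by
  have hn := hL.n_lt
  have hw := hL.w_pos
  have hw0 : w ≠ 0 := by omega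
  have hdeg : ∀ d x, R.deg d x ≤ n := fun d x => AdjArrays.deg_le
  have hr0 : logCol R F r = 0 := logCol_eq_zero.2 ⟨hr, hrF⟩
  have hcore : ∀ {v i p D l f}, (logPar R F r).H R v i p D l f → ∀ x ∈ D, R.core x := by
    intro v i p D l f h x hx
    exact (logCol_eq_zero.1 (Hist.ok_of_mem (ok := fun x => logCol R F x = 0) hr0 h hx)).1
  have hpb : ∀ {v i p D l f}, (logPar R F r).H R v i p D l f →
      pathBits R false v p ≤ R.stTot true := by
    intro v i p D l f h
    exact AdjArrays.pathBits_le hr (fun x _ h => (logCol_eq_zero.1 h).1) h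
  have hcst := hC.st
  have hbits : ∀ x, Nat.clog 2 (R.deg true x) < w := by
    intro x
    have hn1 : n ≤ 2 ^ (w - 1) := by
      have : 2 ^ w = 2 * 2 ^ (w - 1) := by rw [← pow_succ']; congr 1; omega
      omega
    refine lt_of_le_of_lt (Nat.clog_mono_right 2 ((hdeg _ x).trans hn1)) ?_
    rw [Nat.clog_pow _ _ (by norm_num)]; omega
  induction hH generalizing C s st Q with
  | start =>
    -- at the first edge of the root, the search has been undone
    refine WP.loop_true (by simp) (by simp [h19]) ?_
    refine WP.ite (by simp) (fun hb => absurd h18 hb) fun _ => ?_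
    refine WP.ite (by simp) (fun _ => ?_) fun hb => ?_
    · refine WP.assign (by simp) (WP.loop_false (by simp) (by simp) ?_)
      obtain ⟨⟨log, g, hl⟩, h7, h15⟩ := hU
      rw [List.append_nil] at hl h7 hI
      refine hQ _ _ _ C st ⟨⟨log, g.set (by decide) _, hl⟩, by simpa [NState.set_v] using h7,
        by simpa [NState.set_v] using h15⟩ hI (by simp) (by simpa [NState.set_v] using h16)
        (by simpa [NState.set_v, pathBits] using h6) ?_
      simp [DfsPar.spent]; omega
    · simp [h16, h17, logPar] at hb
  | @skip v i p D l f h hi hh ih =>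
    -- the last log entry `0` stands for an edge that was not followed
    have hi : i < R.deg false v := hi
    have hvn := AdjArrays.lt_of_lt_deg hi
    have hdv := hdeg false v
    refine WP.loop_true (by simp) (by simp [h19]) ?_
    refine WP.ite (by simp) (fun _ => ?_) fun hb => absurd hb (by simp [h18])
    refine WP.seq_assign (by simp [h18]; omega) ?_
    obtain ⟨⟨log, g, hl⟩, h7, h15⟩ := hU
    rw [← List.append_assoc] at hl h7 hcap
    refine WP.seq0 (WP.logPop hL (g.set (by decide) _) hl (by simpa [NState.set_v] using h7)
      hcap fun s1 g1 hl1 h71 h13 f1 => ⟨rfl, rfl, ?_⟩)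
    refine WP.ite (by simp) (fun hb => absurd h13 hb) fun _ => WP.skip ?_
    refine ih (s := s1) (by simp at hcap ⊢; omega) hFo hI ⟨⟨log, g1, hl1⟩, h71, ?_⟩ hst
      ?_ ?_ ?_ ?_ ?_ ?_
    · rw [f1 15 (by decide)]; simp [NState.set_v, h15]
    · rw [f1 6 (by decide)]; simp [NState.set_v, h6]
    · rw [f1 16 (by decide)]; simp [NState.set_v, h16]
    · rw [f1 17 (by decide)]; simp [NState.set_v, h17]
    · rw [f1 18 (by decide)]; simp [h18]
    · rw [f1 19 (by decide)]; simp [NState.set_v, h19]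
    · intro q o s' C' st' a1 a2 a3 a4 a5 a6
      refine hQ _ _ s' C' st' a1 a2 (by simpa using a3) a4 a5 ?_
      rw [DfsPar.spent_skip]; omega
  | @down v i p D l f h hi hD hok ih =>
    -- at the first edge of another vertex, the tree edge to it is removed from the path
    have hi : i < R.deg false v := hi
    have hvn := AdjArrays.lt_of_lt_deg hi
    have hyn := AdjArrays.head_lt hi
    have hyr : R.head false v i ≠ r := fun he => hD (by
      show R.head false v i ∈ D
      rw [he]; exact h.root_mem)
    change StkRep R false st 0 (R.head false v i) ((v, i) :: p) at hst
    change s.v 6 = pathBits R false (R.head false v i) ((v, i) :: p) at h6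
    change s.v 17 = R.head false v i at h17
    have hpb' : pathBits R false (R.head false v i) ((v, i) :: p) ≤ R.stTot true :=
      hpb (h.down hi hD hok)
    have hm : R.mate false v i < R.deg true (R.head false v i) := AdjArrays.mate_lt hi
    have q1 : R.head true (R.head false v i) (R.mate false v i) = v := AdjArrays.head_mate hi
    have q2 : R.mate true (R.head false v i) (R.mate false v i) = i := AdjArrays.mate_mate hi
    have hQ' : ∀ q o s' C' st', Undo R S w L C' l₀ st' s' → CInv R C' F₀ →
      outOf R vs es C ++ o = outOf R vs es C' → s'.v 16 = r → s'.v 6 = 0 →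
      q + compCost R C ≤ compCost R C' +
        (logPar R F r).spent R (D ++ [R.head false v i]) l f → Q q o s' := hQ
    generalize R.head false v i = y at *
    refine WP.loop_true (by simp) (by simp [h19]) ?_
    refine WP.ite (by simp) (fun hb => absurd h18 hb) fun _ => ?_
    refine WP.ite (by simp) (fun hb => ?_) fun _ => ?_
    · simp [h16, h17, hyr] at hb
    obtain ⟨⟨log, g, hl⟩, h7, h15⟩ := hU
    have hdy := hdeg true y
    refine WP.seq_query (R.deg true y) (by simp) (by simp)
      (by simpa [h17] using AdjArrays.answer_deg hyn) (by omega) ?_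
    refine WP.seq (WP.cmdBits (d := R.deg true y) (by simp) (by omega) fun s2 m2 h10 f2 => ?_)
    have g2 : Good R S w L s2 (doneCol R C.flatten) log st :=
      (g.set (by decide) _).of_same m2 fun x hx => f2 x (by
        simp; constructor <;> rintro rfl <;> exact absurd hx (by decide))
    have f2' : Same [12, 10, 11] s s2 := fun y hy => by
      simp at hy; rw [f2 y (by simp [hy])]; simp [NState.set_v, hy]
    clear f2
    simp only [pathBits, stBits, Bool.not_false] at hpb' h6
    refine WP.seq (WP.cmdPop hL (p := pathBits R false v p) g2 h10 (hbits y)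
      (by rw [f2' 6 (by decide), h6]) (by omega) fun s3 g3 h63 h93 f3 => ?_)
    have h93' : s3.v 9 = R.mate false v i := by
      rw [h93]; simpa [StkRep, stBits] using hst.2
    have e17 : s3.v 17 = y := by rw [f3 17 (by decide), f2' 17 (by decide), h17]
    have hvd := hdeg false v
    refine WP.seq_query i (by simp) (by simp)
      (by simpa [e17, h93', q2] using AdjArrays.answer_mate hm) (by omega) ?_
    refine WP.query v (by simp) (by simp)
      (by simpa [NState.set_v, e17, h93', q1] using AdjArrays.answer_head hm) (by omega) ?_
    refine ih hcap hFo hI ⟨⟨log, (g3.set (by decide) _).set (by decide) _, hl⟩, ?_, ?_⟩ hst.1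
      ?_ ?_ ?_ ?_ ?_ ?_
    · simp [NState.set_v, f3, f2', h7]
    · simp [NState.set_v, f3, f2', h15]
    · simpa [NState.set_v] using h63
    · simp [NState.set_v, f3, f2', h16]
    · simp
    · simp [NState.set_v]
    · simp [NState.set_v, f3, f2', h19]
    · intro q o s' C' st' a1 a2 a3 a4 a5 a6
      refine hQ' _ _ s' C' st' a1 a2 (by simpa using a3) a4 a5 ?_
      simp [DfsPar.spent, logPar, stBits] at a6 ⊢; omega
  | @up v u j p D l f h ih =>
    -- the last log entry `1` stands for a tree edge, whose head `v` is the last vertex finished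
    obtain ⟨hj, hhead, hpath⟩ := h.isPath
    have hj : j < R.deg false u := hj
    have hhead : R.head false u j = v := hhead
    have hun := AdjArrays.lt_of_lt_deg hj
    have hdu := hdeg false u
    have hm : R.mate false u j < R.deg true v := hhead ▸ AdjArrays.mate_lt hj
    have hvc : R.core v := hcore h v (h.mem_iff.2 (.inr (.inl rfl)))
    have hvn := hvc.lt
    have hdv := hdeg true v
    have hdv' := hdeg false v
    have hpb' := hpb h
    simp only [pathBits, stBits, Bool.not_false] at hpb'
    refine WP.loop_true (by simp) (by simp [h19]) ?_
    refine WP.ite (by simp) (fun _ => ?_) fun hb => absurd hb (by simp [h18])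
    refine WP.seq_assign (by simp [h18]; omega) ?_
    obtain ⟨⟨log, g, hl⟩, h7, h15⟩ := hU
    rw [← List.append_assoc] at hl h7 hcap hI hFo
    refine WP.seq0 (WP.logPop hL (g.set (by decide) _) hl (by simpa [NState.set_v] using h7)
      hcap fun s1 g1 hl1 h71 h13 f1 => ⟨rfl, rfl, ?_⟩)
    refine WP.ite (by simp) (fun _ => ?_) fun hb => by rw [Expr.val_var, h13] at hb; simp at hb
    have f1' : Same [0, 7, 13, 18] s s1 := fun y hy => by
      simp at hy; rw [f1 y (by simp [hy])]; simp [NState.set_v, hy]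
    have e18 : s1.v 18 = j := by rw [f1 18 (by decide)]; simp [h18]
    clear f1
    have e17 : s1.v 17 = u := by rw [f1' 17 (by decide), h17]
    refine WP.seq_query v (by simp) (by simp)
      (by simpa [e17, e18, hhead] using AdjArrays.answer_head hj) (by omega) ?_
    refine WP.seq_query (R.mate false u j) (by simp) (by simp)
      (by simpa [NState.set_v, e17, e18] using AdjArrays.answer_mate hj) (by omega) ?_
    refine WP.seq_query (R.deg true v) (by simp) (by simp)
      (by simpa [NState.set_v] using AdjArrays.answer_deg hvn) (by omega) ?_
    refine WP.seq (WP.cmdBits (d := R.deg true v) (by simp) (by omega) fun s2 m2 h10 f2 => ?_)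
    have g2 : Good R S w L s2 (doneCol R C.flatten) log st :=
      (((g1.set (by decide) _).set (by decide) _).set (by decide) _).of_same m2 fun x hx => f2 x (by
        simp; constructor <;> rintro rfl <;> exact absurd hx (by decide))
    have f2' : Same [8, 9, 12, 10, 11] s1 s2 := fun y hy => by
      simp at hy; rw [f2 y (by simp [hy])]; simp [NState.set_v, hy]
    have k8 : s2.v 8 = v := by rw [f2 8 (by decide)]; simp [NState.set_v]
    have k9 : s2.v 9 = R.mate false u j := by rw [f2 9 (by decide)]; simp [NState.set_v]
    clear f2
    have e6 : s2.v 6 = pathBits R false u p := by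
      rw [f2' 6 (by decide), f1' 6 (by decide), h6]
    refine WP.seq (WP.cmdPush hL g2 h10 (by rw [e6]; omega)
      fun s3 st3 g3 h63 hst3 hfl f3 => ?_)
    have e8 : s3.v 8 = v := by rw [f3 8 (by decide), k8]
    refine WP.seq_assign (by simp) ?_
    simp only [Expr.val_var, e8]
    refine WP.seq_query (R.deg false v) (by simp) (by simp)
      (by simpa using AdjArrays.answer_deg hvn) (by omega) ?_
    have hstk : StkRep R false st3 0 v ((u, j) :: p) := by
      refine ⟨hst.congr fun x _ hx' => hst3 x (by omega), ?_⟩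
      rw [zero_add, ← e6, stBits, Bool.not_false, hfl, k9]
      refine Nat.mod_eq_of_lt (hm.trans_le ?_)
      exact (Nat.clog_le_iff_le_pow (by norm_num)).1 le_rfl
    have e6' : s3.v 6 = pathBits R false v ((u, j) :: p) := by
      rw [h63, e6, pathBits, stBits, Bool.not_false]
    have hFp : FinProp (R.deg false) (R.head false) (· ∈ F₀ ++ f) v := hFo _ v [] (by simp)
    have f3' : Same [0, 7, 13, 18, 8, 9, 12, 10, 11, 1, 6] s s3 := fun y hy => by
      simp at hy; rw [f3 y (by simp [hy]), f2' y (by simp [hy]), f1' y (by simp [hy])]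
    have h73 : s3.v 7 = (l₀ ++ l).length := by rw [f3 7 (by decide), f2' 7 (by decide), h71]
    refine WP.visit (base := pathBits R false v ((u, j) :: p)) vs es hL hC (l := l₀ ++ l)
      ⟨⟨log, (g3.set (by decide) _).set (by decide) _, hl1⟩, by simpa [NState.set_v] using h73, ?_⟩
      hI hvc (by simp [NState.set_v]) (by simpa [NState.set_v] using e6')
      (hpb h) hFp fun q o s4 C' st4 hU' hI' hst4 ho f4 hq => ?_
    · simp [NState.set_v, f3', h15]
    refine ih (s := s4) (by simp at hcap ⊢; omega) (fun f₁ x f₂ he => hFo f₁ x (f₂ ++ [v])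
      (by rw [he]; simp)) hI' hU' (hstk.congr fun x _ hx => hst4 x (by simpa using hx)) ?_ ?_ ?_ ?_ ?_ ?_
    · rw [f4 6 (by decide)]; simpa [NState.set_v] using e6'
    · rw [f4 16 (by decide)]; simp [NState.set_v, f3', h16]
    · rw [f4 17 (by decide)]; simp [NState.set_v]
    · rw [f4 18 (by decide)]; simp [logPar]
    · rw [f4 19 (by decide)]; simp [NState.set_v, f3', h19]
    · intro q' o' s' C'' st' a1 a2 a3 a4 a5 a6
      refine hQ _ _ s' C'' st' a1 a2 (by simpa [← ho] using a3) a4 a5 ?_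
      simp [DfsPar.spent, logPar, stBits] at a6 ⊢; omega

end

section

variable {n : ℕ} {G : Digraph (Fin n)} {R : AdjArrays G} {S w : ℕ} {L : Layout} {s : NState 32}
  {C : List (List ℕ)} {F l : List ℕ} {st : ℕ → ℕ} {Q : ℕ → List OutSymbol → NState 32 → Prop}

theorem Undo.of_same {s' : NState 32} (h : Undo R S w L C l st s) (hm : s'.m = s.m)
    (hv : ∀ x : Fin 32, x = 7 ∨ x = 15 ∨ 24 ≤ x → s'.v x = s.v x) : Undo R S w L C l st s' := by
  obtain ⟨⟨log, g, hl⟩, h7, h15⟩ := h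
  exact ⟨⟨log, g.of_same hm fun x hx => hv x (.inr (.inr hx)), hl⟩, by rw [hv 7 (by simp), h7],
    by rw [hv 15 (by simp), h15]⟩

theorem WP.undoPass (vs es : Bool) (hL : L.Valid R S w) (hC : L.Caps R) (hH : Hist1 R n l F)
    (hI : CInv R C F) (hU : Undo R S w L C l st s) (h6 : s.v 6 = 0)
    (hQ : ∀ q o s' C', CInv R C' [] → outOf R vs es C ++ o = outOf R vs es C' →
      q + compCost R C ≤ compCost R C' + n + (F.map R.cost).sum → Q q o s') :
    WP R S w (undoPass vs es) s Q := by
  have hn := hL.n_lt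
  have hw := hL.w_pos
  have hw0 : w ≠ 0 := by omega
  have hcap : l.length ≤ L.clog := hH.length_le.trans hC.log
  refine WP.seq_assign (by simp; omega) ?_
  suffices H : ∀ r l F, Hist1 R r l F → ∀ C st s Q, r ≤ n → l.length ≤ L.clog → CInv R C F →
      Undo R S w L C l st s → s.v 6 = 0 → s.v 16 = r →
      (∀ q o s' C', CInv R C' [] → outOf R vs es C ++ o = outOf R vs es C' →
        q + compCost R C ≤ compCost R C' + r + (F.map R.cost).sum → Q q o s') →
      WP R S w (.loop (16 : Fin 32)
        (.assign 16 (((16 : Fin 32) : Expr 32) - .const 1) ;;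
          _root_.byDegrees
            (_root_.logPop ;;
              .ite (13 : Fin 32)
                (.assign 17 (16 : Fin 32) ;; .query 18 (.deg false) (17 : Fin 32) (.const 0) ;;
                  .assign 19 (.const 1) ;; _root_.visit vs es ;;
                  .loop (19 : Fin 32) (undoStep vs es))
                .skip)
            .skip .skip .skip)) s Q by
    refine H n l F hH C st _ Q le_rfl hcap hI (hU.of_same rfl fun x hx => ?_) ?_ (by simp) hQ
    · refine NState.set_v_ne _ _ ?_
      rintro rfl; revert hx; decide
    · simpa [NState.set_v] using h6
  clear hcap h6 hU hI hH hQ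
  intro r l F hH
  induction hH with
  | start =>
    intro C st s Q _ _ hI _ _ h16 hQ
    exact WP.loop_false (by simp) (by simp [h16]) (hQ 0 [] s C hI (by simp) (by omega))
  | @triv r l F h hc ih =>
    intro C st s Q hrn hcap hI hU h6 h16 hQ
    refine WP.loop_true (by simp) (by simp [h16]) ?_
    refine WP.seq_assign (by simp [h16]; omega) ?_
    have key : ∀ s' : NState 32, s'.m = (s.set 16 r).m → Same [8, 12] (s.set 16 r) s' →
        WP R S w .skip s' fun q₁ o₁ s₁ => WP R S w (.loop (16 : Fin 32)
        (.assign 16 (((16 : Fin 32) : Expr 32) - .const 1) ;;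
          _root_.byDegrees
            (_root_.logPop ;;
              .ite (13 : Fin 32)
                (.assign 17 (16 : Fin 32) ;; .query 18 (.deg false) (17 : Fin 32) (.const 0) ;;
                  .assign 19 (.const 1) ;; _root_.visit vs es ;;
                  .loop (19 : Fin 32) (undoStep vs es))
                .skip)
            .skip .skip .skip)) s₁ fun q₂ o₂ s₂ => Q (1 + q₁ + q₂) (o₁ ++ o₂) s₂ := by
      intro s' hm hs
      refine WP.skip (ih C st s' _ (by omega) hcap hI (hU.of_same hm fun x hx => ?_) ?_ ?_ ?_)
      · rw [hs x (by revert hx; revert x; decide)]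
        refine NState.set_v_ne _ _ ?_
        rintro rfl; revert hx; decide
      · rw [hs 6 (by decide)]; simpa [NState.set_v] using h6
      · rw [hs 16 (by decide)]; simp
      · exact fun q o s' C' a1 a2 a3 => hQ _ _ s' C' a1 (by simpa using a2) (by omega)
    refine WP.byDegrees (x := r) hn (by simp [h16]) (by omega) (fun h => absurd h hc) ?_ ?_ ?_
    all_goals
      intro _ _ s' hm hs
      simp only [Expr.val_sub, Expr.val_var, Expr.val_const, h16, Nat.add_sub_cancel] at hm hs
      exact key s' hm hs
  | @seen r l F h hc hrF ih =>
    intro C st s Q hrn hcap hI hU h6 h16 hQ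
    refine WP.loop_true (by simp) (by simp [h16]) ?_
    refine WP.seq_assign (by simp [h16]; omega) ?_
    simp only [Expr.val_sub, Expr.val_var, Expr.val_const, h16, Nat.add_sub_cancel]
    have hno : ∀ {p : Prop}, ¬ R.core r → p := fun h => absurd hc h
    refine WP.byDegrees (x := r) hn (by simp) (by omega) (fun _ s' hm hs => ?_)
      (fun h1 h2 => hno fun h => by have := h.2; omega)
      (fun h1 h2 => hno fun h => by have := h.1; omega)
      (fun h1 h2 => hno fun h => by have := h.1; omega)
    have hU' : Undo R S w L C (l ++ [0]) st s' := hU.of_same hm fun x hx => by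
      rw [hs x (by revert hx; revert x; decide)]
      refine NState.set_v_ne _ _ ?_
      rintro rfl; revert hx; decide
    obtain ⟨⟨log, g, hl⟩, h7, h15⟩ := hU'
    refine WP.seq0 (WP.logPop hL g hl h7 hcap fun s1 g1 hl1 h71 h13 f1 => ⟨rfl, rfl, ?_⟩)
    refine WP.ite (by simp) (fun hb => absurd h13 hb) fun _ => WP.skip ?_
    refine ih C st s1 _ (by omega) (by simp at hcap; omega) hI
      ⟨⟨log, g1, hl1⟩, h71, by rw [f1 15 (by decide), h15]⟩ ?_ ?_ ?_
    · rw [f1 6 (by decide), hs 6 (by decide)]; simpa [NState.set_v] using h6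
    · rw [f1 16 (by decide), hs 16 (by decide)]; simp
    · exact fun q o s' C' a1 a2 a3 => hQ _ _ s' C' a1 (by simpa using a2) (by omega)
  | @run r l F D l' f h hc hrF hD ih =>
    intro C st s Q hrn hcap hI hU h6 h16 hQ
    refine WP.loop_true (by simp) (by simp [h16]) ?_
    refine WP.seq_assign (by simp [h16]; omega) ?_
    simp only [Expr.val_sub, Expr.val_var, Expr.val_const, h16, Nat.add_sub_cancel]
    have hno : ∀ {p : Prop}, ¬ R.core r → p := fun h => absurd hc h
    refine WP.byDegrees (x := r) hn (by simp) (by omega) (fun _ s' hm hs => ?_)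
      (fun h1 h2 => hno fun h => by have := h.2; omega)
      (fun h1 h2 => hno fun h => by have := h.1; omega)
      (fun h1 h2 => hno fun h => by have := h.1; omega)
    have hU' : Undo R S w L C (l ++ (l' ++ [1])) st s' := hU.of_same hm fun x hx => by
      rw [hs x (by revert hx; revert x; decide)]
      refine NState.set_v_ne _ _ ?_
      rintro rfl; revert hx; decide
    have hFo := (h.run hc hrF hD).finOrder
    obtain ⟨⟨log, g, hl⟩, h7, h15⟩ := hU'
    rw [← List.append_assoc] at hl h7 hcap hI hFo
    have hrdeg : R.deg false r ≤ n := AdjArrays.deg_le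
    refine WP.seq0 (WP.logPop hL g hl h7 hcap fun s1 g1 hl1 h71 h13 f1 => ⟨rfl, rfl, ?_⟩)
    refine WP.ite (by simp) (fun _ => ?_) fun hb => by rw [Expr.val_var, h13] at hb; simp at hb
    have e16 : s1.v 16 = r := by rw [f1 16 (by decide), hs 16 (by decide)]; simp
    have e6 : s1.v 6 = 0 := by
      rw [f1 6 (by decide), hs 6 (by decide)]; simpa [NState.set_v] using h6
    refine WP.seq_assign (by simp) ?_
    simp only [Expr.val_var, e16]
    refine WP.seq_query (R.deg false r) (by simp) (by simp)
      (by simpa using AdjArrays.answer_deg hc.lt) (by omega) (WP.seq_assign (by simp; omega) ?_)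
    simp only [Expr.val_const]
    have hFp : FinProp (R.deg false) (R.head false) (· ∈ F ++ f) r := hFo _ r [] rfl
    refine WP.seq (WP.visit (base := 0) vs es hL hC (l := l ++ l')
      ⟨⟨log, ((g1.set (by decide) _).set (by decide) _).set (by decide) _, hl1⟩,
        by simpa [NState.set_v] using h71, by simpa [NState.set_v, f1] using h15⟩
      hI hc (by simp [NState.set_v]) (by simpa [NState.set_v] using e6)
      (Nat.zero_le _) hFp fun q1 o1 s2 C' st2 hU2 hI2 _ ho1 f2 hq1 => ?_)
    refine WP.undoLoop vs es hL hC (F₀ := F) hc hrF hD (by simp at hcap ⊢; omega)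
      (fun f₁ x f₂ he => hFo f₁ x (f₂ ++ [r]) (by rw [he]; simp)) hI2 hU2 trivial ?_ ?_ ?_ ?_ ?_ ?_
    · rw [f2 6 (by decide)]; simpa [NState.set_v, pathBits] using e6
    · rw [f2 16 (by decide)]; simp [NState.set_v, e16]
    · rw [f2 17 (by decide)]; simp [NState.set_v]
    · rw [f2 18 (by decide)]; simp [NState.set_v]
    · rw [f2 19 (by decide)]; simp [NState.set_v]
    · intro q2 o2 s3 C'' st3 hU3 hI3 ho2 h163 h63 hq2
      refine ih C'' st3 s3 _ (by omega) (by simp at hcap; omega) hI3 hU3 h63 h163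
        fun q o s' C₃ a1 a2 a3 => hQ _ _ s' C₃ a1 ?_ ?_
      · simpa [← ho1, ← ho2, List.append_assoc] using a2
      · have h1 := DfsPar.spent_le (P := logPar R F r) hD
        have hp : D.Perm (f ++ [r]) := hD.perm
        rw [(hp.map R.cost).sum_eq] at h1
        rw [List.map_append, List.sum_append]
        omega

end

/-! ### The choice of the layout -/

/-- The layout for `n` vertices, `m` edges, `c` vertices with both incoming and outgoing edges, word
length `w` and block pointers `p`.  If there are many edges, a color is stored for every vertex, and
otherwise only for the blocks of `w / 400` vertices that contain a vertex with an edge. -/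
def plan (n m c w : ℕ) (p : ℕ → ℕ) : Layout :=
  let K2 := Nat.log 2 (2 ^ w - 1)
  let KP := Nat.log (n + 1) (2 ^ w - 1)
  let low := 8 * m * (w / 400) ≤ n
  let cptr := if low then n / (w / 400) + 1 else 0
  let alog := 3 * w + (5 * m / 3 - c) / K2 + 1
  let aptr := alog + (m + c) / K2 + 1
  { K2 := K2
    K3 := Nat.log 3 (2 ^ w - 1)
    KP := KP
    AST := 3 * w
    ALOG := alog
    APTR := aptr
    ACOL := aptr + cptr / KP + 1
    LOW := if low then 1 else 0
    cst := 5 * m / 3 - c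
    clog := m + c
    cptr := cptr
    ccol := if low then 2 * m * (w / 400) else n
    p := p }

/-- The number of words of memory for a layout. -/
def Layout.size (L : Layout) : ℕ := L.ACOL + L.ccol / L.K3 + 1

section

variable {n : ℕ} {G : Digraph (Fin n)} {R : AdjArrays G}

theorem edgeCount_le_mul_self (R : AdjArrays G) : edgeCount G ≤ n * n := by
  rw [← R.sum_deg false]
  calc _ ≤ ∑ _u ∈ Finset.range n, n := Finset.sum_le_sum fun u _ => AdjArrays.deg_le
    _ = n * n := by simp

theorem coreCount_le (R : AdjArrays G) : coreCount R n ≤ n := by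
  classical
  simpa [coreCount] using Finset.card_filter_le (Finset.range n) R.core

/-- The numbers of bits for the positions in the two arrays of a vertex are small in comparison with
the degrees. -/
theorem one_add_clog_add_clog_le {a b : ℕ} (ha : 0 < a) (hb : 0 < b) :
    6 * (1 + Nat.clog 2 a + Nat.clog 2 b) ≤ 5 * (a + b) := by
  have key : ∀ a, 0 < a → 6 * Nat.clog 2 a + 3 ≤ 5 * a := by
    intro a ha
    -- the bound is tight for `3`, and it holds for large numbers by the growth of powers of two
    by_cases h : a ≤ 4
    · interval_cases a
      · simp
      · rw [show Nat.clog 2 2 = 1 by decide +kernel]; norm_num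
      · rw [show Nat.clog 2 3 = 2 by decide +kernel]
      · rw [show Nat.clog 2 4 = 2 by decide +kernel]; norm_num
    · push Not at h
      have h2 : ∀ k, 3 ≤ k → 6 * k + 3 ≤ 5 * (2 ^ (k - 1) + 1) := by
        intro k hk
        induction k, hk using Nat.le_induction with
        | base => norm_num
        | succ k hk ih =>
          have : 2 ^ (k + 1 - 1) = 2 * 2 ^ (k - 1) := by rw [← pow_succ']; congr 1; omega
          have h4 : 2 ^ 2 ≤ 2 ^ (k - 1) := Nat.pow_le_pow_right (by norm_num) (by omega)
          omega
      have h3 : 3 ≤ Nat.clog 2 a := by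
        have : 2 < Nat.clog 2 a := (Nat.lt_clog_iff_pow_lt (by norm_num)).2 (by norm_num; omega)
        omega
      have h5 : 2 ^ (Nat.clog 2 a - 1) < a :=
        (Nat.lt_clog_iff_pow_lt (by norm_num)).1 (by omega)
      have := h2 _ h3
      omega
  have := key a ha
  have := key b hb
  omega

/-- The sum of `one_add_clog_add_clog_le` over the core vertices bounds the space for the stacks. -/
theorem coreCount_add_stTot_le (R : AdjArrays G) :
    coreCount R n + (R.stTot false + R.stTot true) ≤ 5 * edgeCount G / 3 := by
  classical
  rw [Nat.le_div_iff_mul_le (by norm_num)]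
  have h : 6 * (coreCount R n + (R.stTot false + R.stTot true)) ≤
      5 * (edgeCount G + edgeCount G) := by
    have e : coreCount R n + (R.stTot false + R.stTot true) =
        ∑ x ∈ (Finset.range n).filter R.core,
          (1 + Nat.clog 2 (R.deg false x) + Nat.clog 2 (R.deg true x)) := by
      simp only [coreCount, AdjArrays.stTot, Finset.sum_add_distrib, Finset.card_eq_sum_ones]
      rw [add_assoc]
    rw [e, Finset.mul_sum]
    calc _ ≤ ∑ x ∈ (Finset.range n).filter R.core, 5 * (R.deg false x + R.deg true x) :=
          Finset.sum_le_sum fun x hx => by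
            have := (Finset.mem_filter.1 hx).2
            exact one_add_clog_add_clog_le this.1 this.2
      _ ≤ ∑ x ∈ Finset.range n, 5 * (R.deg false x + R.deg true x) :=
          Finset.sum_le_sum_of_subset (Finset.filter_subset _ _)
      _ = _ := by
          rw [← Finset.mul_sum, Finset.sum_add_distrib, R.sum_deg, R.sum_deg]
  omega

theorem mul_lt_two_pow {n w : ℕ} (hw : 6800 * (Nat.log 2 n + 1) ≤ w) :
    64 * (w * (n + 2) ^ 2) < 2 ^ w := by
  have hn : n < 2 ^ (Nat.log 2 n + 1) := Nat.lt_pow_succ_log_self (by norm_num) n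
  set u := Nat.log 2 n + 1 with hu
  have hu1 : 1 ≤ u := by omega
  have h1 : n + 2 ≤ 2 ^ (u + 1) := by
    have : 2 ^ 1 ≤ 2 ^ u := Nat.pow_le_pow_right (by norm_num) hu1
    rw [pow_succ]; omega
  have h2 : (n + 2) ^ 2 ≤ 2 ^ (2 * u + 2) := by
    calc (n + 2) ^ 2 ≤ (2 ^ (u + 1)) ^ 2 := Nat.pow_le_pow_left h1 2
      _ = 2 ^ (2 * u + 2) := by rw [← pow_mul]; congr 1; ring
  obtain ⟨d, hd⟩ : ∃ d, w = 2 * u + 2 + (10 + d) := ⟨w - (2 * u + 12), by omega⟩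
  have h3 : d < 2 ^ d := Nat.lt_two_pow_self
  have h4 : 64 * w < 2 ^ (10 + d) := by
    rw [pow_add]; norm_num; omega
  calc 64 * (w * (n + 2) ^ 2) = (n + 2) ^ 2 * (64 * w) := by ring
    _ ≤ 2 ^ (2 * u + 2) * (64 * w) := Nat.mul_le_mul_right _ h2
    _ < 2 ^ (2 * u + 2) * 2 ^ (10 + d) := Nat.mul_lt_mul_of_pos_left h4 (by positivity)
    _ = 2 ^ w := by rw [← pow_add, ← hd]

variable {w : ℕ} {p : ℕ → ℕ}

/-- The numbers that determine a layout, with bounds that exclude overflows. -/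
structure Sizes (n m c w : ℕ) : Prop where
  n_pos : 0 < n
  m_le : m ≤ n * n
  c_le : c ≤ n
  w_ge : 6800 * (Nat.log 2 n + 1) ≤ w

namespace Sizes

variable {m c : ℕ}

/-- A number `X` far below `2 ^ w` bounds all numbers that are computed. -/
theorem bounds (h : Sizes n m c w) : 6800 ≤ w ∧ ∃ X, 64 * X < 2 ^ w ∧ w ≤ X ∧ n + 2 ≤ X ∧
    m + 2 * n ≤ X ∧ c ≤ n ∧ m * (w / 400) ≤ X := by
  obtain ⟨h1, h2, h3, h4⟩ := h
  have hw : 6800 ≤ w := by omega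
  refine ⟨hw, w * (n + 2) ^ 2, mul_lt_two_pow h4, ?_, ?_, ?_, h3, ?_⟩
  · exact Nat.le_mul_of_pos_right _ (by positivity)
  · nlinarith
  · nlinarith [Nat.zero_le (n * n)]
  · have : w / 400 ≤ w := Nat.div_le_self _ _
    calc m * (w / 400) ≤ (n * n) * w := Nat.mul_le_mul h2 this
      _ ≤ (n + 2) ^ 2 * w := Nat.mul_le_mul_right _ (by nlinarith)
      _ = _ := mul_comm _ _

/-- The number of digits to base `β` in a word. -/
theorem log_facts {β : ℕ} (hβ : 2 ≤ β) (hβw : β < 2 ^ w) :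
    0 < Nat.log β (2 ^ w - 1) ∧ Nat.log β (2 ^ w - 1) ≤ w ∧ β ^ Nat.log β (2 ^ w - 1) < 2 ^ w := by
  have h3 : β ^ Nat.log β (2 ^ w - 1) < 2 ^ w := by
    have := Nat.pow_log_le_self β (x := 2 ^ w - 1) (by omega)
    omega
  refine ⟨Nat.log_pos hβ (by omega), ?_, h3⟩
  have : 2 ^ Nat.log β (2 ^ w - 1) < 2 ^ w := (Nat.pow_le_pow_left hβ _).trans_lt h3
  exact ((Nat.pow_lt_pow_iff_right (by norm_num)).1 this).le

theorem size_lt (h : Sizes n m c w) : (plan n m c w p).size < 2 ^ w ∧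
    (plan n m c w p).size ≤ 3 * w + 5 * n + 5 * m + 6 := by
  obtain ⟨hw, X, h1, h2, h3, h4, h5, h6⟩ := h.bounds
  have d1 := Nat.div_le_self (5 * m / 3 - c) (Nat.log 2 (2 ^ w - 1))
  have d2 := Nat.div_le_self (m + c) (Nat.log 2 (2 ^ w - 1))
  have d3 := Nat.div_le_self (if 8 * m * (w / 400) ≤ n then n / (w / 400) + 1 else 0)
    (Nat.log (n + 1) (2 ^ w - 1))
  have d4 := Nat.div_le_self (if 8 * m * (w / 400) ≤ n then 2 * m * (w / 400) else n)
    (Nat.log 3 (2 ^ w - 1))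
  have d5 := Nat.div_le_self n (w / 400)
  have e1 : 2 * m * (w / 400) = 2 * (m * (w / 400)) := by ring
  have e2 : 8 * m * (w / 400) = 8 * (m * (w / 400)) := by ring
  have : (plan n m c w p).size ≤ 3 * w + 5 * n + 5 * m + 6 := by
    simp only [Layout.size, plan]
    split_ifs at d3 d4 ⊢ <;> omega
  exact ⟨by omega, this⟩

end Sizes

theorem plan_valid (hs : Sizes n (edgeCount G) (coreCount R n) w)
    (hp : 8 * edgeCount G * (w / 400) ≤ n →
      (∀ x, R.touched x → p (x / (w / 400)) < 2 * edgeCount G) ∧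
      ∀ x y, R.touched x → R.touched y → p (x / (w / 400)) = p (y / (w / 400)) →
        x / (w / 400) = y / (w / 400)) :
    (plan n (edgeCount G) (coreCount R n) w p).Valid R
      (plan n (edgeCount G) (coreCount R n) w p).size w := by
  obtain ⟨hw, X, h1, h2, h3, h4, h5, h6⟩ := hs.bounds
  have hB : 0 < w / 400 := by omega
  have l2 := Sizes.log_facts (w := w) (β := 2) le_rfl (by omega)
  have l3 := Sizes.log_facts (w := w) (β := 3) (by norm_num) (by omega)
  have lp := Sizes.log_facts (w := w) (β := n + 1) (by have := hs.n_pos; omega) (by omega)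
  have e1 : 2 * edgeCount G * (w / 400) = 2 * (edgeCount G * (w / 400)) := by ring
  refine ⟨hs.size_lt.1, by omega, ?_, ?_, ?_, by omega, ?_, ?_, ?_, ?_, ?_, ?_, ?_, ?_, ?_⟩
  · simp only [plan]; omega
  · simp only [plan]; omega
  · simp only [plan]; split_ifs <;> omega
  · simp only [plan]; omega
  · simp only [plan]; omega
  · simp only [plan]; omega
  · exact le_rfl
  · exact le_rfl
  · exact le_rfl
  · intro x hx
    have hxn := hx.lt
    simp only [Layout.ix, plan]
    split_ifs with hlow h0
    · simp at h0
    · have hpx := (hp hlow).1 x hx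
      have hm := Nat.mod_lt x hB
      calc _ < p (x / (w / 400)) * (w / 400) + (w / 400) := by omega
        _ = (p (x / (w / 400)) + 1) * (w / 400) := by ring
        _ ≤ _ := Nat.mul_le_mul_right _ hpx
    · exact hxn
    · omega
  · intro x y hx hy
    simp only [Layout.ix, plan]
    split_ifs with hlow h0
    · simp at h0
    · intro he
      have hm1 := Nat.mod_lt x hB
      have hm2 := Nat.mod_lt y hB
      have k1 : (p (x / (w / 400)) * (w / 400) + x % (w / 400)) / (w / 400) =
          p (x / (w / 400)) := by
        rw [mul_comm, Nat.mul_add_div hB, Nat.div_eq_of_lt hm1, add_zero]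
      have k2 : (p (y / (w / 400)) * (w / 400) + y % (w / 400)) / (w / 400) =
          p (y / (w / 400)) := by
        rw [mul_comm, Nat.mul_add_div hB, Nat.div_eq_of_lt hm2, add_zero]
      have hpe : p (x / (w / 400)) = p (y / (w / 400)) := by rw [← k1, ← k2, he]
      have hd := (hp hlow).2 x y hx hy hpe
      rw [hpe] at he
      rw [← Nat.div_add_mod x (w / 400), ← Nat.div_add_mod y (w / 400), hd]
      omega
    · exact id
    · omega
  · intro h x hx
    simp only [plan] at h ⊢
    split_ifs at h ⊢ with hlow
    · have := Nat.div_le_div_right (c := w / 400) hx.le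
      omega
    · exact absurd rfl h

theorem plan_caps (R : AdjArrays G) : (plan n (edgeCount G) (coreCount R n) w p).Caps R := by
  have := coreCount_add_stTot_le R
  exact ⟨le_rfl, by simp only [plan]; omega⟩

end

/-! ### Initialization -/

/-- Counts the edges and the vertices with both incoming and outgoing edges. -/
def countPass : Cmd 32 :=
  .assign 20 (.const 0) ;; .assign 21 (.const 0) ;;
  forUp (byDegrees
    (.assign 20 (((20 : Fin 32) : Expr 32) + (12 : Fin 32)) ;;
      .assign 21 (((21 : Fin 32) : Expr 32) + .const 1))
    (.assign 20 (((20 : Fin 32) : Expr 32) + (12 : Fin 32))) .skip .skip)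

/-- Stores the powers of `β` from address `T` on, and their number in variable `x`. -/
def powTable (T β : Expr 32) (x : Fin 32) : Cmd 32 :=
  .assign 11 (.const 1) ;; .assign x (.const 0) ;;
  .loop (.op .lt (11 : Fin 32) (((22 : Fin 32) : Expr 32) / β + .const 1))
    (.store (T + .var x) (11 : Fin 32) ;; .assign 11 (((11 : Fin 32) : Expr 32) * β) ;;
      .assign x ((x : Expr 32) + .const 1))

/-- Computes the layout and, in variable `9`, the size of the memory. -/
def planCmd : Cmd 32 :=
  let B : Expr 32 := Expr.wordLength / 400
  let v (x : Fin 32) : Expr 32 := x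
  .assign 27 (Expr.wordLength * 3) ;;
  .assign 31 (.op .eq (.op .lt Expr.numVertices (8 * v 20 * B)) (.const 0)) ;;
  .assign 28 (v 27 + (5 * v 20 / 3 - v 21) / v 24 + .const 1) ;;
  .assign 29 (v 28 + (v 20 + v 21) / v 24 + .const 1) ;;
  .ite (v 31)
    (.assign 30 (v 29 + (Expr.numVertices / B + .const 1) / v 26 + .const 1) ;;
      .assign 9 (v 30 + 2 * v 20 * B / v 25 + .const 1))
    (.assign 30 (v 29 + .const 1) ;;
      .assign 9 (v 30 + Expr.numVertices / v 25 + .const 1))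

/-- Fills the memory from the address in variable `8` to below that in variable `9` with zeros. -/
def zeroFill : Cmd 32 :=
  .loop (.op .lt (8 : Fin 32) (9 : Fin 32))
    (.store (8 : Fin 32) (.const 0) ;; .assign 8 (((8 : Fin 32) : Expr 32) + .const 1))

/-- Numbers the blocks that contain a vertex with an edge.  Variable `20` counts these blocks, and
variable `21` holds the index plus one of the last of them. -/
def ptrPass : Cmd 32 :=
  let mark : Cmd 32 :=
    .ite (.op .eq (21 : Fin 32)
        (((16 : Fin 32) : Expr 32) / (Expr.wordLength / 400) + .const 1)) .skip
      (.assign 22 (((16 : Fin 32) : Expr 32) / (Expr.wordLength / 400)) ;;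
        arrPtr.put 22 (20 : Fin 32) ;;
        .assign 20 (((20 : Fin 32) : Expr 32) + .const 1) ;;
        .assign 21 (((22 : Fin 32) : Expr 32) + .const 1))
  .assign 20 (.const 0) ;; .assign 21 (.const 0) ;; forUp (byDegrees mark mark mark .skip)

/-- Computes the layout and the tables, and fills the arrays with zeros.  Variable `22` is set to the
largest word `2 ^ w - 1`, which is computed as `(2 ^ (w - 1) - 1) + 2 ^ (w - 1)`. -/
def initCmd : Cmd 32 :=
  countPass ;;
  .assign 22 (.op .shl (.const 1) (Expr.wordLength - .const 1) - .const 1 +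
    .op .shl (.const 1) (Expr.wordLength - .const 1)) ;;
  powTable (.const 0) (.const 2) 24 ;;
  powTable Expr.wordLength (.const 3) 25 ;;
  powTable (Expr.wordLength * 2) (Expr.numVertices + .const 1) 26 ;;
  planCmd ;; .assign 8 (27 : Fin 32) ;; zeroFill ;;
  .ite (31 : Fin 32) ptrPass .skip ;;
  .assign 6 (.const 0) ;; .assign 7 (.const 0)

section

variable {n : ℕ} {G : Digraph (Fin n)} {R : AdjArrays G} {S w : ℕ} {s : NState 32}
  {Q : ℕ → List OutSymbol → NState 32 → Prop}

theorem WP.countPass (hn : 4 * (n + 2) < 2 ^ w) (hm : edgeCount G < 2 ^ w)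
    (hQ : ∀ s' : NState 32, s'.m = s.m → s'.v 20 = edgeCount G → s'.v 21 = coreCount R n →
      Q n [] s') : WP R S w countPass s Q := by
  classical
  have hw0 : w ≠ 0 := by rintro rfl; simp at hn
  refine WP.seq_assign (by simp) (WP.seq_assign (by simp) ?_)
  refine WP.forUp (fun r q o s' => o = [] ∧ q = r ∧ s'.m = s.m ∧
    s'.v 20 = ∑ x ∈ Finset.range r, R.deg false x ∧ s'.v 21 = coreCount R r) (by omega) ?_ ?_ ?_
  · exact ⟨rfl, rfl, rfl, by simp [NState.set_v], by simp [NState.set_v, coreCount]⟩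
  · rintro r q o s1 hr ⟨rfl, rfl, hm1, h20, h21⟩ h16
    have hsum : ∑ x ∈ Finset.range q, R.deg false x + R.deg false q ≤ edgeCount G := by
      rw [← R.sum_deg false, ← Finset.sum_range_succ]
      exact Finset.sum_le_sum_of_subset (Finset.range_mono hr)
    have hc := coreCount_mono (R := R) hr.le
    have hcn := coreCount_le R
    have hd : R.deg false q ≤ n := AdjArrays.deg_le
    have hfin : ∀ s2 : NState 32, s2.m = s.m → s2.v 16 = q →
        s2.v 20 = ∑ x ∈ Finset.range q, R.deg false x + R.deg false q →
        s2.v 21 = coreCount R (q + 1) → s2.v 16 = q ∧ ([] : List OutSymbol) ++ [] = [] ∧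
        q + 1 + 0 = q + 1 ∧ (s2.set 16 (q + 1)).m = s.m ∧
        (s2.set 16 (q + 1)).v 20 = ∑ x ∈ Finset.range (q + 1), R.deg false x ∧
        (s2.set 16 (q + 1)).v 21 = coreCount R (q + 1) := by
      intro s2 a1 a2 a3 a4
      exact ⟨a2, rfl, rfl, a1, by simp [NState.set_v, a3, Finset.sum_range_succ],
        by simp [NState.set_v, a4]⟩
    refine WP.seq_query (R.deg false q) (by simp) (by simp)
      (by simpa [h16] using AdjArrays.answer_deg hr) (by omega) ?_
    have hd2 : R.deg true q ≤ n := AdjArrays.deg_le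
    refine WP.seq_query (R.deg true q) (by simp) (by simp)
      (by simpa [NState.set_v, h16] using AdjArrays.answer_deg hr) (by omega) ?_
    refine WP.ite (by simp) (fun hb => WP.ite (by simp) (fun hb' => ?_) fun hb' => ?_)
      fun hb => WP.ite (by simp) (fun hb' => WP.skip ?_) fun hb' => WP.skip ?_
    all_goals simp [NState.set_v] at hb hb'
    · refine WP.seq_assign (by simp [NState.set_v, h20]; omega)
        (WP.assign (by simp [NState.set_v, h21]; omega) ?_)
      refine hfin _ hm1 (by simp [NState.set_v, h16]) (by simp [NState.set_v, h20]) ?_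
      rw [coreCount_succ_of_core ⟨by omega, by omega⟩]
      simp [NState.set_v, h21]
    · refine WP.assign (by simp [NState.set_v, h20]; omega) ?_
      refine hfin _ hm1 (by simp [NState.set_v, h16]) (by simp [NState.set_v, h20]) ?_
      rw [coreCount_succ fun h => by have := h.2; omega]
      simp [NState.set_v, h21]
    · refine hfin _ hm1 (by simp [NState.set_v, h16]) (by simp [NState.set_v, h20, hb]) ?_
      rw [coreCount_succ fun h => by have := h.1; omega]
      simp [NState.set_v, h21]
    · refine hfin _ hm1 (by simp [NState.set_v, h16]) (by simp [NState.set_v, h20, hb]) ?_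
      rw [coreCount_succ fun h => by have := h.1; omega]
      simp [NState.set_v, h21]
  · rintro q o s' ⟨rfl, rfl, hm', h20, h21⟩
    exact hQ s' hm' (by rw [h20, R.sum_deg]) h21

theorem WP.powTable {T β : Expr 32} {x : Fin 32} {Tv b : ℕ} (hw : 400 ≤ w) (hS : S < 2 ^ w)
    (h22 : s.v 22 = 2 ^ w - 1) (hx : x ≠ 11) (hx' : x ≠ 22)
    (hT : ∀ s', T.ok n w s' ∧ T.val n w s' = Tv) (hβ : ∀ s', β.ok n w s' ∧ β.val n w s' = b)
    (hb : 2 ≤ b) (hbw : b < 2 ^ w) (hTS : Tv + Nat.log b (2 ^ w - 1) ≤ S)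
    (hQ : ∀ s' : NState 32, s'.v x = Nat.log b (2 ^ w - 1) →
      (∀ j < Nat.log b (2 ^ w - 1), s'.m (Tv + j) = b ^ j) → (∀ a < Tv, s'.m a = s.m a) →
      Same [11, x] s s' → Q (Nat.log b (2 ^ w - 1)) [] s') : WP R S w (powTable T β x) s Q := by
  have hw0 : w ≠ 0 := by omega
  have hM : 2 ^ 2 ≤ 2 ^ w := Nat.pow_le_pow_right (by norm_num) (by omega)
  have hdiv : (2 ^ w - 1) / b ≤ (2 ^ w - 1) / 2 := Nat.div_le_div_left hb (by norm_num)
  have htest : ∀ q, b ^ q < (2 ^ w - 1) / b + 1 ↔ q < Nat.log b (2 ^ w - 1) := by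
    intro q
    rw [Nat.lt_succ_iff, Nat.le_div_iff_mul_le (by omega), ← pow_succ,
      ← Nat.succ_le_iff, Nat.succ_eq_add_one]
    exact (Nat.le_log_iff_pow_le hb (by omega)).symm
  refine WP.seq_assign (by simp; omega) (WP.seq_assign (by simp) ?_)
  refine WP.loop_inv (fun q o s' => o = [] ∧ s'.v x = q ∧ s'.v 11 = b ^ q ∧
    q ≤ Nat.log b (2 ^ w - 1) ∧ (∀ j < q, s'.m (Tv + j) = b ^ j) ∧ (∀ a < Tv, s'.m a = s.m a) ∧
    Same [11, x] s s') (fun s' => Nat.log b (2 ^ w - 1) - s'.v x) ?_ ?_ ?_ ?_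
  · refine ⟨rfl, by simp, by simp [NState.set_v, hx.symm], Nat.zero_le _, by simp, fun _ _ => rfl,
      fun y hy => ?_⟩
    simp at hy; simp [NState.set_v, hy]
  · rintro q o s' ⟨-, -, -, -, -, -, hs⟩
    have e22 : s'.v 22 = 2 ^ w - 1 := by rw [hs 22 (by simp [hx'.symm]), h22]
    simp [hβ, e22]; omega
  · rintro q o s' ⟨rfl, hxq, h11, hq, htab, hm, hs⟩ hc
    have e22 : s'.v 22 = 2 ^ w - 1 := by rw [hs 22 (by simp [hx'.symm]), h22]
    have hlt : q < Nat.log b (2 ^ w - 1) := by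
      rw [← htest]
      by_contra hcc
      rw [Expr.val_lt, if_neg] at hc
      · exact hc rfl
      · simpa [hβ, e22, h11] using hcc
    have hmul : b ^ q * b < 2 ^ w := by
      rw [← pow_succ]
      have := (Nat.le_log_iff_pow_le (b := b) (x := q + 1) hb (y := 2 ^ w - 1) (by omega)).1 hlt
      omega
    refine WP.seq0 (WP.store (by simp [hT, hxq]; omega) (by simp) (by simp [hT, hxq]; omega)
      ⟨rfl, rfl, ?_⟩)
    refine WP.seq_assign (by simp [hβ, h11]; omega) (WP.assign (by
      simp [NState.set_v, hx, hxq]; omega) ?_)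
    refine ⟨⟨rfl, by simp [NState.set_v, hx, hxq], ?_, hlt, fun j hj => ?_, fun a ha => ?_,
      fun y hy => ?_⟩, by simp [NState.set_v, hx, hxq]; omega⟩
    · simp [NState.set_v, hx.symm, hβ, h11, pow_succ]
    · simp only [NState.set_m, NState.put_m, Expr.val_add, hT, Expr.val_var, hxq, h11]
      by_cases hjq : j = q
      · subst hjq; simp
      · rw [Function.update_of_ne (by omega)]; exact htab j (by omega)
    · simp only [NState.set_m, NState.put_m, Expr.val_add, hT, Expr.val_var, hxq, h11]
      rw [Function.update_of_ne (by omega)]; exact hm a ha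
    · have := hs y hy
      simp at hy; simp [NState.set_v, hy, this]
  · rintro q o s' ⟨rfl, hxq, h11, hq, htab, hm, hs⟩ hc
    have e22 : s'.v 22 = 2 ^ w - 1 := by rw [hs 22 (by simp [hx'.symm]), h22]
    have hge : ¬ q < Nat.log b (2 ^ w - 1) := by
      rw [← htest]
      intro hcc
      rw [Expr.val_lt, if_pos] at hc
      · simp at hc
      · simpa [hβ, e22, h11] using hcc
    obtain rfl : q = Nat.log b (2 ^ w - 1) := by omega
    exact hQ s' hxq htab hm hs

theorem WP.planCmd {m c : ℕ} (hs : Sizes n m c w) (h20 : s.v 20 = m) (h21 : s.v 21 = c)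
    (h24 : s.v 24 = Nat.log 2 (2 ^ w - 1)) (h25 : s.v 25 = Nat.log 3 (2 ^ w - 1))
    (h26 : s.v 26 = Nat.log (n + 1) (2 ^ w - 1)) (hc : c ≤ 5 * m / 3)
    (hQ : ∀ s' : NState 32, s'.m = s.m →
      (∀ x : Fin 32, 24 ≤ x → s'.v x = (plan n m c w fun _ => 0).fx x) →
      s'.v 9 = (plan n m c w fun _ => 0).size → Q 0 [] s') : WP R S w planCmd s Q := by
  obtain ⟨hw, X, h1, h2, h3, h4, h5, h6⟩ := hs.bounds
  have hw0 : w ≠ 0 := by omega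
  have d1 := Nat.div_le_self (5 * m / 3 - c) (Nat.log 2 (2 ^ w - 1))
  have d2 := Nat.div_le_self (m + c) (Nat.log 2 (2 ^ w - 1))
  have d3 := Nat.div_le_self (n / (w / 400) + 1) (Nat.log (n + 1) (2 ^ w - 1))
  have d4 := Nat.div_le_self (2 * (m * (w / 400))) (Nat.log 3 (2 ^ w - 1))
  have d4' := Nat.div_le_self n (Nat.log 3 (2 ^ w - 1))
  have d5 := Nat.div_le_self n (w / 400)
  have e1 : 2 * m * (w / 400) = 2 * (m * (w / 400)) := by ring
  have e2 : 8 * m * (w / 400) = 8 * (m * (w / 400)) := by ring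
  have hfx : ∀ x : Fin 32, 24 ≤ x → x = 24 ∨ x = 25 ∨ x = 26 ∨ x = 27 ∨ x = 28 ∨ x = 29 ∨
      x = 30 ∨ x = 31 := by decide
  refine WP.seq_assign (by simp; omega) (WP.seq_assign ?_ (WP.seq_assign ?_ (WP.seq_assign ?_ ?_)))
  · simp [NState.set_v, h20, e2]; omega
  · simp [NState.set_v, h20, h21, h24]; omega
  · simp [NState.set_v, h20, h21, h24]; omega
  · by_cases hlow : 8 * m * (w / 400) ≤ n
    · refine WP.ite (by simp) (fun _ => ?_) fun hb => ?_
      · refine WP.seq_assign ?_ (WP.assign ?_ ?_)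
        · simp [NState.set_v, h20, h21, h24, h26]; omega
        · simp [NState.set_v, h20, h21, h24, h26, h25, e1]; omega
        · refine hQ _ rfl (fun x hx => ?_) ?_
          · rcases hfx x hx with rfl | rfl | rfl | rfl | rfl | rfl | rfl | rfl <;>
              simp [NState.set_v, Layout.fx, plan, h20, h21, h24, h25, h26, hlow, mul_comm w 3]
          · simp [NState.set_v, Layout.size, plan, h20, h21, h24, h25, h26, hlow, mul_comm w 3]
      · simp [NState.set_v, h20] at hb; omega
    · refine WP.ite (by simp) (fun hb => ?_) fun _ => ?_
      · simp [NState.set_v, h20] at hb; omega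
      · refine WP.seq_assign ?_ (WP.assign ?_ ?_)
        · simp [NState.set_v, h20, h21, h24, h26]; omega
        · simp [NState.set_v, h20, h21, h24, h26, h25]; omega
        · refine hQ _ rfl (fun x hx => ?_) ?_
          · rcases hfx x hx with rfl | rfl | rfl | rfl | rfl | rfl | rfl | rfl <;>
              simp [NState.set_v, Layout.fx, plan, h20, h21, h24, h25, h26, hlow, mul_comm w 3]
          · simp [NState.set_v, Layout.size, plan, h20, h21, h24, h25, h26, hlow, mul_comm w 3]

theorem WP.zeroFill {a : ℕ} (hw : 400 ≤ w) (hS : S < 2 ^ w) (h8 : s.v 8 = a) (h9 : s.v 9 = S)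
    (haS : a ≤ S)
    (hQ : ∀ s' : NState 32, (∀ i, a ≤ i → i < S → s'.m i = 0) → (∀ i < a, s'.m i = s.m i) →
      Same [8] s s' → Q (S - a) [] s') : WP R S w zeroFill s Q := by
  have hw0 : w ≠ 0 := by omega
  refine WP.loop_inv (fun q o s' => o = [] ∧ s'.v 8 = a + q ∧ a + q ≤ S ∧
    (∀ i, a ≤ i → i < a + q → s'.m i = 0) ∧ (∀ i < a, s'.m i = s.m i) ∧ Same [8] s s')
    (fun s' => S - s'.v 8) ?_ ?_ ?_ ?_
  · exact ⟨rfl, h8, haS, fun i _ _ => by omega, fun _ _ => rfl, fun _ _ => rfl⟩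
  · simp
  · rintro q o s' ⟨rfl, e8, hq, hz, hm, hs⟩ hb
    have e9 : s'.v 9 = S := by rw [hs 9 (by decide), h9]
    have hlt : a + q < S := by by_contra hc; simp [e8, e9, hc] at hb
    refine WP.seq0 (WP.store (by simp) (by simp) (by simpa [e8] using hlt) ⟨rfl, rfl, ?_⟩)
    refine WP.assign (by simp [e8]; omega) ⟨⟨rfl, by simp [e8]; omega, by omega, fun i h1 h2 => ?_,
      fun i hi => ?_, fun y hy => ?_⟩, by simp [e8]; omega⟩
    · simp only [NState.set_m, NState.put_m, Expr.val_var, e8, Expr.val_const]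
      by_cases hi : i = a + q
      · subst hi; simp
      · rw [Function.update_of_ne hi]; exact hz i h1 (by omega)
    · simp only [NState.set_m, NState.put_m, Expr.val_var, e8, Expr.val_const]
      rw [Function.update_of_ne (by omega)]; exact hm i hi
    · have := hs y hy
      simp at hy; simp [NState.set_v, hy, this]
  · rintro q o s' ⟨rfl, e8, hq, hz, hm, hs⟩ hb
    have e9 : s'.v 9 = S := by rw [hs 9 (by decide), h9]
    have hge : ¬ a + q < S := by intro hc; simp [e8, e9, hc] at hb
    obtain rfl : q = S - a := by omega
    exact hQ s' (fun i h1 h2 => hz i h1 (by omega)) hm hs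

theorem DRep.zero {m : ℕ → ℕ} {A T K β cap : ℕ} (posK : 0 < K) (two_le : 2 ≤ β)
    (pow_lt : β ^ K < 2 ^ w) (tab : ∀ j < K, m (T + j) = β ^ j) (tabA : T + K ≤ A)
    (A_le : A + cap / K + 1 ≤ S) (h0 : ∀ a, A ≤ a → a < S → m a = 0) :
    DRep S w m A T K β cap fun _ => 0 := by
  refine ⟨posK, two_le, pow_lt, tab, tabA, A_le, fun i hi => ?_, fun i hi => ?_⟩
  all_goals
    have := DRep.div_le (K := K) hi
    have := Nat.zero_le (i / K)
    rw [h0 _ (by omega) (by omega)]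
  · simp
  · exact Nat.pow_pos (by omega)

end

section

variable {n : ℕ} {G : Digraph (Fin n)} (R : AdjArrays G) (S w : ℕ) (L : Layout) (s : NState 32)

/-- The variables and the tables are as prescribed by the layout, and the arrays other than that of
the block pointers hold zeros. -/
structure Blank : Prop where
  fix : ∀ x : Fin 32, 24 ≤ x → s.v x = L.fx x
  st : DRep S w s.m L.AST 0 L.K2 2 L.cst fun _ => 0
  log : DRep S w s.m L.ALOG 0 L.K2 2 L.clog fun _ => 0
  ptr : DRep S w s.m L.APTR (2 * w) L.KP (n + 1) L.cptr L.p
  col : DRep S w s.m L.ACOL w L.K3 3 L.ccol fun _ => 0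

variable {R S w L s} {Q : ℕ → List OutSymbol → NState 32 → Prop}

theorem Blank.good (h : Blank (n := n) S w L s) :
    Good R S w L s (fun _ => 0) (fun _ => 0) fun _ => 0 :=
  ⟨h.fix, h.st, h.log, h.ptr, _, h.col, fun _ _ => rfl⟩

theorem Blank.of_same {s' : NState 32} (h : Blank (n := n) S w L s) (hm : s'.m = s.m)
    (hv : ∀ x : Fin 32, 24 ≤ x → s'.v x = s.v x) : Blank (n := n) S w L s' :=
  ⟨fun x hx => by rw [hv x hx, h.fix x hx], hm ▸ h.st, hm ▸ h.log, hm ▸ h.ptr, hm ▸ h.col⟩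

theorem Blank.set (h : Blank (n := n) S w L s) {x : Fin 32} (hx : x < 24) (a : ℕ) :
    Blank (n := n) S w L (s.set x a) :=
  h.of_same rfl fun y hy => NState.set_v_ne _ _ (by rintro rfl; exact absurd hy (by simpa using hx))

theorem WP.ptrPass (hs : Sizes n (edgeCount G) (coreCount R n) w)
    (hlow : 8 * edgeCount G * (w / 400) ≤ n)
    (g : Blank (n := n) (plan n (edgeCount G) (coreCount R n) w fun _ => 0).size w
      (plan n (edgeCount G) (coreCount R n) w fun _ => 0) s)
    (hQ : ∀ s' p, Blank (n := n) (plan n (edgeCount G) (coreCount R n) w p).size w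
        (plan n (edgeCount G) (coreCount R n) w p) s' →
      (∀ x, R.touched x → p (x / (w / 400)) < 2 * edgeCount G) →
      (∀ x y, R.touched x → R.touched y → p (x / (w / 400)) = p (y / (w / 400)) →
        x / (w / 400) = y / (w / 400)) → Q n [] s') :
    WP R (plan n (edgeCount G) (coreCount R n) w fun _ => 0).size w ptrPass s Q := by
  obtain ⟨hw, X, h1, h2, h3, h4, h5, h6⟩ := hs.bounds
  have hw0 : w ≠ 0 := by omega
  have hww : 2 * w < 2 ^ w := by omega
  have l2 := Sizes.log_facts (w := w) (β := 2) le_rfl (by omega)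
  have l3 := Sizes.log_facts (w := w) (β := 3) (by norm_num) (by omega)
  have lp := Sizes.log_facts (w := w) (β := n + 1) (by have := hs.n_pos; omega) (by omega)
  have hsz := hs.size_lt (p := fun _ => 0)
  generalize hS : (plan n (edgeCount G) (coreCount R n) w fun _ => 0).size = S at *
  refine WP.seq_assign (by simp) (WP.seq_assign (by simp) ?_)
  refine WP.forUp (fun r q o s' => o = [] ∧ q = r ∧ ∃ p, Blank (n := n) S w
      (plan n (edgeCount G) (coreCount R n) w p) s' ∧
    s'.v 20 ≤ r ∧ s'.v 20 ≤ ∑ x ∈ Finset.range r, (R.deg false x + R.deg true x) ∧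
    (∀ x < r, R.touched x → x / (w / 400) + 1 ≤ s'.v 21 ∧ p (x / (w / 400)) < s'.v 20) ∧
    (s'.v 21 = 0 ∨ ∃ x < r, R.touched x ∧ x / (w / 400) + 1 = s'.v 21) ∧
    ∀ x < r, ∀ y < r, R.touched x → R.touched y → p (x / (w / 400)) = p (y / (w / 400)) →
        x / (w / 400) = y / (w / 400)) (by omega) ?_ ?_ ?_
  · exact ⟨rfl, rfl, fun _ => 0, ((g.set (by decide) _).set (by decide) _).set (by decide) _,
      by simp [NState.set_v], by simp [NState.set_v], by simp, by simp [NState.set_v], by simp⟩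
  · rintro r q o s1 hr ⟨rfl, rfl, p, g1, c1, c2, hlt, hlast, hinj⟩ h16
    have hb16 : q / (w / 400) ≤ n := (Nat.div_le_self _ _).trans hr.le
    have hmark : R.touched q → ∀ s2 : NState 32, s2.m = s1.m → Same [8, 12] s1 s2 →
        WP R S w (.ite (.op .eq (21 : Fin 32)
            (((16 : Fin 32) : Expr 32) / (Expr.wordLength / 400) + .const 1)) .skip
          (.assign 22 (((16 : Fin 32) : Expr 32) / (Expr.wordLength / 400)) ;;
            arrPtr.put 22 (20 : Fin 32) ;;
            .assign 20 (((20 : Fin 32) : Expr 32) + .const 1) ;;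
            .assign 21 (((22 : Fin 32) : Expr 32) + .const 1))) s2
          fun q' o' s'' => s''.v 16 = q ∧ [] ++ o' = [] ∧ q + 1 + q' = q + 1 ∧ ∃ p,
            Blank (n := n) S w (plan n (edgeCount G) (coreCount R n) w p) (s''.set 16 (q + 1)) ∧
            (s''.set 16 (q + 1)).v 20 ≤ q + 1 ∧ (s''.set 16 (q + 1)).v 20 ≤
              ∑ x ∈ Finset.range (q + 1), (R.deg false x + R.deg true x) ∧
            (∀ x < q + 1, R.touched x → x / (w / 400) + 1 ≤ (s''.set 16 (q + 1)).v 21 ∧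
              p (x / (w / 400)) < (s''.set 16 (q + 1)).v 20) ∧
            ((s''.set 16 (q + 1)).v 21 = 0 ∨ ∃ x < q + 1, R.touched x ∧
              x / (w / 400) + 1 = (s''.set 16 (q + 1)).v 21) ∧
            ∀ x < q + 1, ∀ y < q + 1, R.touched x → R.touched y →
              p (x / (w / 400)) = p (y / (w / 400)) → x / (w / 400) = y / (w / 400) := by
      intro ht s2 m2 f2
      have g2 := g1.of_same (s' := s2) m2 fun x hx => f2 x (by
        simp; refine ⟨?_, ?_⟩ <;> rintro rfl <;> exact absurd hx (by decide))
      have e16 : s2.v 16 = q := by rw [f2 16 (by decide), h16]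
      have e20 : s2.v 20 = s1.v 20 := f2 20 (by decide)
      have e21 : s2.v 21 = s1.v 21 := f2 21 (by decide)
      have hpos : 1 ≤ R.deg false q + R.deg true q := by rcases ht with h | h <;> omega
      have hb17 : q / (w / 400) + 1 < 2 ^ w := (Nat.succ_le_succ hb16).trans_lt (by omega)
      have h400 : 400 < 2 ^ w := by omega
      refine WP.ite (by simpa [e16] using ⟨h400, hw0, hb17⟩) (fun hb => ?_) fun hb => ?_
      · -- the block has a number already
        have hblk : s1.v 21 = q / (w / 400) + 1 := by
          by_contra hc; simp [e16, e21, hc] at hb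
        obtain ⟨y, hy, hyt, hyb⟩ := hlast.resolve_left (by rw [hblk]; exact Nat.succ_ne_zero _)
        have hyb' : y / (w / 400) = q / (w / 400) := by omega
        have hq1 := hlt y hy hyt
        refine WP.skip ⟨e16, rfl, rfl, p, g2.set (by decide) _, ?_, ?_, fun x hx hxt => ?_, ?_,
          fun x hx z hz hxt hzt he => ?_⟩
        · simp [NState.set_v, e20]; omega
        · simp [NState.set_v, e20, Finset.sum_range_succ]; omega
        · simp only [NState.set_v, e20, e21]
          simp only [show (21 : Fin 32) ≠ 16 by decide, show (20 : Fin 32) ≠ 16 by decide, if_false]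
          rcases Nat.lt_succ_iff_lt_or_eq.1 hx with hx | rfl
          · exact hlt x hx hxt
          · rw [← hyb']; exact hq1
        · right
          exact ⟨y, by omega, hyt, by simp [NState.set_v, e21, hyb]⟩
        · have hrep : ∀ x < q + 1, R.touched x →
              ∃ x' < q, R.touched x' ∧ x' / (w / 400) = x / (w / 400) := by
            intro x hx hxt
            rcases Nat.lt_succ_iff_lt_or_eq.1 hx with hx | rfl
            · exact ⟨x, hx, hxt, rfl⟩
            · exact ⟨y, hy, hyt, hyb'⟩
          obtain ⟨x', a1, a2, a3⟩ := hrep x hx hxt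
          obtain ⟨z', b1, b2, b3⟩ := hrep z hz hzt
          rw [← a3, ← b3] at he ⊢
          exact hinj x' a1 z' b1 a2 b2 he
      · have hblk : s1.v 21 ≠ q / (w / 400) + 1 := by
          intro hc; simp [e16, e21, hc] at hb
        have hnew : ∀ y < q, R.touched y → y / (w / 400) ≠ q / (w / 400) := by
          intro y hy hyt he
          have := (hlt y hy hyt).1
          have := Nat.zero_le (y / (w / 400))
          rcases hlast with h0 | ⟨z, hz, hzt, hzb⟩
          · omega
          · have := Nat.div_le_div_right (c := w / 400) hz.le
            have := Nat.zero_le (z / (w / 400))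
            omega
        refine WP.seq_assign (by simp; omega) ?_
        simp only [Expr.val_div, Expr.val_var, e16, Expr.val_wordLength, Expr.val_ofNat]
        have g3 := g2.set (x := 22) (by decide) (q / (w / 400))
        have hcp : q / (w / 400) < (plan n (edgeCount G) (coreCount R n) w p).cptr := by
          have := Nat.div_le_div_right (c := w / 400) hr.le
          simp only [plan, if_pos hlow]
          exact Nat.lt_succ_of_le this
        refine WP.seq0 (WP.dput g3.ptr hsz.1 (g3.fix _ (by decide)) (g3.fix _ (by decide))
          (by decide) (by decide) (by decide) (by decide) (by decide) (by decide)
          (fun s' => ?_) (fun s' => ?_) (by simpa using hcp) (ev := s1.v 20)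
          (fun t z => ⟨by simp, by simp [NState.set_v, e20]⟩) (by omega)
          fun t z m' hm hf => ⟨rfl, rfl, ?_⟩)
        · simp [arrPtr, mul_comm w 2]; omega
        · simp [arrPtr]; omega
        · simp only [NState.set_v_self] at hm
          have g4 : Blank (n := n) S w (plan n (edgeCount G) (coreCount R n) w
              (Function.update p (q / (w / 400)) (s1.v 20)))
              ⟨((((s2.set 22 (q / (w / 400))).set 0 t).set 1 z)).v, m'⟩ := by
            simp only [NState.set_m] at hf
            have z1 := Nat.zero_le ((plan n (edgeCount G) (coreCount R n) w p).cst /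
              (plan n (edgeCount G) (coreCount R n) w p).K2)
            have z2 := Nat.zero_le ((plan n (edgeCount G) (coreCount R n) w p).clog /
              (plan n (edgeCount G) (coreCount R n) w p).K2)
            have z3 := Nat.zero_le ((plan n (edgeCount G) (coreCount R n) w p).cptr /
              (plan n (edgeCount G) (coreCount R n) w p).KP)
            have o0 : (plan n (edgeCount G) (coreCount R n) w p).AST = 3 * w := rfl
            have o1 : (plan n (edgeCount G) (coreCount R n) w p).ALOG =
              (plan n (edgeCount G) (coreCount R n) w p).AST +
              (plan n (edgeCount G) (coreCount R n) w p).cst /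
              (plan n (edgeCount G) (coreCount R n) w p).K2 + 1 := rfl
            have o2 : (plan n (edgeCount G) (coreCount R n) w p).APTR =
              (plan n (edgeCount G) (coreCount R n) w p).ALOG +
              (plan n (edgeCount G) (coreCount R n) w p).clog /
              (plan n (edgeCount G) (coreCount R n) w p).K2 + 1 := rfl
            have o3 : (plan n (edgeCount G) (coreCount R n) w p).ACOL =
              (plan n (edgeCount G) (coreCount R n) w p).APTR +
              (plan n (edgeCount G) (coreCount R n) w p).cptr /
              (plan n (edgeCount G) (coreCount R n) w p).KP + 1 := rfl
            have k2 : (plan n (edgeCount G) (coreCount R n) w p).K2 ≤ w := l2.2.1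
            have k3 : (plan n (edgeCount G) (coreCount R n) w p).K3 ≤ w := l3.2.1
            refine ⟨fun y hy => ?_, ?_, ?_, hm, ?_⟩
            · exact ((g3.set (x := 0) (by decide) t).set (x := 1) (by decide) z).fix y hy
            · exact g3.st.frame (fun a _ _ => hf a (by omega)) fun a _ _ => hf a (by omega)
            · exact g3.log.frame (fun a _ _ => hf a (by omega)) fun a _ _ => hf a (by omega)
            · exact g3.col.frame (fun a _ _ => hf a (by omega)) fun a _ _ => hf a (by omega)
          refine WP.seq_assign (by simp [NState.set_v, e20]; omega)
            (WP.assign (by simp [NState.set_v]; omega) ?_)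
          refine ⟨by simp [NState.set_v, e16], rfl, rfl, _, ((g4.set (by decide) _).set
            (by decide) _).set (by decide) _, ?_, ?_, fun x hx hxt => ?_, ?_,
            fun x hx y hy hxt hyt => ?_⟩
          · simp [NState.set_v, e20]; omega
          · simp [NState.set_v, e20, Finset.sum_range_succ]; omega
          · have k21 : ((((NState.mk ((((s2.set 22 (q / (w / 400))).set 0 t).set 1 z)).v m').set 20
                (s1.v 20 + 1)).set 21 (q / (w / 400) + 1)).set 16 (q + 1)).v 21 =
                  q / (w / 400) + 1 := by simp [NState.set_v]
            have hxq := Nat.div_le_div_right (c := w / 400) (Nat.lt_succ_iff.1 hx)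
            simp [NState.set_v, e20]
            refine ⟨hxq, ?_⟩
            by_cases hxb : x / (w / 400) = q / (w / 400)
            · simp [hxb]
            · rw [Function.update_of_ne hxb]
              have hxq' : x < q := lt_of_le_of_ne (Nat.lt_succ_iff.1 hx) fun h => hxb (by rw [h])
              have := (hlt x hxq' hxt).2
              omega
          · right
            exact ⟨q, by omega, ht, by simp [NState.set_v]⟩
          · rcases Nat.lt_succ_iff_lt_or_eq.1 hx with hx | rfl <;>
              rcases Nat.lt_succ_iff_lt_or_eq.1 hy with hy | rfl
            · rw [Function.update_of_ne (hnew x hx hxt), Function.update_of_ne (hnew y hy hyt)]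
              exact hinj x hx y hy hxt hyt
            · rw [Function.update_of_ne (hnew x hx hxt), Function.update_self]
              have := (hlt x hx hxt).2
              omega
            · rw [Function.update_of_ne (hnew y hy hyt), Function.update_self]
              have := (hlt y hy hyt).2
              omega
            · exact fun _ => rfl
    refine WP.byDegrees (by omega) h16 hr (fun hc => hmark hc.touched)
      (fun a _ => hmark (.inl a)) (fun _ a => hmark (.inr a)) fun a1 a2 s2 m2 f2 => ?_
    have ht : ¬ R.touched q := by rintro (h | h) <;> omega
    have hne : ∀ x < q + 1, R.touched x → x < q := fun x hx hxt =>
      lt_of_le_of_ne (Nat.lt_succ_iff.1 hx) (by rintro rfl; exact ht hxt)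
    have g2 := g1.of_same (s' := s2) m2 fun x hx => f2 x (by
      simp; refine ⟨?_, ?_⟩ <;> rintro rfl <;> exact absurd hx (by decide))
    have e20 : (s2.set 16 (q + 1)).v 20 = s1.v 20 := by simp [NState.set_v, f2]
    have e21 : (s2.set 16 (q + 1)).v 21 = s1.v 21 := by simp [NState.set_v, f2]
    refine WP.skip ⟨by rw [f2 16 (by decide), h16], rfl, rfl, p, g2.set (by decide) _, ?_⟩
    rw [e20, e21, Finset.sum_range_succ]
    exact ⟨by omega, by omega, fun x hx hxt => hlt x (hne x hx hxt) hxt,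
      hlast.imp_right fun ⟨y, hy, h⟩ => ⟨y, by omega, h⟩,
      fun x hx y hy hxt hyt => hinj x (hne x hx hxt) y (hne y hy hyt) hxt hyt⟩
  · rintro q o s' ⟨rfl, rfl, p, g', c1, c2, hlt, hlast, hinj⟩
    have hsum : ∑ x ∈ Finset.range q, (R.deg false x + R.deg true x) = 2 * edgeCount G := by
      rw [Finset.sum_add_distrib, R.sum_deg, R.sum_deg]; ring
    rw [hsum] at c2
    refine hQ s' p (by
      have : (plan q (edgeCount G) (coreCount R q) w p).size = S := hS
      rw [this]; exact g') (fun x hx => ?_) fun x y hx hy => hinj x hx.lt y hy.lt hx hy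
    have := (hlt x hx.lt hx).2
    omega

theorem WP.initCmd (hs : Sizes n (edgeCount G) (coreCount R n) w)
    (hS : S = (plan n (edgeCount G) (coreCount R n) w fun _ => 0).size)
    (hQ : ∀ q s' L, Good R S w L s' (fun _ => 0) (fun _ => 0) (fun _ => 0) → L.Valid R S w →
      L.Caps R → s'.v 6 = 0 → s'.v 7 = 0 → q ≤ 2 * n + S → Q q [] s') :
    WP R S w initCmd s Q := by
  obtain ⟨hw, X, h1, h2, h3, h4, h5, h6⟩ := hs.bounds
  have hw0 : w ≠ 0 := by omega
  have l2 := Sizes.log_facts (w := w) (β := 2) le_rfl (by omega)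
  have l3 := Sizes.log_facts (w := w) (β := 3) (by norm_num) (by omega)
  have lp := Sizes.log_facts (w := w) (β := n + 1) (by have := hs.n_pos; omega) (by omega)
  have hsz : S < 2 ^ w := hS ▸ hs.size_lt.1
  have hcs : coreCount R n ≤ 5 * edgeCount G / 3 := by
    have := coreCount_add_stTot_le R
    omega
  have hpow : 2 ^ w = 2 * 2 ^ (w - 1) := by rw [← pow_succ']; congr 1; omega
  let L0 := plan n (edgeCount G) (coreCount R n) w fun _ => 0
  have o0 : L0.AST = 3 * w := rfl
  have o1 : L0.ALOG = L0.AST + L0.cst / L0.K2 + 1 := rfl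
  have o2 : L0.APTR = L0.ALOG + L0.clog / L0.K2 + 1 := rfl
  have o3 : L0.ACOL = L0.APTR + L0.cptr / L0.KP + 1 := rfl
  have o4 : S = L0.ACOL + L0.ccol / L0.K3 + 1 := hS
  have z1 := Nat.zero_le (L0.cst / L0.K2)
  have z2 := Nat.zero_le (L0.clog / L0.K2)
  have z3 := Nat.zero_le (L0.cptr / L0.KP)
  have z4 := Nat.zero_le (L0.ccol / L0.K3)
  have k2 : L0.K2 ≤ w := l2.2.1
  have k3 : L0.K3 ≤ w := l3.2.1
  have kp : L0.KP ≤ w := lp.2.1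
  refine WP.seq (WP.countPass (by omega) (by omega) fun s1 m1 h20 h21 => ?_)
  refine WP.seq_assign (by simp; omega) ?_
  have hM : (Expr.op .shl (.const 1) (Expr.wordLength - .const 1) - .const 1 +
    .op .shl (.const 1) (Expr.wordLength - .const 1) : Expr 32).val n w s1 = 2 ^ w - 1 := by
    simp; omega
  rw [hM]
  refine WP.seq (WP.powTable (Tv := 0) (b := 2) (by omega) hsz (by simp) (by decide) (by decide)
    (fun s' => by simp) (fun s' => by simp; omega) le_rfl (by omega)
    (by have : L0.K2 = Nat.log 2 (2 ^ w - 1) := rfl; omega) fun s2 t24 tab2 _ f2 => ?_)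
  refine WP.seq (WP.powTable (Tv := w) (b := 3) (by omega) hsz
    (by rw [f2 22 (by decide)]; simp) (by decide) (by decide)
    (fun s' => by simp) (fun s' => by simp; omega) (by norm_num) (by omega)
    (by have : L0.K3 = Nat.log 3 (2 ^ w - 1) := rfl; omega) fun s3 t25 tab3 m3 f3 => ?_)
  refine WP.seq (WP.powTable (Tv := 2 * w) (b := n + 1) (by omega) hsz
    (by rw [f3 22 (by decide), f2 22 (by decide)]; simp) (by decide) (by decide)
    (fun s' => by simp [mul_comm w 2]; omega) (fun s' => by simp; omega)
    (by have := hs.n_pos; omega) (by omega)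
    (by have : L0.KP = Nat.log (n + 1) (2 ^ w - 1) := rfl; omega) fun s4 t26 tab4 m4 f4 => ?_)
  have e20 : s4.v 20 = edgeCount G := by
    rw [f4 20 (by decide), f3 20 (by decide), f2 20 (by decide)]; simp [NState.set_v, h20]
  have e21 : s4.v 21 = coreCount R n := by
    rw [f4 21 (by decide), f3 21 (by decide), f2 21 (by decide)]; simp [NState.set_v, h21]
  refine WP.seq0 (WP.planCmd hs e20 e21
    (by rw [f4 24 (by decide), f3 24 (by decide), t24]) (by rw [f4 25 (by decide), t25]) t26 hcs
    fun s5 m5 hfx h9 => ⟨rfl, rfl, ?_⟩)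
  refine WP.seq_assign (by simp) ?_
  have e27 : s5.v 27 = 3 * w := hfx 27 (by decide)
  simp only [Expr.val_var, e27]
  refine WP.seq (WP.zeroFill (a := 3 * w) (by omega) hsz (by simp)
    (by simp [NState.set_v]; rw [h9, hS]) (by omega) fun s6 hz hm6 f6 => ?_)
  have hlowmem : ∀ a < 3 * w, s6.m a = s4.m a := fun a ha => by rw [hm6 a ha]; simp [m5]
  have tabs2 : ∀ j < L0.K2, s6.m (0 + j) = 2 ^ j := fun j hj => by
    rw [hlowmem _ (by omega), m4 _ (by omega), m3 _ (by omega), tab2 j hj]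
  have g6 : Blank (n := n) S w L0 s6 := by
    refine ⟨fun x hx => ?_, ?_, ?_, ?_, ?_⟩
    · rw [f6 x (by simp; rintro rfl; exact absurd hx (by decide))]
      rw [NState.set_v_ne _ _ (by rintro rfl; exact absurd hx (by decide))]
      exact hfx x hx
    · exact DRep.zero l2.1 le_rfl l2.2.2 tabs2 (by omega) (by omega)
        fun a a1 a2 => hz a (by omega) a2
    · exact DRep.zero l2.1 le_rfl l2.2.2 tabs2 (by omega) (by omega)
        fun a a1 a2 => hz a (by omega) a2
    · exact DRep.zero lp.1 (by have := hs.n_pos; omega) lp.2.2 (fun j hj => by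
        have : j < L0.KP := hj
        rw [hlowmem _ (by omega), tab4 j hj]) (by omega) (by omega)
        fun a a1 a2 => hz a (by omega) a2
    · exact DRep.zero l3.1 (by norm_num) l3.2.2 (fun j hj => by
        have : j < L0.K3 := hj
        rw [hlowmem _ (by omega), m4 _ (by omega), tab3 j hj]) (by omega) (by omega)
        fun a a1 a2 => hz a (by omega) a2
  have e31 : s6.v 31 = if 8 * edgeCount G * (w / 400) ≤ n then 1 else 0 := g6.fix 31 (by decide)
  have hfin : ∀ (s7 : NState 32) (p : ℕ → ℕ) (q : ℕ), q ≤ n →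
      Blank (n := n) S w (plan n (edgeCount G) (coreCount R n) w p) s7 →
      (8 * edgeCount G * (w / 400) ≤ n →
      (∀ x, R.touched x → p (x / (w / 400)) < 2 * edgeCount G) ∧
      ∀ x y, R.touched x → R.touched y → p (x / (w / 400)) = p (y / (w / 400)) →
        x / (w / 400) = y / (w / 400)) →
      WP R S w (.assign 6 (.const 0) ;; .assign 7 (.const 0)) s7 fun q' o s' =>
        Q (n + (Nat.log 2 (2 ^ w - 1) + (Nat.log 3 (2 ^ w - 1) + (Nat.log (n + 1) (2 ^ w - 1) +
          (S - 3 * w + (q + q')))))) o s' := by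
    intro s7 p q hq g7 hp
    refine WP.seq_assign (by simp) (WP.assign (by simp) ?_)
    refine hQ _ _ (plan n (edgeCount G) (coreCount R n) w p)
      ((g7.good.set (by decide) _).set (by decide) _) ?_ (plan_caps R) (by simp [NState.set_v])
      (by simp [NState.set_v]) ?_
    · have := plan_valid hs hp
      rw [hS]; exact this
    · have a2 : Nat.log 2 (2 ^ w - 1) ≤ w := l2.2.1
      omega
  refine WP.seq (WP.ite (by simp) (fun hb => ?_) fun hb => ?_)
  · have hlow : 8 * edgeCount G * (w / 400) ≤ n := by
      by_contra hc; simp [e31, hc] at hb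
    have := WP.ptrPass (s := s6) (Q := fun q o s' =>
      WP R S w (.assign 6 (.const 0) ;; .assign 7 (.const 0)) s' fun q' o' s'' =>
        Q (n + (Nat.log 2 (2 ^ w - 1) + (Nat.log 3 (2 ^ w - 1) + (Nat.log (n + 1) (2 ^ w - 1) +
          (S - 3 * w + (q + q')))))) (o ++ o') s'') hs hlow (hS ▸ g6) fun s' p g7 p1 p2 =>
            hfin s' p n le_rfl (by
              have e : (plan n (edgeCount G) (coreCount R n) w p).size = S := hS.symm
              rwa [e] at g7) fun _ => ⟨p1, p2⟩
    rw [← hS] at this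
    simpa only [List.nil_append] using this
  · have hlow : ¬ 8 * edgeCount G * (w / 400) ≤ n := by
      intro hc; simp [e31, hc] at hb
    refine WP.skip ?_
    simpa using hfin s6 (fun _ => 0) 0 (Nat.zero_le _) g6 fun h => absurd h hlow

end

/-! ### The program -/

/-- The program that computes the strongly connected components. -/
def sccProgram (vs es : Bool) : Cmd 32 :=
  initCmd ;; trivialPass vs ;; logPass vs es ;; recolorPass ;; undoPass vs es

section

variable {n : ℕ} {G : Digraph (Fin n)} {R : AdjArrays G} {S w : ℕ} {s : NState 32}
  {Q : ℕ → List OutSymbol → NState 32 → Prop} {r : ℕ} {l F : List ℕ} {C : List (List ℕ)}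

theorem Hist1.cInv (h : Hist1 R n l F) : CInv R (trivComps R n) F := by
  have hf := (flatten_trivComps (R := R) (r := n)).2
  refine ⟨⟨fun x hx hc => (hf x).2 ⟨hx, hc⟩, fun u x h1 h2 h3 => ?_, fun x hx => .inl ?_⟩,
    flatten_trivComps.1, fun D hD => ?_⟩
  · -- a successor has an incoming edge, so that it is not trivial if it has an outgoing edge, too
    exact absurd ⟨h2, h1.pos_codeg⟩ ((hf x).1 h3).2
  · exact h.mem x hx.lt hx
  · obtain ⟨x, hx, hc, rfl⟩ := mem_trivComps.1 hD
    exact AdjArrays.isComp_singleton hx hc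

theorem CInv.sum_le (h : CInv R C F) :
    (C.flatten.map R.cost).sum ≤ n + 10 * edgeCount G := by
  rw [← AdjArrays.sum_cost (R := R)]
  refine sum_map_le_sum_range h.nodup (fun x hx => ?_) _
  obtain ⟨D, hD, hx⟩ := List.mem_flatten.1 hx
  exact (h.comp D hD).lt hx

theorem CInv.isSCCOutput {vs es : Bool} (h : CInv R C []) :
    IsSCCOutput G vs es (outOf R vs es C) := by
  refine isSCCOutput_outOf h.comp h.nodup fun x hx => ?_
  by_cases hc : R.core x
  · simpa using h.inv.cover x hc
  · exact h.inv.triv x hx hc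

theorem WP.sccProgram (vs es : Bool) (hs : Sizes n (edgeCount G) (coreCount R n) w)
    (hS : S = (plan n (edgeCount G) (coreCount R n) w fun _ => 0).size) :
    WP R S w (sccProgram vs es) s fun q o _ =>
      q ≤ 10 * n + 40 * edgeCount G + S ∧ IsSCCOutput G vs es o := by
  refine WP.seq (WP.initCmd hs hS fun q1 s1 L g1 hL hC h6 h7 hq1 => ?_)
  refine WP.seq (WP.trivialPass vs es hL g1 fun q2 s2 g2 h15 f2 hq2 => ?_)
  refine WP.seq (WP.logPass vs es hL hC g2 (by rw [f2 6 (by decide), h6])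
    (by rw [f2 7 (by decide), h7]) fun q3 s3 l F log st hH g3 hl h7' f3 hq3 => ?_)
  have hf := (flatten_trivComps (R := R) (r := n)).2
  refine WP.seq (WP.recolorPass (A := (trivComps R n).flatten)
    (fun x hx => by rw [hf]; exact and_iff_right hx) hL g3 fun s4 g4 f4 => ?_)
  refine WP.undoPass vs es hL hC hH hH.cInv ⟨⟨log, g4, hl⟩, by rw [f4 7 (by decide), h7'],
    by rw [f4 15 (by decide), f3 15 (by decide), h15]⟩
    (by rw [f4 6 (by decide), f3 6 (by decide), f2 6 (by decide), h6])
    fun q5 o s5 C hI ho hq5 => ?_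
  have hF := sum_map_le_sum_range (n := n) hH.nodup (fun x hx => (hH.core x hx).lt) R.cost
  rw [AdjArrays.sum_cost] at hF
  have hCs := hI.sum_le
  have e : compCost R C = 2 * (C.flatten.map R.cost).sum := rfl
  refine ⟨by omega, ?_⟩
  simp only [List.nil_append]
  rw [ho]
  exact hI.isSCCOutput

end

/-! ### The space bound -/

theorem three_half_le_logb : (3 / 2 : ℝ) ≤ Real.logb 2 3 := by
  rw [Real.le_logb_iff_rpow_le (by norm_num) (by norm_num)]
  have h : ((2 : ℝ) ^ (3 / 2 : ℝ)) ^ 2 ≤ 3 ^ 2 := by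
    rw [← Real.rpow_natCast, ← Real.rpow_mul (by norm_num)]
    norm_num
  exact (pow_le_pow_iff_left₀ (by positivity) (by norm_num) (by norm_num)).1 h

theorem logb_le_eight_fifths : Real.logb 2 3 ≤ (8 / 5 : ℝ) := by
  rw [Real.logb_le_iff_le_rpow (by norm_num) (by norm_num)]
  have h : (3 : ℝ) ^ 5 ≤ ((2 : ℝ) ^ (8 / 5 : ℝ)) ^ 5 := by
    rw [← Real.rpow_natCast _ 5, ← Real.rpow_natCast (2 ^ _), ← Real.rpow_mul (by norm_num)]
    norm_num
  exact (pow_le_pow_iff_left₀ (by norm_num) (by positivity) (by norm_num)).1 h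

/-- The number of digits of base `b` in a word is at least `w / log₂ b - 1`. -/
theorem le_log_add_one_mul_logb {b w : ℕ} (hb : 2 ≤ b) :
    (w : ℝ) ≤ (Nat.log b (2 ^ w - 1) + 1) * Real.logb 2 b := by
  have h1 : 2 ^ w ≤ b ^ (Nat.log b (2 ^ w - 1) + 1) := by
    have := Nat.lt_pow_succ_log_self (b := b) hb (2 ^ w - 1)
    rw [Nat.succ_eq_add_one] at this
    omega
  have h2 : ((2 : ℝ) ^ w) ≤ (b : ℝ) ^ (Nat.log b (2 ^ w - 1) + 1) := by exact_mod_cast h1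
  have h3 := Real.logb_le_logb_of_le (b := 2) (by norm_num) (by positivity) h2
  rw [Real.logb_pow, Real.logb_pow, Real.logb_self_eq_one (by norm_num)] at h3
  push_cast at h3
  linarith

/-- The bits in the words of an array of `c` digits, `K` to a word. -/
theorem mul_div_le {w c K : ℕ} {a : ℝ} (hK : 0 < K) (h : (w : ℝ) ≤ a * K) :
    (w : ℝ) * (c / K : ℕ) ≤ a * c := by
  have hK' : (0 : ℝ) < K := by exact_mod_cast hK
  calc (w : ℝ) * (c / K : ℕ) ≤ w * ((c : ℝ) / K) :=
        mul_le_mul_of_nonneg_left Nat.cast_div_le (Nat.cast_nonneg _)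
    _ ≤ a * K * ((c : ℝ) / K) := mul_le_mul_of_nonneg_right h (by positivity)
    _ = a * c := by field_simp

theorem logb_le_log_add_one {n : ℕ} : Real.logb 2 ((n + 1 : ℕ) : ℝ) ≤ (Nat.log 2 n + 1 : ℕ) := by
  have h1 : n + 1 ≤ 2 ^ (Nat.log 2 n + 1) := Nat.lt_pow_succ_log_self (by norm_num) n
  have h2 : ((n + 1 : ℕ) : ℝ) ≤ (2 : ℝ) ^ (Nat.log 2 n + 1) := by exact_mod_cast h1
  have h3 := Real.logb_le_logb_of_le (b := 2) (by norm_num) (by positivity) h2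
  rwa [Real.logb_pow, Real.logb_self_eq_one (by norm_num), mul_one] at h3

theorem log_add_one_le_two_mul_logb {n : ℕ} (hn : 0 < n) :
    ((Nat.log 2 n + 1 : ℕ) : ℝ) ≤ 2 * Real.logb 2 ((n : ℝ) + 1) := by
  have hn1 : (1 : ℝ) ≤ n := by exact_mod_cast hn
  have h1 : (1 : ℝ) ≤ Real.logb 2 ((n : ℝ) + 1) := by
    rw [Real.le_logb_iff_rpow_le (by norm_num) (by linarith)]
    norm_num; linarith
  have h2 : (Nat.log 2 n : ℝ) ≤ Real.logb 2 ((n : ℝ) + 1) := by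
    rw [Real.le_logb_iff_rpow_le (by norm_num) (by linarith), Real.rpow_natCast]
    have : 2 ^ Nat.log 2 n ≤ n := Nat.pow_log_le_self 2 (by omega)
    have : ((2 : ℝ) ^ Nat.log 2 n) ≤ n := by exact_mod_cast this
    linarith
  push_cast; linarith

/-- The space taken by the tables.  The stack and the log together have at most `8 * m / 3` bits.  If
there is a color for every vertex, then `m` exceeds `50 * n / w`, so that the incomplete use of the
words for the colors does not matter.  Otherwise, the colors and the block pointers together take
less than `n / 2` bits. -/
theorem Sizes.mul_size_le {n m c w : ℕ} (h : Sizes n m c w) (hc : c ≤ 5 * m / 3) (p : ℕ → ℕ) :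
    (w : ℝ) * (plan n m c w p).size ≤ n * Real.logb 2 3 + 14 / 5 * m +
      (3 * w * w + 4 * w + 2 * (Nat.log 2 n + 1 : ℕ)) := by
  obtain ⟨hn, -, -, hwn⟩ := id h
  set u := Nat.log 2 n + 1 with hu
  have hu1 : 1 ≤ u := by omega
  have l1 := three_half_le_logb
  have l2 := logb_le_eight_fifths
  have hw : 6800 ≤ w := by omega
  have hwR : (6800 : ℝ) ≤ w := by exact_mod_cast hw
  have huR : (1 : ℝ) ≤ u := by exact_mod_cast hu1
  have hwu : 6800 * (u : ℝ) ≤ w := by exact_mod_cast hwn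
  have hnR : (0 : ℝ) ≤ n := Nat.cast_nonneg _
  have hmR : (0 : ℝ) ≤ m := Nat.cast_nonneg _
  obtain ⟨X, b1, b2, b3, -⟩ := h.bounds.2
  set K2 := Nat.log 2 (2 ^ w - 1) with hK2
  set K3 := Nat.log 3 (2 ^ w - 1) with hK3
  set KP := Nat.log (n + 1) (2 ^ w - 1) with hKP
  have p2 : 0 < K2 := (Sizes.log_facts (w := w) le_rfl (by omega)).1
  have p3 : 0 < K3 := (Sizes.log_facts (w := w) (by norm_num) (by omega)).1
  have pP : 0 < KP := (Sizes.log_facts (w := w) (by omega) (by omega)).1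
  -- the words are nearly filled
  have e2 : (w : ℝ) ≤ 10002 / 10000 * K2 := by
    have := le_log_add_one_mul_logb (b := 2) (w := w) le_rfl
    rw [← hK2] at this
    norm_num at this
    linarith
  have e3 : (w : ℝ) ≤ (K3 + 1) * Real.logb 2 3 := by
    simpa using le_log_add_one_mul_logb (b := 3) (w := w) (by norm_num)
  have e3' : (w : ℝ) ≤ 8 / 5 * (K3 + 1) := by
    have : (0 : ℝ) ≤ K3 := Nat.cast_nonneg _
    nlinarith
  have eP : (w : ℝ) ≤ 1001 / 1000 * u * KP := by
    have h1 := le_log_add_one_mul_logb (b := n + 1) (w := w) (by omega)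
    have h2 := mul_le_mul_of_nonneg_left (logb_le_log_add_one (n := n))
      (show (0 : ℝ) ≤ KP + 1 by positivity)
    rw [← hu] at h2
    nlinarith
  have hbits : (w : ℝ) * ((5 * m / 3 - c) / K2 : ℕ) + w * ((m + c) / K2 : ℕ) ≤ 2.67 * m := by
    have h1 := mul_div_le (w := w) (c := 5 * m / 3 - c) p2 e2
    have h2 := mul_div_le (w := w) (c := m + c) p2 e2
    have h3 : 3 * (((5 * m / 3 - c : ℕ) : ℝ) + (m + c : ℕ)) ≤ 8 * m := by
      have : 3 * ((5 * m / 3 - c) + (m + c)) ≤ 8 * m := by omega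
      exact_mod_cast this
    linarith
  have hB1 : (((w / 400 : ℕ) : ℝ)) ≤ w / 400 := Nat.cast_div_le
  have hB2 : (w : ℝ) ≤ 400 * ((w / 400 : ℕ) : ℝ) + 400 := by
    have : w ≤ 400 * (w / 400) + 400 := by omega
    exact_mod_cast this
  by_cases hlow : 8 * m * (w / 400) ≤ n
  · have hlowR : 8 * (m : ℝ) * ((w / 400 : ℕ) : ℝ) ≤ n := by exact_mod_cast hlow
    have hcol : (w : ℝ) * ((2 * m * (w / 400)) / K3 : ℕ) ≤ 0.41 * n := by
      have := mul_div_le (w := w) (c := 2 * m * (w / 400)) (a := 1.62) p3 (by linarith)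
      push_cast at this
      linarith
    have hptr : (w : ℝ) * ((n / (w / 400) + 1) / KP : ℕ) ≤ 0.07 * n + 2 * u := by
      have h1 := mul_div_le (w := w) (c := n / (w / 400) + 1) pP eP
      have h2 : (u : ℝ) * (n / (w / 400) : ℕ) ≤ 0.0625 * n := by
        refine mul_div_le (by omega) ?_
        linarith
      push_cast at h1 ⊢
      nlinarith
    have hsz : (plan n m c w p).size = 3 * w + 4 + (5 * m / 3 - c) / K2 + (m + c) / K2 +
        (n / (w / 400) + 1) / KP + 2 * m * (w / 400) / K3 := by
      simp only [Layout.size, plan, if_pos hlow]; ring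
    rw [hsz]
    push_cast only [Nat.cast_add, Nat.cast_mul, Nat.cast_ofNat]
    nlinarith
  · have hm2 : 50 * (n : ℝ) ≤ m * w := by
      have : n ≤ 8 * m * (w / 400) := by omega
      have : (n : ℝ) ≤ 8 * m * ((w / 400 : ℕ) : ℝ) := by exact_mod_cast this
      nlinarith
    have hcol : (w : ℝ) * (n / K3 : ℕ) ≤ n * Real.logb 2 3 + 0.06 * m := by
      have h1 := mul_div_le (w := w) (c := n) (a := Real.logb 2 3 + 2.7 / w) p3 (by
        have : (1.6 : ℝ) ≤ 2.7 / w * K3 := by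
          rw [div_mul_eq_mul_div, le_div_iff₀ (by linarith)]
          linarith
        linarith)
      have h2 : 2.7 / w * n ≤ 0.06 * (m : ℝ) := by
        rw [div_mul_eq_mul_div, div_le_iff₀ (by linarith)]
        linarith
      linarith
    have hsz : (plan n m c w p).size = 3 * w + 4 + (5 * m / 3 - c) / K2 + (m + c) / K2 +
        n / K3 := by
      simp only [Layout.size, plan, if_neg hlow, Nat.zero_div]; ring
    rw [hsz]
    simp only [Nat.cast_add, Nat.cast_mul, Nat.cast_ofNat]
    nlinarith

theorem mainTheorem8 (vs es : Bool) (hmode : vs = true ∨ es = true) :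
    ∃ (k : ℕ) (P : Cmd k) (c : ℕ), ∀ K : ℕ, ∃ C : ℕ,
      ∀ (n : ℕ), 1 ≤ n → ∀ (G : Digraph (Fin n)) (R : AdjArrays G) (w : ℕ),
        c * (Nat.log 2 n + 1) ≤ w → w ≤ K * (Nat.log 2 n + 1) →
        ∃ S : ℕ,
          (workBits P w S : ℝ) ≤
            (n : ℝ) * Real.logb 2 3 + (14 / 5 : ℝ) * (edgeCount G : ℝ)
              + (C : ℝ) * (Real.logb 2 ((n : ℝ) + 1)) ^ 2 ∧
          ∀ σ : State w k, ∃ (t : ℕ) (out : List OutSymbol) (σ' : State w k),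
            Exec R S P σ t out σ' ∧ t ≤ C * (n + edgeCount G) ∧ IsSCCOutput G vs es out := by
  -- the constants of the program are kept from being computed
  obtain ⟨P, hP⟩ : ∃ P, P = sccProgram vs es := ⟨_, rfl⟩
  refine ⟨32, P, 6800, fun K => ⟨4 * ((39 + P.temps) * K ^ 2 + 2) + P.weight * (45 + 3 * K), ?_⟩⟩
  intro n hn G R w hcw hwK
  have hs : Sizes n (edgeCount G) (coreCount R n) w :=
    ⟨hn, edgeCount_le_mul_self R, coreCount_le R, hcw⟩
  have hc : coreCount R n ≤ 5 * edgeCount G / 3 := by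
    have := coreCount_add_stTot_le R
    omega
  refine ⟨(plan n (edgeCount G) (coreCount R n) w fun _ => 0).size, ?_, fun σ => ?_⟩
  · have h1 := hs.mul_size_le hc fun _ => 0
    have h2 := log_add_one_le_two_mul_logb hn
    have h3 : w * (32 + P.temps) + (3 * w * w + 4 * w + 2 * (Nat.log 2 n + 1)) ≤
        ((39 + P.temps) * K ^ 2 + 2) * (Nat.log 2 n + 1) ^ 2 := by
      have hu : Nat.log 2 n + 1 ≤ (Nat.log 2 n + 1) ^ 2 := Nat.le_self_pow two_ne_zero _
      have hw2 : w ≤ w ^ 2 := Nat.le_self_pow two_ne_zero _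
      have hwK2 : w ^ 2 ≤ K ^ 2 * (Nat.log 2 n + 1) ^ 2 := by
        rw [← mul_pow]; exact Nat.pow_le_pow_left hwK 2
      calc _ = w * (36 + P.temps) + 3 * w ^ 2 + 2 * (Nat.log 2 n + 1) := by ring
        _ ≤ w ^ 2 * (36 + P.temps) + 3 * w ^ 2 + 2 * (Nat.log 2 n + 1) ^ 2 := by gcongr
        _ = (39 + P.temps) * w ^ 2 + 2 * (Nat.log 2 n + 1) ^ 2 := by ring
        _ ≤ (39 + P.temps) * (K ^ 2 * (Nat.log 2 n + 1) ^ 2) + 2 * (Nat.log 2 n + 1) ^ 2 := by gcongr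
        _ = _ := by ring
    have h3' : (w : ℝ) * (32 + P.temps) + (3 * w * w + 4 * w + 2 * (Nat.log 2 n + 1 : ℕ)) ≤
        ((39 + P.temps) * K ^ 2 + 2) * ((Nat.log 2 n + 1 : ℕ) : ℝ) ^ 2 := by exact_mod_cast h3
    have h4 : ((Nat.log 2 n + 1 : ℕ) : ℝ) ^ 2 ≤ 4 * Real.logb 2 ((n : ℝ) + 1) ^ 2 := by
      calc _ ≤ (2 * Real.logb 2 ((n : ℝ) + 1)) ^ 2 := pow_le_pow_left₀ (Nat.cast_nonneg _) h2 2
        _ = _ := by ring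
    have h5 := mul_le_mul_of_nonneg_left h4
      (show (0 : ℝ) ≤ (39 + P.temps) * K ^ 2 + 2 by positivity)
    have h6 : (0 : ℝ) ≤ P.weight * (45 + 3 * K) * Real.logb 2 ((n : ℝ) + 1) ^ 2 := by positivity
    rw [workBits]
    push_cast at h1 h3' h4 h5 ⊢
    linarith
  · obtain ⟨t, q, out, σ', he, ht, hq, ho⟩ :=
      WP.exec (by omega) σ (hP ▸ WP.sccProgram vs es hs rfl)
    refine ⟨t, out, σ', he, ht.trans ?_, ho⟩
    have h1 := (hs.size_lt (p := fun _ => 0)).2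
    have h2 : Nat.log 2 n + 1 ≤ n := Nat.log_lt_self 2 (by omega)
    have h3 : w ≤ K * n := hwK.trans (Nat.mul_le_mul_left K h2)
    have h4 : q + 1 ≤ (45 + 3 * K) * (n + edgeCount G) := by nlinarith
    calc P.weight * (q + 1) ≤ P.weight * ((45 + 3 * K) * (n + edgeCount G)) :=
          Nat.mul_le_mul_left _ h4
      _ = P.weight * (45 + 3 * K) * (n + edgeCount G) := by ring
      _ ≤ _ := Nat.mul_le_mul_right _ (Nat.le_add_left _ _)
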